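/- **Conventions.** Let $\Omega\subset\mathbb R^n$ be open and $m\ge 1$. $H^s(\mathbb R^n)$, $s\in\mathbb R$, is the Bessel potential space over $L_2$, and $H^s_{loc}(\Omega)$ is the set of distributions $g$ on $\Omega$ such that, for every $\phi\in\mathcal D(\Omega)$, $\phi g$ is the restriction to $\Omega$ of an element of $H^s(\mathbb R^n)$. Let $a_{ij},b_j,c$ $(i,j=1,\dots,n)$ be functions on $\Omega$ with values in $\mathbb C^{m\times m}$ and $$Lu=-\sum_{i,j=1}^n\partial_i(a_{ij}\,\partial_j u)+\sum_{j=1}^n b_j\,\partial_j u+cu,\qquad L^*u=-\sum_{i,j=1}^n\partial_i(\bar a_{ji}^{\top}\partial_j u)-\sum_{j=1}^n\partial_j(\bar b_j^{\top}u)+\bar c^{\top}u .$$ The equation $Lu=f$ is understood in the distribution sense: $\sum_{i,j}\langle a_{ij}\partial_j u,\partial_i v\rangle+\sum_j\langle b_j\partial_j u,v\rangle+\langle cu,v\rangle=\langle f,v\rangle$ for all $v\in\mathcal D(\Omega)^m$, where products with coefficients are understood by transposition, $\langle gw,\phi\rangle=\langle w,g\phi\rangle$, through the bilinear duality $\langle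 U,V\rangle=\int_{\mathbb R^n}(\mathcal F^{-1}U)(\xi)\,(\mathcal FV)(\xi)\,d\xi$ of $H^s(\mathbb R^n)$ and $H^{-s}(\mathbb R^n)$; similarly $L^*u=f$ means $\sum_{i,j}\langle \bar a_{ij}\partial_j v,\partial_i u\rangle+\sum_j\langle\bar b_j\partial_j v,u\rangle+\langle\bar c v,u\rangle=\langle f,v\rangle$ for all $v\in\mathcal D(\Omega)^m$. A system with leading coefficients $a_{ij}$ is *strongly elliptic* in $\Omega$ if there are a bounded $m\times m$ matrix function $\theta$ on $\Omega$ and a constant $C>0$ such that $\operatorname{Re}\{\bar\zeta^{\top}\theta(x)\sum_{i,j}a_{ij}(x)\xi_i\xi_j\,\zeta\}\ge C|\xi|^2|\zeta|^2$ for almost all $x\in\Omega$ and all $\xi\in\mathbb R^n$, $\zeta\in\mathbb C^m$. The leading coefficients of $L^*$ are $\bar a_{ji}^{\top}$. For $\mu\ge0$, $W^\mu_\infty(\mathbb R^n)$ is the space of functions whose weak derivatives of order $\le[\mu]$ are in $L_\infty(\mathbb R^n)$ and, for non-integer $\mu$, whose derivatives of order $[\mu]$ satisfy a Hölder condition with exponent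 $\mu-[\mu]$ almost everywhere. For open $\Omega'$, $\bar C^\mu(\overline{\Omega'})$ is the set of restrictions to $\Omega'$ of functions from $W^\mu_\infty(\mathbb R^n)$; $\bar C^\mu_+(\overline{\Omega'})$ is $\bar C^\mu(\overline{\Omega'})$ if $\mu$ is an integer and $\bigcup_{\nu>\mu}\bar C^\nu(\overline{\Omega'})$ otherwise. For $\sigma\in\mathbb R$, $\{a,b,c\}\in\mathcal C^\sigma_+(\overline{\Omega'})$ means that (all entries of) $a\in\bar C_+^{|\sigma|}(\overline{\Omega'})$, $b\in\bar C_+^{\max(0,|\sigma-1/2|-1/2)}(\overline{\Omega'})$ and $c\in\bar C_+^{\max(0,|\sigma|-1)}(\overline{\Omega'})$; and $\{a,b,c\}\in\mathcal C^\sigma_{+loc}(\Omega)$ means that this holds for every open $\Omega'$ whose closure is compact and contained in $\Omega$. **Theorem.** Let $s_1,s_2\in\mathbb R$, $s_2>s_1-2$, $u\in H^{s_1}_{loc}(\Omega)^m$ and $f\in H^{s_2}_{loc}(\Omega)^m$. Suppose that $u$ satisfies in $\Omega$ either (a) the strongly elliptic system $Lu=f$ with $\{a,b,c\}\in\mathcal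 C^{s_1-1}_{+loc}(\Omega)\cap\mathcal C^{s_2+1}_{+loc}(\Omega)$, or (b) the strongly elliptic system $L^*u=f$ with $\{a,b,c\}\in\mathcal C^{1-s_1}_{+loc}(\Omega)\cap\mathcal C^{-s_2-1}_{+loc}(\Omega)$. Then $u\in H^{s_2+2}_{loc}(\Omega)^m$. -/

import Mathlib

open MeasureTheory TopologicalSpace Topology FourierTransform TemperedDistribution LineDeriv
open scoped SchwartzMap Distributions ENNReal ContDiff

noncomputable section

namespace EllipticReg

/-- Euclidean space `ℝⁿ`. -/
abbrev RR (n : ℕ) : Type := EuclideanSpace ℝ (Fin n)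

/-- The `i`-th coordinate direction of `ℝⁿ`. -/
abbrev dir {n : ℕ} (i : Fin n) : RR n := EuclideanSpace.single i (1 : ℝ)

/-! ### Test functions and Sobolev (Bessel potential) spaces

Distributions on `Ω` are Mathlib's `𝓓'(Ω, ℂ)`; they are tested against real-valued test functions,
which by complex linearity is the same as testing against complex-valued ones. -/

/-- A test function on `Ω`, regarded as a complex-valued Schwartz function on `ℝⁿ`. -/
def testToSchwartz {n : ℕ} {Ω : Opens (RR n)} (ψ : 𝓓(Ω, ℝ)) : 𝓢(RR n, ℂ) :=
  HasCompactSupport.toSchwartzMap (f := fun x => ((ψ x : ℝ) : ℂ))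
    (ψ.hasCompactSupport.comp_left (g := fun r : ℝ => (r : ℂ)) Complex.ofReal_zero)
    (Complex.ofRealCLM.contDiff.comp ψ.contDiff)

/-- The product of two test functions. -/
def testMul {n : ℕ} {Ω : Opens (RR n)} (φ ψ : 𝓓(Ω, ℝ)) : 𝓓(Ω, ℝ) where
  toFun := fun x => φ x * ψ x
  contDiff' := φ.contDiff.mul ψ.contDiff
  hasCompactSupport' := φ.hasCompactSupport.mul_right
  tsupport_subset' := (tsupport_mul_subset_left (f := φ) (g := ψ)).trans φ.tsupport_subset

/-- `g ∈ H^s_loc(Ω)`: for every `φ ∈ 𝓓(Ω)`, the distribution `φ g` is the restriction to `Ω` of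
some `U ∈ H^s(ℝⁿ)`. -/
def MemHsLoc {n : ℕ} (Ω : Opens (RR n)) (s : ℝ) (g : 𝓓'(Ω, ℂ)) : Prop :=
  ∀ φ : 𝓓(Ω, ℝ), ∃ U : 𝓢'(RR n, ℂ), MemSobolev s 2 U ∧
    ∀ ψ : 𝓓(Ω, ℝ), U (testToSchwartz ψ) = g (testMul φ ψ)

open Classical in
/-- For `U ∈ H^s(ℝⁿ)`, the `L²` function `𝓙^s U`, where `𝓙^s` is the Bessel potential operator
with symbol `(1 + |ξ|²)^{s/2}` (junk value `0` if `U ∉ H^s(ℝⁿ)`). -/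
def besselL2 {n : ℕ} (s : ℝ) (U : 𝓢'(RR n, ℂ)) : Lp ℂ 2 (volume : Measure (RR n)) :=
  if h : MemSobolev s 2 U then h.choose else 0

/-- The bilinear duality `⟨U, V⟩ = ∫ (𝓕⁻¹ U)(ξ) (𝓕 V)(ξ) dξ` between `U ∈ H^s(ℝⁿ)` and
`V ∈ H^{-s}(ℝⁿ)`. The integrand is written as `(𝓕⁻¹ 𝓙^s U) (𝓕 𝓙^{-s} V)`, a product of two `L²`
functions: the (even) symbols of `𝓙^s` and `𝓙^{-s}` cancel. -/
def sobolevDual {n : ℕ} (s : ℝ) (U V : 𝓢'(RR n, ℂ)) : ℂ :=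
  ∫ ξ, (𝓕⁻ (besselL2 s U)) ξ * (𝓕 (besselL2 (-s) V)) ξ

open Classical in
/-- The tempered distribution `ψ ↦ ∫ h ψ` given by a function `h ∈ L²(ℝⁿ)`
(junk value `0` if `h ∉ L²`; below `h` is bounded with compact support). -/
def ofFun {n : ℕ} (h : RR n → ℂ) : 𝓢'(RR n, ℂ) :=
  if hh : MemLp h 2 (volume : Measure (RR n)) then Lp.toTemperedDistribution hh.toLp else 0

/-! ### Hölder–Lipschitz coefficient classes -/

/-- `h` is the weak partial derivative `∂_i g` on `ℝⁿ`. -/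
def HasWeakPartial {n : ℕ} (i : Fin n) (g h : RR n → ℂ) : Prop :=
  ∀ φ : 𝓓((⊤ : Opens (RR n)), ℝ),
    ∫ x, g x * (((∂_{dir i} φ) x : ℝ) : ℂ) = - ∫ x, h x * ((φ x : ℝ) : ℂ)

/-- All weak derivatives of `g` of order at most `k` are in `L_∞(ℝⁿ)`, and those of order `k`
satisfy `|h(x) - h(y)| ≤ C |x - y|^θ` for almost all `(x, y)` (which for `θ = 0` follows from
boundedness). -/
def MemWkInfty {n : ℕ} : ℕ → ℝ → (RR n → ℂ) → Prop
  | 0, θ, g => MemLp g ∞ (volume : Measure (RR n)) ∧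
      ∃ C : ℝ, ∀ᵐ p ∂((volume : Measure (RR n)).prod (volume : Measure (RR n))),
        ‖g p.1 - g p.2‖ ≤ C * ‖p.1 - p.2‖ ^ θ
  | k + 1, θ, g => MemLp g ∞ (volume : Measure (RR n)) ∧
      ∀ i : Fin n, ∃ h : RR n → ℂ, HasWeakPartial i g h ∧ MemWkInfty k θ h

/-- `g ∈ W^μ_∞(ℝⁿ)`, `μ ≥ 0`. -/
def MemWInfty {n : ℕ} (μ : ℝ) (g : RR n → ℂ) : Prop :=
  MemWkInfty ⌊μ⌋₊ (Int.fract μ) g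

/-- `g ∈ C̄^μ(Ω̄)`: on `Ω`, `g` is (a.e. equal to) the restriction of a function in
`W^μ_∞(ℝⁿ)`. -/
def MemCbar {n : ℕ} (Ω : Opens (RR n)) (μ : ℝ) (g : RR n → ℂ) : Prop :=
  ∃ G : RR n → ℂ, MemWInfty μ G ∧ ∀ᵐ x ∂(volume.restrict (Ω : Set (RR n))), g x = G x

/-- `g ∈ C̄^μ_+(Ω̄)`: this is `C̄^μ(Ω̄)` for integer `μ ≥ 0`, and the union of the `C̄^ν(Ω̄)`, `ν > μ`,
for non-integer `μ ≥ 0`. -/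
def MemCbarPlus {n : ℕ} (Ω : Opens (RR n)) (μ : ℝ) (g : RR n → ℂ) : Prop :=
  ((∃ k : ℕ, (k : ℝ) = μ) ∧ MemCbar Ω μ g) ∨
    ((¬ ∃ k : ℕ, (k : ℝ) = μ) ∧ ∃ ν : ℝ, μ < ν ∧ MemCbar Ω ν g)

/-- The coefficients `a_{ij}`, `b_j`, `c` (functions with values in complex `m × m` matrices) of
`L u = - ∑_{i,j} ∂_i (a_{ij} ∂_j u) + ∑_j b_j ∂_j u + c u`. Only their values on the domain `Ω`
(up to null sets) are used. -/
structure Coeffs (n m : ℕ) where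
  a : Fin n → Fin n → RR n → Matrix (Fin m) (Fin m) ℂ
  b : Fin n → RR n → Matrix (Fin m) (Fin m) ℂ
  c : RR n → Matrix (Fin m) (Fin m) ℂ

/-- `{a, b, c} ∈ 𝒞_+^σ(Ω̄)`: `a ∈ C̄_+^{|σ|}`, `b ∈ C̄_+^{μ_b}` with
`μ_b = max(0, |σ - 1/2| - 1/2)`, and `c ∈ C̄_+^{μ_c}` with `μ_c = max(0, |σ| - 1)`. -/
def Coeffs.MemClass {n m : ℕ} (A : Coeffs n m) (Ω : Opens (RR n)) (σ : ℝ) : Prop :=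
  (∀ i j k l, MemCbarPlus Ω |σ| (fun x => A.a i j x k l)) ∧
  (∀ j k l, MemCbarPlus Ω (max 0 (|σ - 1 / 2| - 1 / 2)) (fun x => A.b j x k l)) ∧
  (∀ k l, MemCbarPlus Ω (max 0 (|σ| - 1)) (fun x => A.c x k l))

/-- `{a, b, c} ∈ 𝒞_{+loc}^σ(Ω)`: `{a, b, c} ∈ 𝒞_+^σ(Ω̄')` for every open `Ω' ⋐ Ω`. -/
def Coeffs.MemClassLoc {n m : ℕ} (A : Coeffs n m) (Ω : Opens (RR n)) (σ : ℝ) : Prop :=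
  ∀ Ω' : Opens (RR n), IsCompact (closure (Ω' : Set (RR n))) →
    closure (Ω' : Set (RR n)) ⊆ (Ω : Set (RR n)) → A.MemClass Ω' σ

/-! ### Strong ellipticity and the equations `L u = f`, `L* u = f` -/

/-- (Uniform) strong ellipticity in `Ω` of the second-order system with leading coefficients
`a_{ij}`: there are a bounded matrix function `θ` on `Ω` and `C > 0` with
`Re (ζ̄ᵀ θ(x) ∑_{i,j} a_{ij}(x) ξ_i ξ_j ζ) ≥ C |ξ|² |ζ|²` for (almost) all `x ∈ Ω` and all
`ξ ∈ ℝⁿ`, `ζ ∈ ℂᵐ`. -/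
def StronglyElliptic {n m : ℕ} (Ω : Opens (RR n))
    (a : Fin n → Fin n → RR n → Matrix (Fin m) (Fin m) ℂ) : Prop :=
  ∃ θ : RR n → Matrix (Fin m) (Fin m) ℂ,
    (∃ M : ℝ, ∀ x ∈ Ω, ∀ k l, ‖θ x k l‖ ≤ M) ∧
    ∃ C : ℝ, 0 < C ∧ ∀ᵐ x ∂(volume.restrict (Ω : Set (RR n))),
      ∀ (ξ : RR n) (ζ : EuclideanSpace ℂ (Fin m)),
        C * ‖ξ‖ ^ 2 * ‖ζ‖ ^ 2 ≤
          (∑ k, ∑ l, star (ζ k) *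
            (θ x * ∑ i, ∑ j, ((ξ i * ξ j : ℝ) : ℂ) • a i j x) k l * ζ l).re

/-- The leading coefficients `ā_{ji}ᵀ` of the formally adjoint operator
`L* v = - ∑_{i,j} ∂_i (ā_{ji}ᵀ ∂_j v) - ∑_j ∂_j (b̄_jᵀ v) + c̄ᵀ v`. -/
def Coeffs.adjLeading {n m : ℕ} (A : Coeffs n m) :
    Fin n → Fin n → RR n → Matrix (Fin m) (Fin m) ℂ :=
  fun i j x => (A.a j i x).conjTranspose

/-- The bilinear form
`ℰ(U, v) = ∑_{i,j} ⟨a_{ij} ∂_j U, ∂_i v⟩ + ∑_j ⟨b_j ∂_j U, v⟩ + ⟨c U, v⟩` for `U ∈ H^s(ℝⁿ)^m` and a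
vector `v` of test functions on `Ω`. Multiplication by a coefficient `g` is the transpose of
multiplication by `g`: `⟨g T, φ⟩ = ⟨T, g φ⟩`. -/
def Coeffs.form {n m : ℕ} (A : Coeffs n m) {Ω : Opens (RR n)} (s : ℝ)
    (U : Fin m → 𝓢'(RR n, ℂ)) (v : Fin m → 𝓓(Ω, ℝ)) : ℂ :=
  (∑ i, ∑ j, ∑ k, ∑ l, sobolevDual (s - 1) (∂_{dir j} (U l))
      (ofFun fun x => A.a i j x k l * (((∂_{dir i} (v k)) x : ℝ) : ℂ))) +
  (∑ j, ∑ k, ∑ l, sobolevDual (s - 1) (∂_{dir j} (U l))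
      (ofFun fun x => A.b j x k l * ((v k x : ℝ) : ℂ))) +
  ∑ k, ∑ l, sobolevDual s (U l) (ofFun fun x => A.c x k l * ((v k x : ℝ) : ℂ))

/-- The bilinear form of the formally adjoint operator, `ℰ*(U, v) = conj ℰ(v̄, Ū)`, that is
`∑_{i,j} ⟨ā_{ij} ∂_j v, ∂_i U⟩ + ∑_j ⟨b̄_j ∂_j v, U⟩ + ⟨c̄ v, U⟩`, for `U ∈ H^s(ℝⁿ)^m` and a vector
`v` of test functions on `Ω`. -/
def Coeffs.adjForm {n m : ℕ} (A : Coeffs n m) {Ω : Opens (RR n)} (s : ℝ)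
    (U : Fin m → 𝓢'(RR n, ℂ)) (v : Fin m → 𝓓(Ω, ℝ)) : ℂ :=
  (∑ i, ∑ j, ∑ k, ∑ l, sobolevDual (s - 1) (∂_{dir i} (U k))
      (ofFun fun x => star (A.a i j x k l) * (((∂_{dir j} (v l)) x : ℝ) : ℂ))) +
  (∑ j, ∑ k, ∑ l, sobolevDual s (U k)
      (ofFun fun x => star (A.b j x k l) * (((∂_{dir j} (v l)) x : ℝ) : ℂ))) +
  ∑ k, ∑ l, sobolevDual s (U k) (ofFun fun x => star (A.c x k l) * ((v l x : ℝ) : ℂ))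

/-- `U` is a vector of distributions from `H^s(ℝⁿ)` which coincides with `u` on some open
neighbourhood `W` of the supports of the test functions `v k`. -/
def IsExtensionNear {n m : ℕ} {Ω : Opens (RR n)} (s : ℝ) (u : Fin m → 𝓓'(Ω, ℂ))
    (v : Fin m → 𝓓(Ω, ℝ)) (U : Fin m → 𝓢'(RR n, ℂ)) : Prop :=
  (∀ l, MemSobolev s 2 (U l)) ∧
  ∃ W : Set (RR n), IsOpen W ∧ (∀ k, tsupport (v k) ⊆ W) ∧
    ∀ l, ∀ ψ : 𝓓(Ω, ℝ), tsupport ψ ⊆ W → U l (testToSchwartz ψ) = u l ψ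

/-- `u ∈ H^s_loc(Ω)^m` satisfies `L u = f` in `Ω` in the distribution sense: `ℰ(u, v) = ⟨f, v⟩` for
all `v ∈ 𝓓(Ω)^m`. As `ℰ(u, v)` only involves `u` near the support of `v`, it is evaluated on
extensions to `ℝⁿ` of the restriction of `u` to a neighbourhood of this support; these exist for
`u ∈ H^s_loc(Ω)^m`. -/
def Coeffs.Satisfies {n m : ℕ} (A : Coeffs n m) (Ω : Opens (RR n)) (s : ℝ)
    (u f : Fin m → 𝓓'(Ω, ℂ)) : Prop :=
  ∀ (v : Fin m → 𝓓(Ω, ℝ)) (U : Fin m → 𝓢'(RR n, ℂ)),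
    IsExtensionNear s u v U → A.form s U v = ∑ k, f k (v k)

/-- `u ∈ H^s_loc(Ω)^m` satisfies `L* u = f` in `Ω` in the distribution sense:
`ℰ*(u, v) = ⟨f, v⟩` for all `v ∈ 𝓓(Ω)^m`. -/
def Coeffs.AdjSatisfies {n m : ℕ} (A : Coeffs n m) (Ω : Opens (RR n)) (s : ℝ)
    (u f : Fin m → 𝓓'(Ω, ℂ)) : Prop :=
  ∀ (v : Fin m → 𝓓(Ω, ℝ)) (U : Fin m → 𝓢'(RR n, ℂ)),
    IsExtensionNear s u v U → A.adjForm s U v = ∑ k, f k (v k)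

end EllipticReg

end

/-! Put σ₁ = s₁ - 1 and σ₂ = s₂ + 1, so that σ₁ < σ₂. The first derivatives of u are locally of
order σ₁, and order σ₂ is wanted. The proof freezes the leading coefficients near a point and treats
the difference as a small perturbation, in Sobolev norms of arbitrary real order.

All analysis is done on the frequency side. An element of H^κ is replaced by a function F with ⟨ξ⟩^κ
F in L² (`MemW`), acting on Schwartz functions by `act`, and the Sobolev duality becomes the
integral `pair` (`sobolevDual_ofFun`). The norms carry a scale ρ: the weight is (1 + ρ²|ξ|²)^{κ/2}.
For fixed ρ this changes nothing up to constants, but ρ → 0 suppresses the smoothness of a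
multiplier: by `exists_eventually_isMul`, multiplication by a coefficient g has norm at most C
sup|g| + ε in order κ once ρ is small. For 0 < κ < 1 this comes from a characterisation of the norm
by dyadic differences (`exists_isMul_of_holder`); order κ + 1 is reduced to order κ by writing a
test function through the resolvent of the Laplacian and integrating by parts (`IsMul.succ`);
negative orders follow by duality.

Both equations are instances of one system `Sys`, with terms b ∂u and ∂(d u) side by side.
Multiplying the solution by a cutoff φ produces commutators containing at most one derivative of u,
or one outer derivative of u. Hence if u is locally of order τ + 1, then ∑ ∂_i(a_ij ∂_j(φu)) is of
order τ' - 1 for every τ' ≤ min(τ + 1, σ₂) (`Sys.Good.localize`).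

At a good point z near x₀, strong ellipticity makes the symbol 1 + 4π² θ(z) ∑ a_ij(z) ξ_i ξ_j
invertible with inverse of order -2 (`exists_frozenSymbol_inv`). Solving the localised equation with
it gives ∂(φu) = G + K((a - a(z)) ∂(φu)), where G is of order τ' and K is a bounded Fourier
multiplier. After cutting off to a small ball and taking ρ small, the last term is a contraction in
the orders τ and τ' simultaneously, so the solution known in order τ lies in order τ'
(`memW_of_contraction`). This gains up to one order (`Sys.Good.step`); iteration reaches σ₂
(`Sys.Good.locReg`), and a partition of unity returns to Ω (`memHsLoc_of_local`).

The strict inequality σ₁ < σ₂ also forces max(|σ₁|, |σ₂|) > 0, so the leading coefficients are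
Hölder continuous off a null set and can be frozen. -/

noncomputable section

namespace EllipticReg

open Filter

/-! ### Weights and Sobolev norms on the frequency side -/

/-- The weight `(1 + ρ² |ξ|²)^{κ/2}`. -/
def wt {n : ℕ} (ρ κ : ℝ) (ξ : RR n) : ℝ := (1 + ρ ^ 2 * ‖ξ‖ ^ 2) ^ (κ / 2)

variable {n : ℕ}

lemma wt_base_pos (ρ : ℝ) (ξ : RR n) : 0 < 1 + ρ ^ 2 * ‖ξ‖ ^ 2 := by positivity

lemma wt_pos (ρ κ : ℝ) (ξ : RR n) : 0 < wt ρ κ ξ := Real.rpow_pos_of_pos (wt_base_pos ρ ξ) _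

lemma wt_add (ρ κ κ' : ℝ) (ξ : RR n) : wt ρ (κ + κ') ξ = wt ρ κ ξ * wt ρ κ' ξ := by
  rw [wt, add_div, Real.rpow_add (wt_base_pos ρ ξ)]; rfl

@[simp] lemma wt_zero (ρ : ℝ) (ξ : RR n) : wt ρ 0 ξ = 1 := by simp [wt]

lemma wt_mul_neg (ρ κ : ℝ) (ξ : RR n) : wt ρ κ ξ * wt ρ (-κ) ξ = 1 := by
  rw [← wt_add]; simp

lemma wt_neg_mul (ρ κ : ℝ) (ξ : RR n) : wt ρ (-κ) ξ * wt ρ κ ξ = 1 := by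
  rw [← wt_add]; simp

lemma wt_two (ρ : ℝ) (ξ : RR n) : wt ρ 2 ξ = 1 + ρ ^ 2 * ‖ξ‖ ^ 2 := by simp [wt]

lemma wt_sq (ρ κ : ℝ) (ξ : RR n) : wt ρ κ ξ ^ 2 = (1 + ρ ^ 2 * ‖ξ‖ ^ 2) ^ κ := by
  rw [sq, ← wt_add, wt]; congr 1; ring

@[simp] lemma wt_neg_arg (ρ κ : ℝ) (ξ : RR n) : wt ρ κ (-ξ) = wt ρ κ ξ := by simp [wt]

lemma wt_mono (ρ : ℝ) {κ κ' : ℝ} (h : κ ≤ κ') (ξ : RR n) : wt ρ κ ξ ≤ wt ρ κ' ξ :=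
  Real.rpow_le_rpow_of_exponent_le (le_add_of_nonneg_right (by positivity)) (by linarith)

lemma wt_le_one (ρ : ℝ) {κ : ℝ} (h : κ ≤ 0) (ξ : RR n) : wt ρ κ ξ ≤ 1 := by
  simpa using wt_mono ρ h ξ

lemma hasTemperateGrowth_wt (ρ κ : ℝ) : (wt ρ κ : RR n → ℝ).HasTemperateGrowth := by
  have h1 := Function.hasTemperateGrowth_one_add_norm_sq_rpow (RR n) (κ / 2)
  have h2 : (fun ξ : RR n => ρ • ξ).HasTemperateGrowth :=
    (ρ • ContinuousLinearMap.id ℝ (RR n)).hasTemperateGrowth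
  have h3 : (wt ρ κ : RR n → ℝ) = (fun x => (1 + ‖x‖ ^ 2) ^ (κ / 2)) ∘ fun ξ => ρ • ξ := by
    ext ξ
    simp [wt, norm_smul, mul_pow]
  rw [h3]
  exact h1.comp h2

lemma hasTemperateGrowth_wtC (ρ κ : ℝ) :
    (fun ξ : RR n => ((wt ρ κ ξ : ℝ) : ℂ)).HasTemperateGrowth :=
  Function.HasTemperateGrowth.comp Function.Complex.hasTemperateGrowth_ofReal (hasTemperateGrowth_wt ρ κ)

lemma continuous_wt (ρ κ : ℝ) : Continuous (wt ρ κ : RR n → ℝ) :=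
  (hasTemperateGrowth_wt ρ κ).1.continuous

lemma continuous_wtC (ρ κ : ℝ) : Continuous (fun ξ : RR n => ((wt ρ κ ξ : ℝ) : ℂ)) :=
  Complex.continuous_ofReal.comp (continuous_wt ρ κ)

/-- Comparability of the scales: membership in a weighted space, or being a multiplier, does not
depend on ρ, so ρ may be chosen late in the argument to make constants small. -/
lemma exists_wt_le (ρ ρ' κ : ℝ) (hρ : 0 < ρ) (hρ' : 0 < ρ') :
    ∃ C : ℝ, 0 < C ∧ ∀ ξ : RR n, wt ρ κ ξ ≤ C * wt ρ' κ ξ := by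
  have key : ∀ r r' : ℝ, 0 < r → 0 < r' → ∃ D : ℝ, 1 ≤ D ∧ ∀ ξ : RR n,
      1 + r ^ 2 * ‖ξ‖ ^ 2 ≤ D * (1 + r' ^ 2 * ‖ξ‖ ^ 2) := by
    intro r r' hr hr'
    refine ⟨max 1 (r ^ 2 / r' ^ 2), le_max_left _ _, fun ξ => ?_⟩
    have h1 : r ^ 2 = r ^ 2 / r' ^ 2 * r' ^ 2 := by field_simp
    have h2 : r ^ 2 * ‖ξ‖ ^ 2 ≤ max 1 (r ^ 2 / r' ^ 2) * r' ^ 2 * ‖ξ‖ ^ 2 := by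
      conv_lhs => rw [h1]
      gcongr
      exact le_max_right _ _
    have := le_max_left 1 (r ^ 2 / r' ^ 2)
    linarith
  rcases le_or_gt 0 κ with hκ | hκ
  · obtain ⟨D, hD, h⟩ := key ρ ρ' hρ hρ'
    refine ⟨D ^ (κ / 2), by positivity, fun ξ => ?_⟩
    rw [wt, wt, ← Real.mul_rpow (by positivity) (by positivity)]
    exact Real.rpow_le_rpow (by positivity) (h ξ) (by positivity)
  · obtain ⟨D, hD, h⟩ := key ρ' ρ hρ' hρ
    refine ⟨D ^ (-(κ / 2)), by positivity, fun ξ => ?_⟩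
    have hD0 : 0 < D := by linarith
    have : (D * (1 + ρ ^ 2 * ‖ξ‖ ^ 2)) ^ (κ / 2) ≤ (1 + ρ' ^ 2 * ‖ξ‖ ^ 2) ^ (κ / 2) :=
      Real.rpow_le_rpow_of_nonpos (by positivity) (h ξ) (by linarith)
    rw [Real.mul_rpow (by positivity) (by positivity)] at this
    rw [wt, wt]
    calc _ = D ^ (-(κ / 2)) * (D ^ (κ / 2) * (1 + ρ ^ 2 * ‖ξ‖ ^ 2) ^ (κ / 2)) := by
          rw [← mul_assoc, ← Real.rpow_add hD0]; simp
      _ ≤ _ := by gcongr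

/-- `ψ ↦ ⟨ρ ξ⟩^κ 𝓕⁻ψ` on Schwartz functions. -/
def fqL (n : ℕ) (ρ κ : ℝ) : 𝓢(RR n, ℂ) →L[ℂ] 𝓢(RR n, ℂ) :=
  (SchwartzMap.smulLeftCLM ℂ (fun ξ : RR n => ((wt ρ κ ξ : ℝ) : ℂ))) ∘L
    (fourierInvCLM ℂ 𝓢(RR n, ℂ))

@[simp] lemma fqL_apply (ρ κ : ℝ) (ψ : 𝓢(RR n, ℂ)) (ξ : RR n) :
    fqL n ρ κ ψ ξ = (wt ρ κ ξ : ℂ) * 𝓕⁻ ψ ξ := by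
  simp [fqL, hasTemperateGrowth_wtC]

/-- The weight and its reciprocal both have temperate growth, so weighting is invertible on Schwartz
functions. Density of Schwartz functions in L² thereby transfers to every order and scale. -/
lemma fqL_surjective (ρ κ : ℝ) : Function.Surjective (fqL n ρ κ) := by
  intro η
  refine ⟨𝓕 (SchwartzMap.smulLeftCLM ℂ (fun ξ : RR n => ((wt ρ (-κ) ξ : ℝ) : ℂ)) η), ?_⟩
  ext ξ
  rw [fqL_apply, FourierTransform.fourierInv_fourier_eq,
    SchwartzMap.smulLeftCLM_apply_apply (hasTemperateGrowth_wtC _ _), smul_eq_mul, ← mul_assoc]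
  norm_cast
  rw [wt_mul_neg]; simp

/-- The norm `‖⟨ρ ξ⟩^κ 𝓕⁻ψ‖_{L²}` of a Schwartz function. -/
def sn (ρ κ : ℝ) (ψ : 𝓢(RR n, ℂ)) : ℝ := ‖(fqL n ρ κ ψ).toLp 2‖

lemma sn_nonneg (ρ κ : ℝ) (ψ : 𝓢(RR n, ℂ)) : 0 ≤ sn ρ κ ψ := norm_nonneg _

lemma sn_eq (ρ κ : ℝ) (ψ : 𝓢(RR n, ℂ)) :
    sn ρ κ ψ = (eLpNorm (fun ξ => (wt ρ κ ξ : ℂ) * 𝓕⁻ ψ ξ) 2).toReal := by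
  rw [sn, SchwartzMap.norm_toLp]
  congr 2
  ext ξ
  simp

/-- Membership of the frequency function `F` in the weighted `L²` space of order `κ`. -/
def MemW (κ : ℝ) (F : RR n → ℂ) : Prop := MemLp (fun ξ => (wt 1 κ ξ : ℂ) * F ξ) 2

/-- The weighted `L²` norm of a frequency function. -/
def nW (ρ κ : ℝ) (F : RR n → ℂ) : ℝ := (eLpNorm (fun ξ => (wt ρ κ ξ : ℂ) * F ξ) 2).toReal

lemma nW_nonneg (ρ κ : ℝ) (F : RR n → ℂ) : 0 ≤ nW ρ κ F := ENNReal.toReal_nonneg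

lemma MemW.aesm {κ : ℝ} {F : RR n → ℂ} (h : MemW κ F) : AEStronglyMeasurable F volume := by
  have := (continuous_wtC (n := n) 1 (-κ)).aestronglyMeasurable.mul h.1
  refine this.congr (Eventually.of_forall fun ξ => ?_)
  simp only [Pi.mul_apply]
  rw [← mul_assoc]
  norm_cast
  rw [wt_neg_mul]; simp

lemma memLp_wt_of_le {F : RR n → ℂ} {v w : RR n → ℝ} {C : ℝ}
    (hF : AEStronglyMeasurable F volume) (hw : Continuous w)
    (hv0 : ∀ ξ, 0 ≤ v ξ) (hw0 : ∀ ξ, 0 ≤ w ξ)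
    (h : ∀ ξ, w ξ ≤ C * v ξ) (hm : MemLp (fun ξ => (v ξ : ℂ) * F ξ) 2) :
    MemLp (fun ξ => (w ξ : ℂ) * F ξ) 2 := by
  refine MemLp.of_le_mul (c := C) hm
    ((Complex.continuous_ofReal.comp hw).aestronglyMeasurable.mul hF) (Eventually.of_forall fun ξ => ?_)
  simp only [norm_mul, Complex.norm_real, Real.norm_eq_abs, abs_of_nonneg (hw0 ξ),
    abs_of_nonneg (hv0 ξ)]
  rw [← mul_assoc]
  gcongr
  exact h ξ

lemma memW_iff {κ ρ : ℝ} (hρ : 0 < ρ) {F : RR n → ℂ} :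
    MemW κ F ↔ MemLp (fun ξ => (wt ρ κ ξ : ℂ) * F ξ) 2 := by
  constructor
  · intro h
    obtain ⟨C, -, hC⟩ := exists_wt_le (n := n) ρ 1 κ hρ one_pos
    exact memLp_wt_of_le h.aesm (continuous_wt _ _)
      (fun _ => (wt_pos _ _ _).le) (fun _ => (wt_pos _ _ _).le) hC h
  · intro h
    obtain ⟨C, -, hC⟩ := exists_wt_le (n := n) 1 ρ κ one_pos hρ
    have hF : AEStronglyMeasurable F volume := by
      have := (continuous_wtC (n := n) ρ (-κ)).aestronglyMeasurable.mul h.1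
      refine this.congr (Eventually.of_forall fun ξ => ?_)
      simp only [Pi.mul_apply]
      rw [← mul_assoc]
      norm_cast
      rw [wt_neg_mul]; simp
    exact memLp_wt_of_le hF (continuous_wt _ _)
      (fun _ => (wt_pos _ _ _).le) (fun _ => (wt_pos _ _ _).le) hC h

lemma MemW.mono {κ κ' : ℝ} (h : κ' ≤ κ) {F : RR n → ℂ} (hF : MemW κ F) : MemW κ' F :=
  memLp_wt_of_le (C := 1) hF.aesm (continuous_wt _ _)
    (fun _ => (wt_pos _ _ _).le) (fun _ => (wt_pos _ _ _).le)
    (fun ξ => by simpa using wt_mono 1 h ξ) hF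

lemma MemW.congr {κ : ℝ} {F G : RR n → ℂ} (hF : MemW κ F) (h : F =ᵐ[volume] G) : MemW κ G :=
  (memLp_congr_ae (h.mono fun ξ hξ => by simp [hξ])).1 hF

lemma MemW.add {κ : ℝ} {F G : RR n → ℂ} (hF : MemW κ F) (hG : MemW κ G) :
    MemW κ (fun ξ => F ξ + G ξ) := by
  refine (memLp_congr_ae (Eventually.of_forall fun ξ => ?_)).1 (MemLp.add hF hG)
  simp [mul_add]

lemma MemW.sub {κ : ℝ} {F G : RR n → ℂ} (hF : MemW κ F) (hG : MemW κ G) :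
    MemW κ (fun ξ => F ξ - G ξ) := by
  refine (memLp_congr_ae (Eventually.of_forall fun ξ => ?_)).1 (MemLp.sub hF hG)
  simp [mul_sub]

lemma MemW.zero {κ : ℝ} : MemW κ (fun _ : RR n => 0) := by simp [MemW]

lemma MemW.sum {κ : ℝ} {ι : Type*} (s : Finset ι) {F : ι → RR n → ℂ} (hF : ∀ i ∈ s, MemW κ (F i)) :
    MemW κ (fun ξ => ∑ i ∈ s, F i ξ) := by
  classical
  induction s using Finset.induction_on with
  | empty => simpa using MemW.zero
  | insert a s ha ih =>
    simp only [Finset.sum_insert ha]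
    exact (hF a (by simp)).add (ih fun i hi => hF i (by simp [hi]))

/-- Multiplication by a bounded frequency symbol of order `d`. -/
lemma MemW.symbol {κ κ' : ℝ} {F K : RR n → ℂ} (hF : MemW κ F) (hK : AEStronglyMeasurable K volume)
    {C : ℝ} (h : ∀ ξ, ‖K ξ‖ ≤ C * wt 1 (κ - κ') ξ) : MemW κ' (fun ξ => K ξ * F ξ) := by
  refine MemLp.of_le_mul (c := C) hF
    ((continuous_wtC _ _).aestronglyMeasurable.mul (hK.mul hF.aesm)) (Eventually.of_forall fun ξ => ?_)
  simp only [norm_mul, Complex.norm_real, Real.norm_eq_abs, abs_of_pos (wt_pos _ _ _)]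
  have : wt 1 κ ξ = wt 1 (κ - κ') ξ * wt 1 κ' ξ := by rw [← wt_add]; simp
  rw [this]
  have := mul_le_mul_of_nonneg_right (h ξ) (mul_nonneg (wt_pos 1 κ' ξ).le (norm_nonneg (F ξ)))
  nlinarith

lemma MemW.const_mul {κ : ℝ} {F : RR n → ℂ} (hF : MemW κ F) (c : ℂ) :
    MemW κ (fun ξ => c * F ξ) :=
  hF.symbol (C := ‖c‖) aestronglyMeasurable_const (fun ξ => by simp)

/-- The symbol `2πi ξ_j` of `∂_j`. -/
def dsym (j : Fin n) (ξ : RR n) : ℂ := 2 * Real.pi * Complex.I * (ξ j : ℂ)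

lemma continuous_dsym (j : Fin n) : Continuous (dsym j) := by
  unfold dsym
  fun_prop

lemma norm_dsym (j : Fin n) (ξ : RR n) : ‖dsym j ξ‖ = 2 * Real.pi * |ξ j| := by
  simp [dsym, abs_of_pos Real.pi_pos]

lemma norm_dsym_le (j : Fin n) (ξ : RR n) : ‖dsym j ξ‖ ≤ 2 * Real.pi * wt 1 1 ξ := by
  rw [norm_dsym]
  have h1 : |ξ j| ≤ ‖ξ‖ := by simpa using PiLp.norm_apply_le ξ j
  have h2 : ‖ξ‖ ≤ wt 1 1 ξ := by
    have := wt_sq 1 1 ξ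
    simp only [one_pow, one_mul, Real.rpow_one] at this
    exact le_of_sq_le_sq (by linarith) (wt_pos _ _ _).le
  gcongr
  exact h1.trans h2

lemma MemW.dsym_mul {κ : ℝ} {F : RR n → ℂ} (hF : MemW κ F) (j : Fin n) :
    MemW (κ - 1) (fun ξ => dsym j ξ * F ξ) :=
  hF.symbol (continuous_dsym j).aestronglyMeasurable
    (fun ξ => by simpa using norm_dsym_le j ξ)

/-! ### Pairings -/

lemma norm_integral_mul_le {f g : RR n → ℂ} (hf : MemLp f 2) (hg : MemLp g 2) :
    ‖∫ ξ, f ξ * g ξ‖ ≤ (eLpNorm f 2).toReal * (eLpNorm g 2).toReal := by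
  have h := L2.inner_def (𝕜 := ℂ) (hf.star.toLp _) (hg.toLp _)
  have h2 : ∫ ξ, f ξ * g ξ = inner ℂ (hf.star.toLp _) (hg.toLp _) := by
    rw [h]
    refine integral_congr_ae ?_
    filter_upwards [hf.star.coeFn_toLp, hg.coeFn_toLp] with ξ h1 h2
    simp [h1, h2, mul_comm]
  rw [h2]
  refine (norm_inner_le_norm _ _).trans ?_
  rw [Lp.norm_toLp, Lp.norm_toLp, eLpNorm_star]

lemma integrable_mul_of_memLp {f g : RR n → ℂ} (hf : MemLp f 2) (hg : MemLp g 2) :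
    Integrable (fun ξ => f ξ * g ξ) := MemLp.integrable_mul hf hg

/-- The distribution with Fourier transform `F`, applied to a test function. -/
def act (F : RR n → ℂ) (ψ : 𝓢(RR n, ℂ)) : ℂ := ∫ ξ, F ξ * 𝓕⁻ ψ ξ

lemma wt_mul_split (ρ κ : ℝ) (F : RR n → ℂ) (h : RR n → ℂ) (ξ : RR n) :
    F ξ * h ξ = ((wt ρ κ ξ : ℂ) * F ξ) * ((wt ρ (-κ) ξ : ℂ) * h ξ) := by
  have : (wt ρ κ ξ : ℂ) * (wt ρ (-κ) ξ : ℂ) = 1 := by norm_cast; exact wt_mul_neg ρ κ ξ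
  linear_combination (-(F ξ * h ξ)) * this

lemma memW_fourierInv (κ : ℝ) (ψ : 𝓢(RR n, ℂ)) : MemW κ (𝓕⁻ ψ : 𝓢(RR n, ℂ)) := by
  refine (memLp_congr_ae (Eventually.of_forall fun ξ => ?_)).1 ((fqL n 1 κ ψ).memLp 2)
  simp

lemma integrable_of_memW {κ : ℝ} {F h : RR n → ℂ} (hF : MemW κ F) (hh : MemW (-κ) h) :
    Integrable (fun ξ => F ξ * h ξ) := by
  refine (integrable_mul_of_memLp hF hh).congr (Eventually.of_forall fun ξ => ?_)
  exact (wt_mul_split 1 κ F h ξ).symm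

lemma norm_integral_le_nW {κ ρ : ℝ} (hρ : 0 < ρ) {F h : RR n → ℂ} (hF : MemW κ F)
    (hh : MemW (-κ) h) : ‖∫ ξ, F ξ * h ξ‖ ≤ nW ρ κ F * nW ρ (-κ) h := by
  have := norm_integral_mul_le ((memW_iff hρ).1 hF) ((memW_iff hρ).1 hh)
  rwa [← integral_congr_ae (Eventually.of_forall (wt_mul_split ρ κ F h))] at this

lemma integrable_act {κ : ℝ} {F : RR n → ℂ} (hF : MemW κ F) (ψ : 𝓢(RR n, ℂ)) :
    Integrable (fun ξ => F ξ * 𝓕⁻ ψ ξ) := integrable_of_memW hF (memW_fourierInv _ ψ)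

lemma norm_act_le {κ ρ : ℝ} (hρ : 0 < ρ) {F : RR n → ℂ} (hF : MemW κ F) (ψ : 𝓢(RR n, ℂ)) :
    ‖act F ψ‖ ≤ nW ρ κ F * sn ρ (-κ) ψ := by
  rw [sn_eq]
  exact norm_integral_le_nW hρ hF (memW_fourierInv _ ψ)

lemma toLp_fqL_dense (ρ κ : ℝ) :
    DenseRange (((SchwartzMap.toLpCLM ℂ (E := RR n) ℂ 2 volume).toLinearMap).comp
      (fqL n ρ κ).toLinearMap) := by
  have h : DenseRange (SchwartzMap.toLpCLM ℂ (E := RR n) ℂ 2 volume) :=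
    SchwartzMap.denseRange_toLpCLM ENNReal.ofNat_ne_top
  exact h.comp (fqL_surjective ρ κ).denseRange (SchwartzMap.toLpCLM ℂ (E := RR n) ℂ 2 volume).continuous

/-- Riesz representation: functionals bounded by the norm of order `-κ` are frequency functions
of order `κ`. -/
theorem exists_memW_of_bound {κ ρ C : ℝ} (hρ : 0 < ρ) (hC : 0 ≤ C) (Λ : 𝓢(RR n, ℂ) →ₗ[ℂ] ℂ)
    (hΛ : ∀ ψ, ‖Λ ψ‖ ≤ C * sn ρ (-κ) ψ) :
    ∃ F : RR n → ℂ, MemW κ F ∧ nW ρ κ F ≤ C ∧ ∀ ψ, Λ ψ = act F ψ := by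
  set e := ((SchwartzMap.toLpCLM ℂ (E := RR n) ℂ 2 volume).toLinearMap).comp
      (fqL n ρ (-κ)).toLinearMap with he
  have hd := toLp_fqL_dense (n := n) ρ (-κ)
  -- The bound says that Λ factors through the dense image of the weighted transform in L², so it
  -- extends to a functional on L² and Riesz applies.
  set Λ' := Λ.extendOfNorm e with hΛ'
  have h1 : ∀ ψ, Λ' (e ψ) = Λ ψ := LinearMap.extendOfNorm_eq hd ⟨C, hΛ⟩
  have h2 : ∀ f, ‖Λ' f‖ ≤ C * ‖f‖ := LinearMap.norm_extendOfNorm_apply_le hd C hΛ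
  set g := (InnerProductSpace.toDual ℂ (Lp ℂ 2 (volume : Measure (RR n)))).symm Λ' with hg
  have h3 : ∀ f, inner ℂ g f = Λ' f := fun f => InnerProductSpace.toDual_symm_apply
  have h4 : ‖g‖ ≤ C := by
    rw [hg, LinearIsometryEquiv.norm_map]
    exact Λ'.opNorm_le_bound hC h2
  have hF : (fun ξ => (wt ρ κ ξ : ℂ) * ((wt ρ (-κ) ξ : ℂ) * star (g ξ))) = fun ξ => star (g ξ) := by
    ext ξ
    rw [← mul_assoc]
    norm_cast
    rw [wt_mul_neg]; simp
  -- The conjugate appears because `act` is bilinear while the inner product is conjugate-linear in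
  -- its first slot; the weight undoes the one built into `fqL`.
  refine ⟨fun ξ => (wt ρ (-κ) ξ : ℂ) * star (g ξ), ?_, ?_, fun ψ => ?_⟩
  · rw [memW_iff hρ, hF]
    exact (Lp.memLp g).star
  · rw [nW, hF]
    rw [Lp.norm_def] at h4
    have := eLpNorm_star (f := (g : RR n → ℂ)) (p := 2) (μ := volume)
    rw [← this] at h4
    exact h4
  · rw [← h1, ← h3, L2.inner_def]
    refine integral_congr_ae ?_
    filter_upwards [(fqL n ρ (-κ) ψ).coeFn_toLp 2] with ξ hξ
    have : (e ψ : RR n → ℂ) ξ = fqL n ρ (-κ) ψ ξ := hξ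
    rw [this]
    simp
    ring

lemma memLp_ext {f : RR n → ℂ} (hf : MemLp f 2) (h : ∀ η : 𝓢(RR n, ℂ), ∫ ξ, f ξ * η ξ = 0) :
    f =ᵐ[volume] 0 := by
  have hd : DenseRange (SchwartzMap.toLpCLM ℂ (E := RR n) ℂ 2 volume) :=
    SchwartzMap.denseRange_toLpCLM ENNReal.ofNat_ne_top
  have h0 : hf.star.toLp _ = 0 := by
    refine hd.eq_zero_of_inner_left (𝕜 := ℂ) fun η => ?_
    rw [L2.inner_def, ← h η]
    refine integral_congr_ae ?_
    filter_upwards [hf.star.coeFn_toLp, η.coeFn_toLp 2] with ξ h1 h2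
    have h3 : (SchwartzMap.toLpCLM ℂ ℂ 2 volume η : RR n → ℂ) ξ = η ξ := h2
    rw [h1, h3]
    simp [mul_comm]
  have h1 := hf.star.coeFn_toLp
  rw [h0] at h1
  filter_upwards [h1, Lp.coeFn_zero ℂ 2 (volume : Measure (RR n))] with ξ h2 h3
  rw [h3] at h2
  simpa using h2.symm

/-- A frequency function is determined by its action on Schwartz functions. This is the device by
which identities between distributions become almost everywhere identities in ξ. -/
lemma act_ext {κ : ℝ} {F G : RR n → ℂ} (hF : MemW κ F) (hG : MemW κ G)
    (h : ∀ ψ, act F ψ = act G ψ) : F =ᵐ[volume] G := by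
  have h1 := memLp_ext (f := fun ξ => (wt 1 κ ξ : ℂ) * (F ξ - G ξ)) (hF.sub hG) (fun η => by
    obtain ⟨ψ, rfl⟩ := fqL_surjective 1 (-κ) η
    have h2 : ∫ ξ, (F ξ * 𝓕⁻ ψ ξ - G ξ * 𝓕⁻ ψ ξ) = 0 := by
      rw [integral_sub (integrable_act hF ψ) (integrable_act hG ψ)]
      exact sub_eq_zero.2 (h ψ)
    rw [← h2]
    congr 1
    ext ξ
    rw [fqL_apply, ← wt_mul_split 1 κ (fun ξ => F ξ - G ξ) (𝓕⁻ ψ : 𝓢(RR n, ℂ)) ξ]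
    ring)
  filter_upwards [h1] with ξ hξ
  have : (wt 1 κ ξ : ℂ) ≠ 0 := by exact_mod_cast (wt_pos _ _ _).ne'
  simpa [this, sub_eq_zero] using hξ

/-! ### Inverse Fourier transforms of `L²` functions and multipliers -/

open Classical in
/-- The `L²` inverse Fourier transform of a function (junk value `0` if it is not in `L²`). -/
def fiL (h : RR n → ℂ) : RR n → ℂ :=
  if hh : MemLp h 2 (volume : Measure (RR n)) then
    ((𝓕⁻ hh.toLp : Lp ℂ 2 (volume : Measure (RR n))) : RR n → ℂ) else 0

lemma fiL_of_memLp {h : RR n → ℂ} (hh : MemLp h 2 (volume : Measure (RR n))) :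
    fiL h = ((𝓕⁻ hh.toLp : Lp ℂ 2 (volume : Measure (RR n))) : RR n → ℂ) := by
  simp [fiL, hh]

lemma memLp_fiL {h : RR n → ℂ} (hh : MemLp h 2 (volume : Measure (RR n))) :
    MemLp (fiL h) 2 (volume : Measure (RR n)) := by
  rw [fiL_of_memLp hh]; exact Lp.memLp _

lemma fiL_congr {h h' : RR n → ℂ} (e : h =ᵐ[volume] h') : fiL h = fiL h' := by
  by_cases hh : MemLp h 2 (volume : Measure (RR n))
  · rw [fiL_of_memLp hh, fiL_of_memLp ((memLp_congr_ae e).1 hh)]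
    congr 3
    exact (MemLp.toLp_eq_toLp_iff _ _).2 e
  · have hh' : ¬ MemLp h' 2 (volume : Measure (RR n)) := fun H => hh ((memLp_congr_ae e).2 H)
    simp [fiL, hh, hh']

lemma fiL_add {h h' : RR n → ℂ} (hh : MemLp h 2 (volume : Measure (RR n)))
    (hh' : MemLp h' 2 (volume : Measure (RR n))) :
    fiL (fun x => h x + h' x) =ᵐ[volume] fun ξ => fiL h ξ + fiL h' ξ := by
  have e : fiL (fun x => h x + h' x) = _ := fiL_of_memLp (hh.add hh')
  rw [e, MemLp.toLp_add, fourierInv_add, fiL_of_memLp hh, fiL_of_memLp hh']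
  exact Lp.coeFn_add _ _

lemma fiL_sub {h h' : RR n → ℂ} (hh : MemLp h 2 (volume : Measure (RR n)))
    (hh' : MemLp h' 2 (volume : Measure (RR n))) :
    fiL (fun x => h x - h' x) =ᵐ[volume] fun ξ => fiL h ξ - fiL h' ξ := by
  have e : fiL (fun x => h x - h' x) = _ := fiL_of_memLp (hh.sub hh')
  have e2 : (𝓕⁻ ((hh.sub hh').toLp) : Lp ℂ 2 (volume : Measure (RR n))) =
      𝓕⁻ hh.toLp - 𝓕⁻ hh'.toLp := by
    rw [MemLp.toLp_sub hh hh']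
    exact (Lp.fourierTransformₗᵢ (RR n) ℂ).symm.map_sub _ _
  rw [e, e2, fiL_of_memLp hh, fiL_of_memLp hh']
  exact Lp.coeFn_sub _ _

lemma fiL_const_mul {h : RR n → ℂ} (hh : MemLp h 2 (volume : Measure (RR n))) (c : ℂ) :
    fiL (fun x => c * h x) =ᵐ[volume] fun ξ => c * fiL h ξ := by
  have e : fiL (fun x => c * h x) = _ := fiL_of_memLp (hh.const_smul c)
  rw [e, MemLp.toLp_const_smul, fourierInv_smul, fiL_of_memLp hh]
  exact Lp.coeFn_smul _ _

lemma fiL_schwartz (ψ : 𝓢(RR n, ℂ)) : fiL ψ =ᵐ[volume] (𝓕⁻ ψ : 𝓢(RR n, ℂ)) := by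
  rw [fiL_of_memLp (ψ.memLp 2)]
  have : (ψ.memLp 2 (volume : Measure (RR n))).toLp = ψ.toLp 2 := rfl
  rw [this, SchwartzMap.toLp_fourierInv_eq]
  exact (𝓕⁻ ψ).coeFn_toLp 2

lemma integral_mul_eq_fiL {h : RR n → ℂ} (hh : MemLp h 2 (volume : Measure (RR n)))
    (η : 𝓢(RR n, ℂ)) : ∫ x, h x * η x = ∫ ξ, fiL h ξ * (𝓕 η : 𝓢(RR n, ℂ)) ξ := by
  have h1 := Lp.fourierInv_toTemperedDistribution_eq (E := RR n) (F := ℂ) hh.toLp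
  have h2 := congrArg (fun T : 𝓢'(RR n, ℂ) => T (𝓕 η)) h1
  simp only [TemperedDistribution.fourierInv_apply, FourierTransform.fourierInv_fourier_eq,
    Lp.toTemperedDistribution_apply] at h2
  rw [fiL_of_memLp hh]
  simp only [smul_eq_mul] at h2
  have h3 : ∫ x, h x * η x = ∫ x, η x * (hh.toLp : RR n → ℂ) x := by
    refine integral_congr_ae ?_
    filter_upwards [hh.coeFn_toLp] with x hx
    rw [hx, mul_comm]
  rw [h3, h2]
  simp only [mul_comm]

lemma fourier_eq_fourierInv_neg (η : 𝓢(RR n, ℂ)) (ξ : RR n) :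
    (𝓕 η : 𝓢(RR n, ℂ)) ξ = (𝓕⁻ η : 𝓢(RR n, ℂ)) (-ξ) := by
  rw [SchwartzMap.fourierInv_apply_eq]
  simp

lemma measurePreserving_neg' : MeasurePreserving (fun ξ : RR n => -ξ) volume volume :=
  Measure.measurePreserving_neg _

lemma MemW.comp_neg {κ : ℝ} {F : RR n → ℂ} (hF : MemW κ F) : MemW κ (fun ξ => F (-ξ)) := by
  have := MemLp.comp_measurePreserving hF measurePreserving_neg'
  refine (memLp_congr_ae (Eventually.of_forall fun ξ => ?_)).1 this
  simp

lemma nW_comp_neg {κ ρ : ℝ} {F : RR n → ℂ} (hF : AEStronglyMeasurable F volume) :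
    nW ρ κ (fun ξ => F (-ξ)) = nW ρ κ F := by
  have h1 : AEStronglyMeasurable (fun ξ => (wt ρ κ ξ : ℂ) * F ξ) (volume : Measure (RR n)) :=
    (continuous_wtC _ _).aestronglyMeasurable.mul hF
  have := eLpNorm_comp_measurePreserving (p := 2) h1 measurePreserving_neg'
  rw [nW, nW, ← this]
  congr 2
  ext ξ
  simp

lemma nW_congr {κ ρ : ℝ} {F G : RR n → ℂ} (h : F =ᵐ[volume] G) : nW ρ κ F = nW ρ κ G := by
  rw [nW, nW, eLpNorm_congr_ae]
  exact h.mono fun ξ hξ => by simp [hξ]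

lemma sn_eq_nW (ρ κ : ℝ) (ψ : 𝓢(RR n, ℂ)) : sn ρ κ ψ = nW ρ κ (𝓕⁻ ψ : 𝓢(RR n, ℂ)) := sn_eq _ _ _

/-- The reflection is unavoidable: `act` takes the Fourier transform of a distribution, whereas
`fiL` is the inverse transform, used on the test side of a pairing. -/
lemma integral_mul_eq_act {h : RR n → ℂ} (hh : MemLp h 2 (volume : Measure (RR n)))
    (η : 𝓢(RR n, ℂ)) : ∫ x, h x * η x = act (fun ξ => fiL h (-ξ)) η := by
  rw [integral_mul_eq_fiL hh, act, ← integral_neg_eq_self]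
  simp only [fourier_eq_fourierInv_neg, neg_neg]

lemma norm_integral_mul_schwartz_le {κ ρ : ℝ} (hρ : 0 < ρ) {h : RR n → ℂ}
    (hh : MemLp h 2 (volume : Measure (RR n))) (hW : MemW κ (fiL h)) (η : 𝓢(RR n, ℂ)) :
    ‖∫ x, h x * η x‖ ≤ nW ρ κ (fiL h) * sn ρ (-κ) η := by
  rw [integral_mul_eq_act hh, ← nW_comp_neg (memLp_fiL hh).1]
  exact norm_act_le hρ hW.comp_neg η

lemma memW_zero_iff {F : RR n → ℂ} : MemW 0 F ↔ MemLp F 2 (volume : Measure (RR n)) := by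
  simp [MemW]

lemma act_ext' {κ κ' : ℝ} {F G : RR n → ℂ} (hF : MemW κ F) (hG : MemW κ' G)
    (h : ∀ ψ, act F ψ = act G ψ) : F =ᵐ[volume] G :=
  act_ext (hF.mono (min_le_left κ κ')) (hG.mono (min_le_right κ κ')) h

/-- An `L²` function which is bounded, as a functional on Schwartz functions, by the norm of order
`κ` has an inverse Fourier transform of order `-κ`. -/
theorem memW_fiL_of_bound {κ ρ C : ℝ} (hρ : 0 < ρ) (hC : 0 ≤ C) {h : RR n → ℂ}
    (hh : MemLp h 2 (volume : Measure (RR n)))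
    (hb : ∀ η : 𝓢(RR n, ℂ), ‖∫ x, h x * η x‖ ≤ C * sn ρ κ η) :
    MemW (-κ) (fiL h) ∧ nW ρ (-κ) (fiL h) ≤ C := by
  let Λ : 𝓢(RR n, ℂ) →ₗ[ℂ] ℂ :=
    { toFun := fun η => ∫ x, h x * η x
      map_add' := fun η η' => by
        rw [← integral_add (integrable_mul_of_memLp hh (η.memLp 2))
          (integrable_mul_of_memLp hh (η'.memLp 2))]
        simp [mul_add]
      map_smul' := fun c η => by
        rw [RingHom.id_apply, smul_eq_mul, ← integral_const_mul]
        congr 1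
        ext x
        simp
        ring }
  obtain ⟨F, hF, hFC, hFa⟩ := exists_memW_of_bound (κ := -κ) hρ hC Λ (by simpa [Λ] using hb)
  have h0 : MemW 0 (fun ξ => fiL h (-ξ)) := (memW_zero_iff.2 (memLp_fiL hh)).comp_neg
  have he : F =ᵐ[volume] fun ξ => fiL h (-ξ) := act_ext' hF h0 fun ψ => by
    rw [← hFa, ← integral_mul_eq_act hh]; rfl
  refine ⟨?_, ?_⟩
  · simpa using (hF.congr he).comp_neg
  · rw [← nW_comp_neg (memLp_fiL hh).1, ← nW_congr he]
    exact hFC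

/-! ### Pairings with functions of finite order -/

/-- The pairing of the distribution with Fourier transform `F` with the `L²` function `h`. -/
def pair (F h : RR n → ℂ) : ℂ := ∫ ξ, F ξ * fiL h ξ

/-- `h` is an `L²` function with finite norm of order `μ`. -/
def HasOrd (μ : ℝ) (h : RR n → ℂ) : Prop :=
  MemLp h 2 (volume : Measure (RR n)) ∧ MemW μ (fiL h)

lemma HasOrd.mono {μ μ' : ℝ} (hμ : μ' ≤ μ) {h : RR n → ℂ} (hh : HasOrd μ h) : HasOrd μ' h :=
  ⟨hh.1, hh.2.mono hμ⟩

lemma hasOrd_schwartz (μ : ℝ) (ψ : 𝓢(RR n, ℂ)) : HasOrd μ ψ :=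
  ⟨ψ.memLp 2, (memW_fourierInv μ ψ).congr (fiL_schwartz ψ).symm⟩

lemma HasOrd.sub {μ : ℝ} {h h' : RR n → ℂ} (hh : HasOrd μ h) (hh' : HasOrd μ h') :
    HasOrd μ (fun x => h x - h' x) :=
  ⟨hh.1.sub hh'.1, (hh.2.sub hh'.2).congr (fiL_sub hh.1 hh'.1).symm⟩

lemma HasOrd.const_mul {μ : ℝ} {h : RR n → ℂ} (hh : HasOrd μ h) (c : ℂ) :
    HasOrd μ (fun x => c * h x) :=
  ⟨hh.1.const_mul c, (hh.2.const_mul c).congr (fiL_const_mul hh.1 c).symm⟩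

lemma pair_schwartz (F : RR n → ℂ) (ψ : 𝓢(RR n, ℂ)) : pair F ψ = act F ψ :=
  integral_congr_ae ((fiL_schwartz ψ).mono fun ξ h => by simp only [h])

lemma integrable_pair {μ : ℝ} {F h : RR n → ℂ} (hF : MemW (-μ) F) (hh : HasOrd μ h) :
    Integrable (fun ξ => F ξ * fiL h ξ) := integrable_of_memW hF (by simpa using hh.2)

lemma pair_add_right {μ : ℝ} {F h h' : RR n → ℂ} (hF : MemW (-μ) F) (hh : HasOrd μ h)
    (hh' : HasOrd μ h') : pair F (fun x => h x + h' x) = pair F h + pair F h' := by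
  rw [pair, pair, pair, ← integral_add (integrable_pair hF hh) (integrable_pair hF hh')]
  exact integral_congr_ae ((fiL_add hh.1 hh'.1).mono fun ξ h => by simp only [h, mul_add])

lemma pair_sub_right {μ : ℝ} {F h h' : RR n → ℂ} (hF : MemW (-μ) F) (hh : HasOrd μ h)
    (hh' : HasOrd μ h') : pair F (fun x => h x - h' x) = pair F h - pair F h' := by
  rw [pair, pair, pair, ← integral_sub (integrable_pair hF hh) (integrable_pair hF hh')]
  exact integral_congr_ae ((fiL_sub hh.1 hh'.1).mono fun ξ h => by simp only [h, mul_sub])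

lemma pair_const_mul_right {F h : RR n → ℂ} (hh : MemLp h 2 (volume : Measure (RR n))) (c : ℂ) :
    pair F (fun x => c * h x) = c * pair F h := by
  rw [pair, pair, ← integral_const_mul]
  exact integral_congr_ae ((fiL_const_mul hh c).mono fun ξ h => by simp only [h]; ring)

lemma pair_sub_left {μ : ℝ} {F F' h : RR n → ℂ} (hF : MemW (-μ) F) (hF' : MemW (-μ) F')
    (hh : HasOrd μ h) : pair (fun ξ => F ξ - F' ξ) h = pair F h - pair F' h := by
  rw [pair, pair, pair, ← integral_sub (integrable_pair hF hh) (integrable_pair hF' hh)]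
  simp only [sub_mul]

lemma pair_congr_right {F h h' : RR n → ℂ} (e : h =ᵐ[volume] h') : pair F h = pair F h' := by
  rw [pair, pair, fiL_congr e]

lemma norm_pair_le {μ ρ : ℝ} (hρ : 0 < ρ) {F h : RR n → ℂ} (hF : MemW (-μ) F) (hh : HasOrd μ h) :
    ‖pair F h‖ ≤ nW ρ (-μ) F * nW ρ μ (fiL h) := by
  have := norm_integral_le_nW (h := fiL h) hρ hF (by simpa using hh.2)
  rw [neg_neg] at this
  exact this

/-! ### Multipliers of Sobolev norms -/

/-- The product of two Schwartz functions. -/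
def sm (φ ψ : 𝓢(RR n, ℂ)) : 𝓢(RR n, ℂ) := SchwartzMap.smulLeftCLM ℂ φ ψ

@[simp] lemma sm_apply (φ ψ : 𝓢(RR n, ℂ)) (x : RR n) : sm φ ψ x = φ x * ψ x := by
  simp [sm, φ.hasTemperateGrowth]

/-- Multiplication by `a` is bounded in the norm of order `κ` at scale `ρ`, with constant `m`. -/
def IsMul (a : RR n → ℂ) (κ ρ m : ℝ) : Prop :=
  ∀ φ ψ : 𝓢(RR n, ℂ), ‖∫ x, a x * (φ x * ψ x)‖ ≤ m * sn ρ κ φ * sn ρ (-κ) ψ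

/-- The defining bilinear form is symmetric in φ and ψ, so the orders κ and -κ are interchangeable,
with the same constant. -/
lemma IsMul.neg {a : RR n → ℂ} {κ ρ m : ℝ} (h : IsMul a κ ρ m) : IsMul a (-κ) ρ m := by
  intro φ ψ
  have := h ψ φ
  simp only [neg_neg]
  simp only [mul_comm (ψ _) (φ _)] at this
  linarith [mul_right_comm m (sn ρ κ ψ) (sn ρ (-κ) φ)]

lemma memLp_mul_schwartz {a : RR n → ℂ} (ha : MemLp a ∞ (volume : Measure (RR n)))
    {h : RR n → ℂ} (hh : MemLp h 2 (volume : Measure (RR n))) :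
    MemLp (fun x => a x * h x) 2 (volume : Measure (RR n)) := hh.mul ha

lemma IsMul.hasOrd {a : RR n → ℂ} (ha : MemLp a ∞ (volume : Measure (RR n))) {κ ρ m : ℝ}
    (hρ : 0 < ρ) (hm : 0 ≤ m) (h : IsMul a κ ρ m) (ψ : 𝓢(RR n, ℂ)) :
    HasOrd κ (fun x => a x * ψ x) ∧ nW ρ κ (fiL fun x => a x * ψ x) ≤ m * sn ρ κ ψ := by
  have hL := memLp_mul_schwartz ha (ψ.memLp 2)
  have := memW_fiL_of_bound (κ := -κ) hρ (mul_nonneg hm (sn_nonneg ρ κ ψ)) hL (fun η => by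
    simpa only [mul_assoc] using h ψ η)
  rw [neg_neg] at this
  exact ⟨⟨hL, this.1⟩, this.2⟩

lemma IsMul.sn_sm_le {φ : 𝓢(RR n, ℂ)} {κ ρ m : ℝ} (hρ : 0 < ρ) (hm : 0 ≤ m)
    (h : IsMul φ κ ρ m) (ψ : 𝓢(RR n, ℂ)) : sn ρ κ (sm φ ψ) ≤ m * sn ρ κ ψ := by
  have h1 := (h.hasOrd φ.memLp_top hρ hm ψ).2
  have h2 : (fun x => φ x * ψ x) = sm φ ψ := by ext; simp
  rwa [h2, nW_congr (fiL_schwartz _), ← sn_eq_nW] at h1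

lemma HasOrd.schwartz_mul {φ : 𝓢(RR n, ℂ)} {μ ρ m : ℝ} (hρ : 0 < ρ) (hm : 0 ≤ m)
    (h : IsMul φ μ ρ m) {g : RR n → ℂ} (hg : HasOrd μ g) :
    HasOrd μ (fun x => φ x * g x) ∧ nW ρ μ (fiL fun x => φ x * g x) ≤ m * nW ρ μ (fiL g) := by
  have hL := memLp_mul_schwartz φ.memLp_top hg.1
  have := memW_fiL_of_bound (κ := -μ) hρ (mul_nonneg hm (nW_nonneg ρ μ (fiL g))) hL (fun η => by
    have h1 := norm_integral_mul_schwartz_le hρ hg.1 hg.2 (sm φ η)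
    have h2 := h.neg.sn_sm_le hρ hm η
    have h3 : ∫ x, φ x * g x * η x = ∫ x, g x * sm φ η x := by
      congr 1; ext x; simp; ring
    rw [h3]
    refine h1.trans ?_
    calc _ ≤ nW ρ μ (fiL g) * (m * sn ρ (-μ) η) :=
          mul_le_mul_of_nonneg_left h2 (nW_nonneg _ _ _)
      _ = _ := by ring)
  rw [neg_neg] at this
  exact ⟨⟨hL, this.1⟩, this.2⟩

/-- Pairings are controlled by the norm of order μ, so identities known for Schwartz functions
extend to all functions with `HasOrd μ` by approximation. -/
lemma exists_schwartz_close {μ : ℝ} {h : RR n → ℂ} (hh : HasOrd μ h) {ε : ℝ} (hε : 0 < ε) :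
    ∃ ψ : 𝓢(RR n, ℂ), nW 1 μ (fiL fun x => h x - ψ x) ≤ ε := by
  have hd := toLp_fqL_dense (n := n) 1 μ
  obtain ⟨ψ, hψ⟩ := hd.exists_dist_lt (MemLp.toLp _ hh.2) hε
  refine ⟨ψ, ?_⟩
  have e : nW 1 μ (fiL fun x => h x - ψ x) = dist (MemLp.toLp _ hh.2) ((fqL n 1 μ ψ).toLp 2) := by
    rw [nW_congr (fiL_sub hh.1 (ψ.memLp 2)), nW, Lp.dist_def]
    congr 1
    refine eLpNorm_congr_ae ?_
    filter_upwards [hh.2.coeFn_toLp, (fqL n 1 μ ψ).coeFn_toLp 2, fiL_schwartz ψ] with ξ h1 h2 h3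
    simp only [Pi.sub_apply, h1, h2, h3, fqL_apply, mul_sub]
  rw [e]
  exact hψ.le

/-- Locality of the pairing under multiplication by a Schwartz function. -/
theorem pair_schwartz_mul {μ m : ℝ} {F F' g : RR n → ℂ} {φ : 𝓢(RR n, ℂ)}
    (hm : IsMul φ μ 1 m) (hF : MemW (-μ) F) (hF' : MemW (-μ) F') (hg : HasOrd μ g)
    (hact : ∀ ψ, act F (sm φ ψ) = act F' ψ) : pair F (fun x => φ x * g x) = pair F' g := by
  wlog hm0 : 0 ≤ m generalizing m
  · refine this (m := |m|) (fun ψ η => (hm ψ η).trans ?_) (abs_nonneg m)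
    gcongr
    · exact sn_nonneg _ _ _
    · exact sn_nonneg _ _ _
    · exact le_abs_self m
  -- For a Schwartz approximation ψ of g the two sides agree exactly by `hact`; what remains is the
  -- pairing with g - ψ, linear in ε because multiplication by φ is bounded in order μ.
  have key : ∀ ε : ℝ, 0 < ε → ‖pair F (fun x => φ x * g x) - pair F' g‖
      ≤ (nW 1 (-μ) F * m + nW 1 (-μ) F') * ε := by
    intro ε hε
    obtain ⟨ψ, hψ⟩ := exists_schwartz_close hg hε
    have hgψ : HasOrd μ (fun x => g x - ψ x) := hg.sub (hasOrd_schwartz μ ψ)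
    have h1 := norm_pair_le one_pos hF' hgψ
    have h2 := HasOrd.schwartz_mul one_pos hm0 hm hgψ
    have h3 := norm_pair_le one_pos hF h2.1
    have e1 : pair F' (fun x => g x - ψ x) = pair F' g - act F' ψ := by
      rw [pair_sub_right hF' hg (hasOrd_schwartz μ ψ), pair_schwartz]
    have e2 : pair F (fun x => φ x * (g x - ψ x)) = pair F (fun x => φ x * g x) - act F' ψ := by
      have : (fun x => φ x * (g x - ψ x)) = fun x => φ x * g x - sm φ ψ x := by
        ext x; simp; ring
      rw [this, pair_sub_right hF (HasOrd.schwartz_mul one_pos hm0 hm hg).1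
        (hasOrd_schwartz μ (sm φ ψ)), pair_schwartz, hact]
    have e3 : pair F (fun x => φ x * g x) - pair F' g =
        pair F (fun x => φ x * (g x - ψ x)) - pair F' (fun x => g x - ψ x) := by
      rw [e1, e2]; ring
    rw [e3]
    refine (norm_sub_le _ _).trans ?_
    have a1 := nW_nonneg (n := n) 1 (-μ) F
    have a2 := nW_nonneg (n := n) 1 (-μ) F'
    calc _ ≤ nW 1 (-μ) F * (m * ε) + nW 1 (-μ) F' * ε := by
          refine add_le_add (h3.trans ?_) (h1.trans ?_)
          · exact mul_le_mul_of_nonneg_left (h2.2.trans (mul_le_mul_of_nonneg_left hψ hm0)) a1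
          · exact mul_le_mul_of_nonneg_left hψ a2
      _ = _ := by ring
  rw [← sub_eq_zero, ← norm_le_zero_iff]
  have hc : Tendsto (fun ε : ℝ => (nW 1 (-μ) F * m + nW 1 (-μ) F') * ε) (𝓝[>] 0) (𝓝 0) := by
    have : Tendsto (fun ε : ℝ => (nW 1 (-μ) F * m + nW 1 (-μ) F') * ε) (𝓝 0) (𝓝 (_ * 0)) :=
      (continuous_const.mul continuous_id).tendsto 0
    rw [mul_zero] at this
    exact this.mono_left nhdsWithin_le_nhds
  exact ge_of_tendsto hc (eventually_mem_nhdsWithin.mono fun ε hε => key ε hε)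

/-- The product of a multiplier with a distribution of order `κ`. -/
theorem IsMul.exists_mul {a : RR n → ℂ} (ha : MemLp a ∞ (volume : Measure (RR n))) {κ ρ m : ℝ}
    (hρ : 0 < ρ) (hm : 0 ≤ m) (h : IsMul a κ ρ m) {F : RR n → ℂ} (hF : MemW κ F) :
    ∃ F' : RR n → ℂ, MemW κ F' ∧ nW ρ κ F' ≤ m * nW ρ κ F ∧
      ∀ ψ : 𝓢(RR n, ℂ), pair F (fun x => a x * ψ x) = act F' ψ := by
  have hF' : MemW (- -κ) F := by simpa using hF
  let Λ : 𝓢(RR n, ℂ) →ₗ[ℂ] ℂ :=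
    { toFun := fun ψ => pair F (fun x => a x * ψ x)
      map_add' := fun η η' => by
        rw [← pair_add_right hF' (h.neg.hasOrd ha hρ hm η).1 (h.neg.hasOrd ha hρ hm η').1]
        simp [mul_add]
      map_smul' := fun c η => by
        rw [RingHom.id_apply, smul_eq_mul, ← pair_const_mul_right (h.neg.hasOrd ha hρ hm η).1.1]
        congr 1
        ext x
        simp
        ring }
  refine exists_memW_of_bound hρ (mul_nonneg hm (nW_nonneg ρ κ F)) Λ (fun ψ => ?_)
  have h1 := h.neg.hasOrd ha hρ hm ψ
  have h2 := norm_pair_le hρ hF' h1.1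
  rw [neg_neg] at h2
  refine h2.trans ?_
  calc _ ≤ nW ρ κ F * (m * sn ρ (-κ) ψ) := mul_le_mul_of_nonneg_left h1.2 (nW_nonneg _ _ _)
    _ = _ := by ring

/-! ### Weak derivatives and the classes `W^μ_∞` -/

lemma testFunction_lineDeriv_apply {Ω : Opens (RR n)} (φ : 𝓓(Ω, ℝ)) (v x : RR n) :
    (∂_{v} φ) x = fderiv ℝ φ x v := by
  have h : (∂_{v} φ) x = lineDeriv ℝ φ x v :=
    TestFunction.lineDerivCLM_apply_of_le (by simp)
  rw [h]
  exact ((φ.contDiff.differentiable (by simp)) x).lineDeriv_eq_fderiv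

lemma integrable_top_mul {g f : RR n → ℂ} (hg : MemLp g ∞ (volume : Measure (RR n)))
    (hf : Integrable f) : Integrable (fun x => g x * f x) := by
  rw [← memLp_one_iff_integrable] at hf ⊢
  exact hf.mul hg

lemma HasWeakPartial.real {i : Fin n} {g h : RR n → ℂ} (H : HasWeakPartial i g h) {f : RR n → ℝ}
    (hf : ContDiff ℝ ∞ f) (hc : HasCompactSupport f) :
    ∫ x, g x * ((fderiv ℝ f x (dir i) : ℝ) : ℂ) = - ∫ x, h x * ((f x : ℝ) : ℂ) := by
  have := H ⟨f, hf, hc, by simp⟩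
  simp only [testFunction_lineDeriv_apply] at this
  exact this

lemma integrable_contDiff {f : RR n → ℂ} (hf : Continuous f) (hc : HasCompactSupport f) :
    Integrable f := hf.integrable_of_hasCompactSupport hc

/-- Weak derivatives are defined with real test functions; the real and imaginary parts of f are
tested separately and recombined. -/
lemma HasWeakPartial.complex {i : Fin n} {g h : RR n → ℂ} (H : HasWeakPartial i g h)
    (hg : MemLp g ∞ (volume : Measure (RR n))) (hh : MemLp h ∞ (volume : Measure (RR n)))
    {f : RR n → ℂ} (hf : ContDiff ℝ ∞ f) (hc : HasCompactSupport f) :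
    ∫ x, g x * fderiv ℝ f x (dir i) = - ∫ x, h x * f x := by
  have hre : ContDiff ℝ ∞ fun x => (f x).re := Complex.reCLM.contDiff.comp hf
  have him : ContDiff ℝ ∞ fun x => (f x).im := Complex.imCLM.contDiff.comp hf
  have cre : HasCompactSupport fun x => (f x).re := hc.comp_left (g := Complex.re) rfl
  have cim : HasCompactSupport fun x => (f x).im := hc.comp_left (g := Complex.im) rfl
  have hd : Differentiable ℝ f := hf.differentiable (by simp)
  have dre : ∀ x v, fderiv ℝ (fun x => (f x).re) x v = (fderiv ℝ f x v).re := fun x v => by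
    have := (Complex.reCLM.hasFDerivAt.comp x (hd x).hasFDerivAt).fderiv
    exact congrArg (fun L => L v) this
  have dim : ∀ x v, fderiv ℝ (fun x => (f x).im) x v = (fderiv ℝ f x v).im := fun x v => by
    have := (Complex.imCLM.hasFDerivAt.comp x (hd x).hasFDerivAt).fderiv
    exact congrArg (fun L => L v) this
  have e1 := H.real hre cre
  have e2 := H.real him cim
  have I : ∀ (k : RR n → ℂ), MemLp k ∞ (volume : Measure (RR n)) → ∀ u : RR n → ℝ, Continuous u →
      HasCompactSupport u → Integrable fun x => k x * ((u x : ℝ) : ℂ) := fun k hk u hu huc =>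
    integrable_top_mul hk (integrable_contDiff (Complex.continuous_ofReal.comp hu)
      (huc.comp_left (g := fun r : ℝ => (r : ℂ)) Complex.ofReal_zero))
  have cd : ∀ {u : RR n → ℝ}, ContDiff ℝ ∞ u → Continuous fun x => fderiv ℝ u x (dir i) :=
    fun hu => (hu.continuous_fderiv (by simp)).clm_apply continuous_const
  have dd : ∀ {u : RR n → ℝ}, HasCompactSupport u →
      HasCompactSupport fun x => fderiv ℝ u x (dir i) := fun hu => hu.fderiv_apply ℝ (dir i)
  have s1 : ∫ x, g x * fderiv ℝ f x (dir i) =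
      (∫ x, g x * ((fderiv ℝ (fun x => (f x).re) x (dir i) : ℝ) : ℂ)) +
      Complex.I * ∫ x, g x * ((fderiv ℝ (fun x => (f x).im) x (dir i) : ℝ) : ℂ) := by
    rw [← integral_const_mul, ← integral_add (I g hg _ (cd hre) (dd cre))
      ((I g hg _ (cd him) (dd cim)).const_mul _)]
    congr 1; ext x
    rw [dre, dim]
    conv_lhs => rw [← Complex.re_add_im (fderiv ℝ f x (dir i))]
    ring
  have s2 : ∫ x, h x * f x = (∫ x, h x * (((f x).re : ℝ) : ℂ)) +
      Complex.I * ∫ x, h x * (((f x).im : ℝ) : ℂ) := by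
    rw [← integral_const_mul, ← integral_add (I h hh _ hre.continuous cre)
      ((I h hh _ him.continuous cim).const_mul _)]
    congr 1; ext x
    conv_lhs => rw [← Complex.re_add_im (f x)]
    ring
  rw [s1, s2, e1, e2]
  ring

/-- A smooth cutoff function, equal to one on the unit ball. -/
def cutBump (n : ℕ) : ContDiffBump (0 : RR n) := ⟨1, 2, one_pos, one_lt_two⟩

/-- Compact support is removed by the cutoffs χ(x/(k+1)). Their derivatives carry a factor 1/(k+1),
so the extra term of the product rule vanishes in the limit by dominated convergence. -/
lemma HasWeakPartial.schwartz {i : Fin n} {g h : RR n → ℂ} (H : HasWeakPartial i g h)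
    (hg : MemLp g ∞ (volume : Measure (RR n))) (hh : MemLp h ∞ (volume : Measure (RR n)))
    (φ : 𝓢(RR n, ℂ)) :
    ∫ x, g x * (∂_{dir i} φ) x = - ∫ x, h x * φ x := by
  set c : ℕ → ℝ := fun k => 1 / ((k : ℝ) + 1) with hc
  have c0 : ∀ k, 0 < c k := fun k => by positivity
  have clim : Tendsto c atTop (𝓝 0) := tendsto_one_div_add_atTop_nhds_zero_nat
  set χ : RR n → ℂ := fun x => ((cutBump n x : ℝ) : ℂ) with hχ
  have χs : ContDiff ℝ ∞ χ := Complex.ofRealCLM.contDiff.comp (cutBump n).contDiff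
  have χc : HasCompactSupport χ :=
    (cutBump n).hasCompactSupport.comp_left (g := fun r : ℝ => (r : ℂ)) Complex.ofReal_zero
  have χ1 : ∀ x, ‖χ x‖ ≤ 1 := fun x => by
    simp only [hχ, Complex.norm_real, Real.norm_eq_abs]
    rw [abs_of_nonneg (cutBump n).nonneg]
    exact (cutBump n).le_one
  obtain ⟨M, hM⟩ : ∃ M, ∀ x, ‖fderiv ℝ χ x (dir i)‖ ≤ M := by
    have := (χs.continuous_fderiv (by simp)).clm_apply (continuous_const (y := dir i))
    exact this.bounded_above_of_compact_support (χc.fderiv_apply ℝ (dir i))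
  have scs : ∀ k, ContDiff ℝ ∞ fun x => χ (c k • x) := fun k =>
    χs.comp (contDiff_const_smul (c k))
  have fs : ∀ k, ContDiff ℝ ∞ fun x => χ (c k • x) * φ x := fun k => (scs k).mul (φ.smooth ⊤)
  have fc : ∀ k, HasCompactSupport fun x => χ (c k • x) * φ x := fun k =>
    (χc.comp_smul (c0 k).ne').mul_right
  have hfd : ∀ k x, fderiv ℝ (fun x => χ (c k • x) * φ x) x (dir i) =
      χ (c k • x) * (∂_{dir i} φ) x + (c k : ℂ) * fderiv ℝ χ (c k • x) (dir i) * φ x := by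
    intro k x
    have h1 : HasFDerivAt (fun x => χ (c k • x)) (c k • fderiv ℝ χ (c k • x)) x := by
      have a := (χs.differentiable (by simp) (c k • x)).hasFDerivAt
      have b : HasFDerivAt (fun x : RR n => c k • x) (c k • ContinuousLinearMap.id ℝ (RR n)) x :=
        (hasFDerivAt_id x).const_smul (c k)
      have e : c k • fderiv ℝ χ (c k • x) =
          (fderiv ℝ χ (c k • x)).comp (c k • ContinuousLinearMap.id ℝ (RR n)) := by ext v; simp
      rw [e]
      exact a.comp x b
    have h2 : HasFDerivAt (fun x => χ (c k • x) * φ x) _ x := h1.mul (φ.hasFDerivAt x)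
    rw [h2.fderiv, SchwartzMap.lineDerivOp_apply_eq_fderiv]
    simp
    ring
  have e : ∀ k, ∫ x, g x * (χ (c k • x) * (∂_{dir i} φ) x +
      (c k : ℂ) * fderiv ℝ χ (c k • x) (dir i) * φ x) = - ∫ x, h x * (χ (c k • x) * φ x) := by
    intro k
    rw [← H.complex hg hh (fs k) (fc k)]
    simp only [hfd]
  have cc : ∀ x : RR n, Tendsto (fun k => c k • x) atTop (𝓝 0) := fun x => by
    simpa using clim.smul_const x
  have χlim : ∀ x, Tendsto (fun k => χ (c k • x)) atTop (𝓝 1) := fun x => by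
    have := (χs.continuous.tendsto 0).comp (cc x)
    have h1 : χ 0 = 1 := by
      simp only [hχ]
      rw [(cutBump n).one_of_mem_closedBall (by simp [cutBump])]
      simp
    rwa [h1] at this
  have c1 : ∀ k, c k ≤ 1 := fun k => by
    simp only [hc]
    rw [div_le_one (by positivity)]
    linarith [Nat.cast_nonneg (α := ℝ) k]
  have L1 : Tendsto (fun k => ∫ x, g x * (χ (c k • x) * (∂_{dir i} φ) x +
      (c k : ℂ) * fderiv ℝ χ (c k • x) (dir i) * φ x)) atTop
      (𝓝 (∫ x, g x * (∂_{dir i} φ) x)) := by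
    refine tendsto_integral_of_dominated_convergence
      (fun x => ‖g x * (∂_{dir i} φ) x‖ + M * ‖g x * φ x‖) (fun k => ?_) ?_ (fun k => ?_) ?_
    · refine hg.1.mul (Continuous.aestronglyMeasurable ?_)
      have := (fs k).continuous_fderiv (by simp)
      have := this.clm_apply (continuous_const (y := dir i))
      simpa only [hfd] using this
    · exact (integrable_top_mul hg (∂_{dir i} φ).integrable).norm.add
        ((integrable_top_mul hg φ.integrable).norm.const_mul M)
    · refine Eventually.of_forall fun x => ?_
      have hck : ‖(c k : ℂ)‖ ≤ 1 := by
        simp only [Complex.norm_real, Real.norm_eq_abs, abs_of_pos (c0 k)]; exact c1 k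
      rw [norm_mul, norm_mul, norm_mul]
      have t1 : ‖χ (c k • x) * (∂_{dir i} φ) x‖ ≤ ‖(∂_{dir i} φ) x‖ := by
        rw [norm_mul]
        exact mul_le_of_le_one_left (norm_nonneg _) (χ1 _)
      have t2 : ‖(c k : ℂ) * fderiv ℝ χ (c k • x) (dir i) * φ x‖ ≤ M * ‖φ x‖ := by
        rw [norm_mul, norm_mul]
        have := mul_le_mul hck (hM (c k • x)) (norm_nonneg _) zero_le_one
        rw [one_mul] at this
        exact mul_le_mul_of_nonneg_right this (norm_nonneg _)
      have := (norm_add_le _ _).trans (add_le_add t1 t2)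
      have := mul_le_mul_of_nonneg_left this (norm_nonneg (g x))
      linarith
    · refine Eventually.of_forall fun x => ?_
      have t1 := (χlim x).mul_const ((∂_{dir i} φ) x)
      have t2 : Tendsto (fun k => (c k : ℂ) * fderiv ℝ χ (c k • x) (dir i) * φ x) atTop (𝓝 0) := by
        have a1 : Tendsto (fun k => ((c k : ℝ) : ℂ)) atTop (𝓝 ((0 : ℝ) : ℂ)) :=
          (Complex.continuous_ofReal.tendsto 0).comp clim
        have a2 : Continuous fun y => fderiv ℝ χ y (dir i) :=
          (χs.continuous_fderiv (by simp)).clm_apply continuous_const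
        have a3 := (a2.tendsto 0).comp (cc x)
        have := (a1.mul a3).mul_const (φ x)
        simpa using this
      have := (t1.add t2).const_mul (g x)
      simpa using this
  have L2 : Tendsto (fun k => - ∫ x, h x * (χ (c k • x) * φ x)) atTop (𝓝 (- ∫ x, h x * φ x)) := by
    refine Tendsto.neg (tendsto_integral_of_dominated_convergence
      (fun x => ‖h x * φ x‖) (fun k => ?_) ?_ (fun k => ?_) ?_)
    · exact hh.1.mul (fs k).continuous.aestronglyMeasurable
    · exact (integrable_top_mul hh φ.integrable).norm
    · refine Eventually.of_forall fun x => ?_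
      rw [norm_mul, norm_mul, norm_mul]
      have := mul_le_of_le_one_left (norm_nonneg (φ x)) (χ1 (c k • x))
      exact mul_le_mul_of_nonneg_left this (norm_nonneg _)
    · refine Eventually.of_forall fun x => ?_
      have := ((χlim x).mul_const (φ x)).const_mul (h x)
      simpa using this
  simp only [e] at L1
  exact tendsto_nhds_unique L1 L2

lemma MemWkInfty.memLp {k : ℕ} {θ : ℝ} {g : RR n → ℂ} (hg : MemWkInfty k θ g) :
    MemLp g ∞ (volume : Measure (RR n)) := by
  cases k with
  | zero => exact hg.1
  | succ k => exact hg.1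

lemma exists_ae_bound {g : RR n → ℂ} (hg : MemLp g ∞ (volume : Measure (RR n))) :
    ∃ S : ℝ, 0 ≤ S ∧ ∀ᵐ x, ‖g x‖ ≤ S := by
  refine ⟨(eLpNorm g ∞ volume).toReal, ENNReal.toReal_nonneg, ?_⟩
  have h := ae_le_eLpNormEssSup (f := g) (μ := (volume : Measure (RR n)))
  filter_upwards [h] with x hx
  rw [← eLpNorm_exponent_top] at hx
  have := ENNReal.toReal_mono hg.2.ne hx
  simpa using this

/-- A bounded function with bounded weak derivatives of first order is Lipschitz off a null set. -/
theorem exists_lipschitz_of_hasWeakPartial {g : RR n → ℂ} (hg : MemLp g ∞ (volume : Measure (RR n)))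
    {h : Fin n → RR n → ℂ} (hh : ∀ i, MemLp (h i) ∞ (volume : Measure (RR n)))
    (H : ∀ i, HasWeakPartial i g (h i)) :
    ∃ L : ℝ, 0 ≤ L ∧ ∃ p : RR n → Prop, (∀ᵐ x, p x) ∧
      ∀ x y, p x → p y → ‖g x - g y‖ ≤ L * ‖x - y‖ := by
  choose S hS0 hS using fun i => exists_ae_bound (hh i)
  have hloc : LocallyIntegrable g (volume : Measure (RR n)) := hg.locallyIntegrable (by simp)
  -- Mollifiers with outer radius exactly twice the inner one: a bounded ratio of radii is what
  -- almost everywhere convergence of the mollifications requires (`K := 2` below).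
  set φ : ℕ → ContDiffBump (0 : RR n) := fun k =>
    ⟨1 / ((k : ℝ) + 1), 2 * (1 / ((k : ℝ) + 1)), by positivity,
      by have : 0 < 1 / ((k : ℝ) + 1) := by positivity
         linarith⟩ with hφ
  have hlim : Tendsto (fun k => (φ k).rOut) atTop (𝓝 0) := by
    have := (tendsto_one_div_add_atTop_nhds_zero_nat (𝕜 := ℝ)).const_mul 2
    simpa [hφ] using this
  have hae := ContDiffBump.ae_convolution_tendsto_right_of_locallyIntegrable (μ := volume)
    (K := 2) hlim (Eventually.of_forall fun k => le_rfl) hloc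
  set G : ℕ → RR n → ℂ := fun k =>
    convolution ((φ k).normed volume) g (ContinuousLinearMap.lsmul ℝ ℝ) volume with hG
  set D : ℕ → RR n → (RR n →L[ℝ] ℂ) := fun k => convolution (fderiv ℝ ((φ k).normed volume)) g
      ((ContinuousLinearMap.lsmul ℝ ℝ : ℝ →L[ℝ] ℂ →L[ℝ] ℂ).precompL (RR n)) volume with hD
  have hder : ∀ k x, HasFDerivAt (G k) (D k x) x := fun k x =>
    (φ k).hasCompactSupport_normed.hasFDerivAt_convolution_left _
      ((φ k).contDiff_normed (n := 1)) hloc x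
  -- The derivative of a mollification is an average of the weak derivative against a probability
  -- density, hence bounded by its essential supremum uniformly in k.
  have hDi : ∀ k x i, ‖D k x (dir i)‖ ≤ S i := by
    intro k x i
    set f : RR n → ℝ := fun z => (φ k).normed volume (x - z) with hf
    have fs : ContDiff ℝ ∞ f := (φ k).contDiff_normed.comp (contDiff_const.sub contDiff_id)
    have fc : HasCompactSupport f := by
      have := (φ k).hasCompactSupport_normed (μ := volume)
      exact this.comp_homeomorph (Homeomorph.subLeft x)
    have fd : ∀ z, fderiv ℝ f z (dir i) = - fderiv ℝ ((φ k).normed volume) (x - z) (dir i) := by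
      intro z
      have a := (((φ k).contDiff_normed (μ := volume) (n := 1)).differentiable (by simp)
        (x - z)).hasFDerivAt
      have b : HasFDerivAt (fun z : RR n => x - z) (-ContinuousLinearMap.id ℝ (RR n)) z :=
        (hasFDerivAt_id z).const_sub x
      have h2 : HasFDerivAt f _ z := a.comp z b
      rw [h2.fderiv]
      simp
    have e1 : D k x (dir i) = ∫ z, fderiv ℝ ((φ k).normed volume) (x - z) (dir i) • g z := by
      have hex : ConvolutionExistsAt (fderiv ℝ ((φ k).normed volume)) g x
          ((ContinuousLinearMap.lsmul ℝ ℝ : ℝ →L[ℝ] ℂ →L[ℝ] ℂ).precompL (RR n)) volume :=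
        ((φ k).hasCompactSupport_normed.fderiv ℝ).convolutionExists_left _
          ((φ k).contDiff_normed.continuous_fderiv (n := 1) (by simp)) hloc x
      simp only [hD]
      rw [convolution_eq_swap, ContinuousLinearMap.integral_apply]
      · rfl
      · exact hex.integrable_swap
    have e2 : ∫ z, fderiv ℝ ((φ k).normed volume) (x - z) (dir i) • g z =
        ∫ z, h i z * ((f z : ℝ) : ℂ) := by
      have := (H i).real fs fc
      rw [← neg_inj, ← this, ← integral_neg]
      congr 1; ext z
      rw [fd]
      simp [mul_comm]
    rw [e1, e2]
    have e3 : ∫ z, f z = 1 := by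
      simp only [hf]
      rw [integral_sub_left_eq_self (fun z => (φ k).normed volume z)]
      exact (φ k).integral_normed
    have fint : Integrable f := fs.continuous.integrable_of_hasCompactSupport fc
    calc _ ≤ ∫ z, S i * f z := by
          refine norm_integral_le_of_norm_le (fint.const_mul _) ?_
          filter_upwards [hS i] with z hz
          rw [norm_mul, Complex.norm_real, Real.norm_eq_abs, abs_of_nonneg ((φ k).nonneg_normed _)]
          exact mul_le_mul_of_nonneg_right hz ((φ k).nonneg_normed _)
      _ = S i := by rw [integral_const_mul, e3, mul_one]
  have hDn : ∀ k x, ‖D k x‖ ≤ ∑ i, S i := by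
    intro k x
    refine ContinuousLinearMap.opNorm_le_bound _ (Finset.sum_nonneg fun i _ => hS0 i) fun v => ?_
    have hv : v = ∑ i, v i • (dir i : RR n) := by
      ext j
      simp [Finset.sum_apply, Pi.single_apply]
    conv_lhs => rw [hv]
    rw [map_sum, Finset.sum_mul]
    refine (norm_sum_le _ _).trans (Finset.sum_le_sum fun i _ => ?_)
    rw [map_smul, norm_smul, mul_comm]
    exact mul_le_mul (hDi k x i) (PiLp.norm_apply_le v i) (norm_nonneg _) (hS0 i)
  -- The exceptional set is where the mollifications fail to converge to g; off it the uniform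
  -- Lipschitz bound passes to the limit.
  refine ⟨∑ i, S i, Finset.sum_nonneg fun i _ => hS0 i, _, hae, fun x y hx hy => ?_⟩
  refine le_of_tendsto ((hx.sub hy).norm) (Eventually.of_forall fun k => ?_)
  exact Convex.norm_image_sub_le_of_norm_hasFDerivWithin_le (s := Set.univ)
    (fun z _ => (hder k z).hasFDerivWithinAt) (fun z _ => hDn k z) convex_univ trivial trivial

/-! ### Multiplication by Hölder continuous functions -/

/-- The weight of the `j`-th dyadic difference in the norm of order `κ`. -/
def dyad (κ : ℝ) (j : ℕ) (t : ℝ) : ℝ :=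
  (4 : ℝ) ^ ((j : ℝ) * κ) * (4 * Real.sin (Real.pi * (t / 2 ^ j)) ^ 2)

lemma continuous_dyad (κ : ℝ) (j : ℕ) : Continuous (dyad κ j) := by
  unfold dyad; fun_prop

/-- One term of the sum suffices. If 2^k ≤ |t| < 2^{k+1}, then for j = k + 2 the quotient |t|/2^j
lies in [1/4, 1/2], where sin(πx) ≥ 2x ≥ 1/2, so the sine factor is at least 1. -/
lemma rpow_sq_le_tsum_dyad {κ : ℝ} (h0 : 0 ≤ κ) (t : ℝ) :
    ENNReal.ofReal ((t ^ 2) ^ κ) ≤ 1 + ∑' j, ENNReal.ofReal (dyad κ j t) := by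
  by_cases ht : |t| ≤ 1
  · refine le_trans ?_ (le_add_of_nonneg_right (zero_le))
    rw [← ENNReal.ofReal_one]
    refine ENNReal.ofReal_le_ofReal (Real.rpow_le_one (sq_nonneg t) ?_ h0)
    exact (sq_le_one_iff_abs_le_one t).2 ht
  · push Not at ht
    obtain ⟨k, hk1, hk2⟩ := exists_nat_pow_near ht.le (one_lt_two (α := ℝ))
    refine le_trans ?_ ((ENNReal.le_tsum (k + 2)).trans (le_add_of_nonneg_left (zero_le)))
    refine ENNReal.ofReal_le_ofReal ?_
    have e1 : (t ^ 2) ^ κ ≤ (4 : ℝ) ^ (((k + 2 : ℕ) : ℝ) * κ) := by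
      rw [Real.rpow_mul (by norm_num)]
      refine Real.rpow_le_rpow (sq_nonneg t) ?_ h0
      rw [Real.rpow_natCast, ← sq_abs]
      have : (4 : ℝ) ^ (k + 2) = (2 ^ (k + 2)) ^ 2 := by rw [← pow_mul, mul_comm, pow_mul]; norm_num
      rw [this]
      refine pow_le_pow_left₀ (abs_nonneg t) (hk2.le.trans ?_) 2
      exact pow_le_pow_right₀ one_le_two (by omega)
    have e2 : (1 : ℝ) ≤ 4 * Real.sin (Real.pi * (t / 2 ^ (k + 2))) ^ 2 := by
      set x := |t| / 2 ^ (k + 2) with hx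
      have hx1 : 1 / 4 ≤ x := by
        rw [hx, le_div_iff₀ (by positivity)]
        calc (1 : ℝ) / 4 * 2 ^ (k + 2) = 2 ^ k := by ring
          _ ≤ _ := hk1
      have hx2 : x ≤ 1 / 2 := by
        rw [hx, div_le_iff₀ (by positivity)]
        calc |t| ≤ 2 ^ (k + 1) := hk2.le
          _ = _ := by ring
      have e3 : Real.sin (Real.pi * (t / 2 ^ (k + 2))) ^ 2 = Real.sin (Real.pi * x) ^ 2 := by
        rcases abs_cases t with ⟨h, -⟩ | ⟨h, -⟩
        · rw [hx, h]
        · rw [hx, h, neg_div, mul_neg, Real.sin_neg, neg_sq]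
      rw [e3]
      have e4 : 2 / Real.pi * (Real.pi * x) ≤ Real.sin (Real.pi * x) :=
        Real.mul_le_sin (by positivity) (by nlinarith [Real.pi_pos])
      have e5 : 2 / Real.pi * (Real.pi * x) = 2 * x := by field_simp
      nlinarith
    calc (t ^ 2) ^ κ ≤ (4 : ℝ) ^ (((k + 2 : ℕ) : ℝ) * κ) * 1 := by rw [mul_one]; exact e1
      _ ≤ _ := mul_le_mul_of_nonneg_left e2 (by positivity)

/-- With truncated subtraction the exponent is |J - j|, and each distance is attained by at most two
values of j. -/
lemma tsum_pow_dist_le (q : ℝ≥0∞) (J : ℕ) :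
    ∑' j : ℕ, q ^ ((J - j) + (j - J)) ≤ 2 * ∑' j : ℕ, q ^ j := by
  rw [← Summable.sum_add_tsum_nat_add' (k := J) ENNReal.summable, two_mul]
  refine add_le_add ?_ ?_
  · rw [← Finset.sum_range_reflect]
    refine le_trans ?_ ((ENNReal.sum_le_tsum (f := fun j : ℕ => q ^ j) ((Finset.range J).image (· + 1))))
    rw [Finset.sum_image (by simp)]
    refine Finset.sum_le_sum fun j hj => ?_
    rw [Finset.mem_range] at hj
    have e : (J - (J - 1 - j)) + (J - 1 - j - J) = j + 1 := by omega
    rw [e]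
  · refine ENNReal.tsum_le_tsum fun j => ?_
    have e : (J - (j + J)) + (j + J - J) = j := by omega
    rw [e]

/-- Let 4^J ≤ 1 + t² < 4^{J+1}. For j ≤ J the sine is bounded by 1 and the weights 4^{jκ} grow up to
the size of (1 + t²)^κ; for j > J the estimate sin² ≤ π² t²/4^j leaves decay 4^{-j(1-κ)}. Both tails
are geometric exactly because 0 < κ < 1. -/
lemma tsum_dyad_le {κ : ℝ} (h0 : 0 < κ) (h1 : κ < 1) :
    ∃ C : ℝ, 0 ≤ C ∧ ∀ t : ℝ, ∑' j, ENNReal.ofReal (dyad κ j t) ≤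
      ENNReal.ofReal (C * (1 + t ^ 2) ^ κ) := by
  set q : ℝ := (4 : ℝ) ^ (-(min κ (1 - κ))) with hq
  have hm : 0 < min κ (1 - κ) := lt_min h0 (by linarith)
  have hq0 : 0 < q := by positivity
  have hq1 : q < 1 := Real.rpow_lt_one_of_one_lt_of_neg (by norm_num) (by linarith)
  have hs : ∑' j : ℕ, (ENNReal.ofReal q) ^ j = ENNReal.ofReal ((1 - q)⁻¹) := by
    rw [ENNReal.tsum_geometric, ENNReal.ofReal_inv_of_pos (by linarith),
      ENNReal.ofReal_sub _ hq0.le, ENNReal.ofReal_one]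
  refine ⟨16 * Real.pi ^ 2 * (2 * (1 - q)⁻¹), by
    have : 0 < (1 - q)⁻¹ := inv_pos.2 (by linarith)
    positivity, fun t => ?_⟩
  set T := 1 + t ^ 2 with hT
  have hT1 : 1 ≤ T := by rw [hT]; nlinarith [sq_nonneg t]
  obtain ⟨J, hJ1, hJ2⟩ := exists_nat_pow_near hT1 (by norm_num : (1 : ℝ) < 4)
  have hpi : (1 : ℝ) ≤ Real.pi ^ 2 := by nlinarith [Real.pi_gt_three]
  have qle : ∀ (k : ℕ) (s : ℝ), min κ (1 - κ) ≤ s → (4 : ℝ) ^ (-((k : ℝ) * s)) ≤ q ^ k := by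
    intro k s hs
    rw [hq, ← Real.rpow_natCast, ← Real.rpow_mul (by norm_num)]
    refine Real.rpow_le_rpow_of_exponent_le (by norm_num) ?_
    have := mul_le_mul_of_nonneg_left hs (Nat.cast_nonneg (α := ℝ) k)
    linarith
  have key : ∀ j, dyad κ j t ≤ 16 * Real.pi ^ 2 * T ^ κ * q ^ ((J - j) + (j - J)) := by
    intro j
    rcases le_or_gt j J with h | h
    · have e1 : (j - J : ℕ) = 0 := by omega
      rw [e1, add_zero]
      have e2 : (4 : ℝ) ^ ((j : ℝ) * κ) ≤ T ^ κ * q ^ (J - j) := by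
        have : (4 : ℝ) ^ ((j : ℝ) * κ) =
            (4 : ℝ) ^ ((J : ℝ) * κ) * (4 : ℝ) ^ (-(((J - j : ℕ) : ℝ) * κ)) := by
          rw [← Real.rpow_add (by norm_num), Nat.cast_sub h]
          congr 1; ring
        rw [this]
        refine mul_le_mul ?_ (qle _ _ (min_le_left _ _)) (by positivity) (by positivity)
        rw [Real.rpow_mul (by norm_num), Real.rpow_natCast]
        exact Real.rpow_le_rpow (by positivity) hJ1 h0.le
      have e3 : 4 * Real.sin (Real.pi * (t / 2 ^ j)) ^ 2 ≤ 16 * Real.pi ^ 2 := by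
        have := Real.sin_sq_le_one (Real.pi * (t / 2 ^ j))
        nlinarith
      calc dyad κ j t ≤ (T ^ κ * q ^ (J - j)) * (16 * Real.pi ^ 2) :=
            mul_le_mul e2 e3 (by positivity) (by positivity)
        _ = _ := by ring
    · have e1 : (J - j : ℕ) = 0 := by omega
      rw [e1, zero_add]
      have e2 : (4 : ℝ) ^ ((j : ℝ) * κ) * (T / 4 ^ j) ≤ 4 * (T ^ κ * q ^ (j - J)) := by
        have a1 : T = T ^ κ * T ^ (1 - κ) := by
          rw [← Real.rpow_add (by linarith)]; simp
        have a2 : T ^ (1 - κ) ≤ (4 : ℝ) ^ (((J + 1 : ℕ) : ℝ) * (1 - κ)) := by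
          rw [Real.rpow_mul (by norm_num), Real.rpow_natCast]
          exact Real.rpow_le_rpow (by linarith) hJ2.le (by linarith)
        have a3 : (4 : ℝ) ^ ((j : ℝ) * κ) / 4 ^ j = (4 : ℝ) ^ (-((j : ℝ) * (1 - κ))) := by
          rw [← Real.rpow_natCast, ← Real.rpow_sub (by norm_num)]
          congr 1; ring
        have a4 : (4 : ℝ) ^ (-((j : ℝ) * (1 - κ))) * (4 : ℝ) ^ (((J + 1 : ℕ) : ℝ) * (1 - κ)) =
            (4 : ℝ) ^ (1 - κ) * (4 : ℝ) ^ (-(((j - J : ℕ) : ℝ) * (1 - κ))) := by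
          rw [← Real.rpow_add (by norm_num), ← Real.rpow_add (by norm_num), Nat.cast_sub h.le]
          congr 1; push_cast; ring
        have a5 : (4 : ℝ) ^ (1 - κ) ≤ 4 := by
          calc (4 : ℝ) ^ (1 - κ) ≤ (4 : ℝ) ^ (1 : ℝ) :=
                Real.rpow_le_rpow_of_exponent_le (by norm_num) (by linarith)
            _ = 4 := by simp
        calc (4 : ℝ) ^ ((j : ℝ) * κ) * (T / 4 ^ j)
            = (4 : ℝ) ^ ((j : ℝ) * κ) / 4 ^ j * (T ^ κ * T ^ (1 - κ)) := by rw [← a1]; ring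
          _ ≤ (4 : ℝ) ^ (-((j : ℝ) * (1 - κ))) * (T ^ κ * (4 : ℝ) ^ (((J + 1 : ℕ) : ℝ) * (1 - κ))) := by
              rw [a3]; gcongr
          _ = T ^ κ * ((4 : ℝ) ^ (-((j : ℝ) * (1 - κ))) *
                (4 : ℝ) ^ (((J + 1 : ℕ) : ℝ) * (1 - κ))) := by ring
          _ = T ^ κ * ((4 : ℝ) ^ (1 - κ) * (4 : ℝ) ^ (-(((j - J : ℕ) : ℝ) * (1 - κ)))) := by rw [a4]
          _ ≤ T ^ κ * (4 * q ^ (j - J)) := by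
              gcongr
              exact qle _ _ (min_le_right _ _)
          _ = _ := by ring
      have e3 : Real.sin (Real.pi * (t / 2 ^ j)) ^ 2 ≤ Real.pi ^ 2 * (T / 4 ^ j) := by
        have b1 : Real.sin (Real.pi * (t / 2 ^ j)) ^ 2 ≤ (Real.pi * (t / 2 ^ j)) ^ 2 := by
          rw [sq_le_sq]; exact Real.abs_sin_le_abs
        refine b1.trans ?_
        have : (Real.pi * (t / 2 ^ j)) ^ 2 = Real.pi ^ 2 * (t ^ 2 / 4 ^ j) := by
          rw [mul_pow, div_pow, ← pow_mul, mul_comm j 2, pow_mul]; norm_num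
        rw [this]
        gcongr
        rw [hT]; linarith
      calc dyad κ j t ≤ (4 : ℝ) ^ ((j : ℝ) * κ) * (4 * (Real.pi ^ 2 * (T / 4 ^ j))) := by
            unfold dyad; gcongr
        _ = 4 * Real.pi ^ 2 * ((4 : ℝ) ^ ((j : ℝ) * κ) * (T / 4 ^ j)) := by ring
        _ ≤ 4 * Real.pi ^ 2 * (4 * (T ^ κ * q ^ (j - J))) := by gcongr
        _ = _ := by ring
  calc ∑' j, ENNReal.ofReal (dyad κ j t)
      ≤ ∑' j, ENNReal.ofReal (16 * Real.pi ^ 2 * T ^ κ) * ENNReal.ofReal q ^ ((J - j) + (j - J)) := by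
        refine ENNReal.tsum_le_tsum fun j => ?_
        rw [← ENNReal.ofReal_pow hq0.le, ← ENNReal.ofReal_mul (by positivity)]
        exact ENNReal.ofReal_le_ofReal (key j)
    _ ≤ ENNReal.ofReal (16 * Real.pi ^ 2 * T ^ κ) * (2 * ENNReal.ofReal ((1 - q)⁻¹)) := by
        rw [ENNReal.tsum_mul_left, ← hs]
        gcongr
        exact tsum_pow_dist_le _ _
    _ = _ := by
        have : (2 : ℝ≥0∞) = ENNReal.ofReal 2 := by simp
        rw [this, ← ENNReal.ofReal_mul (by norm_num), ← ENNReal.ofReal_mul (by positivity)]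
        congr 1; ring

/-- Subadditivity of the power κ ≤ 1; it reduces the weight on ℝⁿ to one coordinate at a time. -/
lemma rpow_one_add_sum_le {κ : ℝ} (h0 : 0 ≤ κ) (h1 : κ ≤ 1) {ι : Type*} (s : Finset ι) (t : ι → ℝ) :
    (1 + ∑ i ∈ s, t i ^ 2) ^ κ ≤ 1 + ∑ i ∈ s, (t i ^ 2) ^ κ := by
  classical
  induction s using Finset.induction_on with
  | empty => simp
  | insert a s ha ih =>
    rw [Finset.sum_insert ha, Finset.sum_insert ha]
    have hs : 0 ≤ ∑ i ∈ s, t i ^ 2 := Finset.sum_nonneg fun i _ => sq_nonneg _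
    have := Real.rpow_add_le_add_rpow (sq_nonneg (t a)) (by linarith : 0 ≤ 1 + ∑ i ∈ s, t i ^ 2) h0 h1
    rw [show 1 + (t a ^ 2 + ∑ i ∈ s, t i ^ 2) = t a ^ 2 + (1 + ∑ i ∈ s, t i ^ 2) by ring]
    linarith

lemma wt_sq_eq_sum (ρ κ : ℝ) (ξ : RR n) : wt ρ κ ξ ^ 2 = (1 + ∑ i, (ρ * ξ i) ^ 2) ^ κ := by
  rw [wt_sq, EuclideanSpace.norm_sq_eq, Finset.mul_sum]
  simp [mul_pow]

lemma wt_sq_le_tsum_dyad {κ : ℝ} (h0 : 0 ≤ κ) (h1 : κ ≤ 1) (ρ : ℝ) (ξ : RR n) :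
    ENNReal.ofReal (wt ρ κ ξ ^ 2) ≤
      (1 + n) + ∑ i, ∑' j, ENNReal.ofReal (dyad κ j (ρ * ξ i)) := by
  rw [wt_sq_eq_sum]
  refine (ENNReal.ofReal_le_ofReal (rpow_one_add_sum_le h0 h1 _ _)).trans ?_
  rw [ENNReal.ofReal_add zero_le_one (Finset.sum_nonneg fun i _ => by positivity),
    ENNReal.ofReal_sum_of_nonneg (fun i _ => by positivity), ENNReal.ofReal_one, add_assoc]
  gcongr
  calc _ ≤ ∑ i : Fin n, (1 + ∑' j, ENNReal.ofReal (dyad κ j (ρ * ξ i))) :=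
        Finset.sum_le_sum fun i _ => rpow_sq_le_tsum_dyad h0 _
    _ = _ := by rw [Finset.sum_add_distrib]; simp

lemma exists_tsum_dyad_le_wt {κ : ℝ} (h0 : 0 < κ) (h1 : κ < 1) :
    ∃ C : ℝ, 0 ≤ C ∧ ∀ (ρ : ℝ) (ξ : RR n), ∑ i, ∑' j, ENNReal.ofReal (dyad κ j (ρ * ξ i)) ≤
      ENNReal.ofReal (C * wt ρ κ ξ ^ 2) := by
  obtain ⟨C, hC0, hC⟩ := tsum_dyad_le h0 h1
  refine ⟨n * C, by positivity, fun ρ ξ => ?_⟩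
  calc _ ≤ ∑ i : Fin n, ENNReal.ofReal (C * wt ρ κ ξ ^ 2) := by
        refine Finset.sum_le_sum fun i _ => (hC _).trans (ENNReal.ofReal_le_ofReal ?_)
        rw [wt_sq_eq_sum]
        gcongr
        exact Finset.single_le_sum (f := fun i => (ρ * ξ i) ^ 2) (fun i _ => sq_nonneg _)
          (Finset.mem_univ i)
    _ = _ := by
        rw [Finset.sum_const, Finset.card_univ, Fintype.card_fin, nsmul_eq_mul, mul_assoc (n : ℝ),
          ENNReal.ofReal_mul (Nat.cast_nonneg n), ENNReal.ofReal_natCast]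

lemma eLpNorm_two_sq (f : RR n → ℂ) : eLpNorm f 2 volume ^ 2 = ∫⁻ x, ‖f x‖ₑ ^ 2 := by
  have := eLpNorm_nnreal_pow_eq_lintegral (f := f) (μ := volume) (p := 2) (by norm_num)
  simpa using this

lemma eLpNorm_fiL {f : RR n → ℂ} (hf : MemLp f 2 (volume : Measure (RR n))) :
    eLpNorm (fiL f) 2 volume = eLpNorm f 2 volume := by
  have h : ‖(𝓕⁻ hf.toLp : Lp ℂ 2 (volume : Measure (RR n)))‖ = ‖hf.toLp‖ :=
    LinearIsometryEquiv.norm_map _ _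
  rw [Lp.norm_def, Lp.norm_def, ENNReal.toReal_eq_toReal_iff' (Lp.eLpNorm_ne_top _)
    (Lp.eLpNorm_ne_top _)] at h
  rw [fiL_of_memLp hf, h]
  exact eLpNorm_congr_ae hf.coeFn_toLp

lemma lintegral_fiL_sq {f : RR n → ℂ} (hf : MemLp f 2 (volume : Measure (RR n))) :
    ∫⁻ ξ, ‖fiL f ξ‖ₑ ^ 2 = ∫⁻ x, ‖f x‖ₑ ^ 2 := by
  rw [← eLpNorm_two_sq, ← eLpNorm_two_sq, eLpNorm_fiL hf]

lemma memLp_translate {f : RR n → ℂ} (hf : MemLp f 2 (volume : Measure (RR n))) (y : RR n) :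
    MemLp (fun x => f (x + y)) 2 (volume : Measure (RR n)) :=
  hf.comp_measurePreserving (measurePreserving_add_right volume y)

lemma fourier_compSubConst (ζ : 𝓢(RR n, ℂ)) (y ξ : RR n) :
    (𝓕 (ζ.compSubConstCLM ℂ y) : 𝓢(RR n, ℂ)) ξ =
      Complex.exp (Complex.I * ((-(2 * Real.pi * inner ℝ y ξ) : ℝ) : ℂ)) * (𝓕 ζ : 𝓢(RR n, ℂ)) ξ := by
  have h := congrFun (VectorFourier.fourierIntegral_comp_add_right Real.fourierChar volume
    (innerₗ (RR n)) (ζ : RR n → ℂ) (-y)) ξ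
  have h2 : ((ζ : RR n → ℂ) ∘ fun v => v + -y) = (ζ.compSubConstCLM ℂ y : 𝓢(RR n, ℂ)) := by
    ext x; simp [sub_eq_add_neg]
  rw [h2] at h
  refine Eq.trans h ?_
  rw [Circle.smul_def, Real.fourierChar_apply, smul_eq_mul]
  congr 2
  simp
  ring

lemma fiL_translate {f : RR n → ℂ} (hf : MemLp f 2 (volume : Measure (RR n))) (y : RR n) :
    fiL (fun x => f (x + y)) =ᵐ[volume] fun ξ =>
      Complex.exp (Complex.I * ((-(2 * Real.pi * inner ℝ y ξ) : ℝ) : ℂ)) * fiL f ξ := by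
  have hc : Continuous fun ξ : RR n =>
      Complex.exp (Complex.I * ((-(2 * Real.pi * inner ℝ y ξ) : ℝ) : ℂ)) := by fun_prop
  have m1 := memLp_fiL (memLp_translate hf y)
  have m2 : MemLp (fun ξ => Complex.exp (Complex.I * ((-(2 * Real.pi * inner ℝ y ξ) : ℝ) : ℂ)) *
      fiL f ξ) 2 (volume : Measure (RR n)) := by
    refine (memLp_fiL hf).of_le (hc.aestronglyMeasurable.mul (memLp_fiL hf).1)
      (Eventually.of_forall fun ξ => ?_)
    rw [norm_mul, mul_comm Complex.I, Complex.norm_exp_ofReal_mul_I, one_mul]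
  have h := memLp_ext (m1.sub m2) (fun η => by
    obtain ⟨ζ, rfl⟩ : ∃ ζ : 𝓢(RR n, ℂ), 𝓕 ζ = η := ⟨𝓕⁻ η, FourierTransform.fourier_fourierInv_eq η⟩
    have i1 := integrable_mul_of_memLp m1 ((𝓕 ζ).memLp 2)
    have i2 := integrable_mul_of_memLp m2 ((𝓕 ζ).memLp 2)
    simp only [Pi.sub_apply, sub_mul]
    rw [integral_sub i1 i2, ← integral_mul_eq_fiL (memLp_translate hf y), sub_eq_zero]
    have e : ∀ ξ, Complex.exp (Complex.I * ((-(2 * Real.pi * inner ℝ y ξ) : ℝ) : ℂ)) * fiL f ξ *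
        (𝓕 ζ : 𝓢(RR n, ℂ)) ξ = fiL f ξ * (𝓕 (ζ.compSubConstCLM ℂ y) : 𝓢(RR n, ℂ)) ξ := fun ξ => by
      rw [fourier_compSubConst]; ring
    simp only [e]
    rw [← integral_mul_eq_fiL hf,
      ← integral_add_right_eq_self (fun x => f x * (ζ.compSubConstCLM ℂ y) x) y]
    simp)
  filter_upwards [h] with ξ hξ
  simpa [sub_eq_zero] using hξ

/-- Plancherel: translation by y becomes a phase, and |e^{ia} - 1|² = 4 sin²(a/2). -/
lemma lintegral_translate_sub {f : RR n → ℂ} (hf : MemLp f 2 (volume : Measure (RR n))) (y : RR n) :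
    ∫⁻ x, ‖f (x + y) - f x‖ₑ ^ 2 =
      ∫⁻ ξ, ENNReal.ofReal (4 * Real.sin (Real.pi * inner ℝ y ξ) ^ 2) * ‖fiL f ξ‖ₑ ^ 2 := by
  have hm := memLp_translate hf y
  refine (lintegral_fiL_sq (hm.sub hf)).symm.trans (lintegral_congr_ae ?_)
  have e : fiL ((fun x => f (x + y)) - f) = fiL (fun x => f (x + y) - f x) := rfl
  rw [e]
  filter_upwards [fiL_sub hm hf, fiL_translate hf y] with ξ h1 h2
  rw [h1, h2, ← sub_one_mul, enorm_mul, mul_pow]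
  congr 1
  rw [← ofReal_norm, Complex.norm_exp_I_mul_ofReal_sub_one, ← ENNReal.ofReal_pow (norm_nonneg _),
    Real.norm_eq_abs, sq_abs]
  congr 1
  rw [neg_div, Real.sin_neg, show 2 * Real.pi * inner ℝ y ξ / 2 = Real.pi * inner ℝ y ξ by ring]
  ring

/-- The `j`-th dyadic difference step in the `i`-th coordinate direction. -/
def step (ρ : ℝ) (j : ℕ) (i : Fin n) : RR n := (ρ / 2 ^ j) • dir i

lemma norm_step {ρ : ℝ} (hρ : 0 ≤ ρ) (j : ℕ) (i : Fin n) : ‖(step ρ j i : RR n)‖ = ρ / 2 ^ j := by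
  rw [step, norm_smul, Real.norm_eq_abs, abs_of_nonneg (by positivity)]
  simp

/-- Weighted sums of differences with steps ρ 2^{-j} along the axes turn into the frequency weights
`dyad`. Since those are comparable to the Sobolev weight, the norm of fractional order can be
estimated in physical space, where Hölder continuity is visible. -/
lemma tsum_translate_sub {f : RR n → ℂ} (hf : MemLp f 2 (volume : Measure (RR n))) (κ ρ : ℝ) :
    ∑ i : Fin n, ∑' j : ℕ, ENNReal.ofReal ((4 : ℝ) ^ ((j : ℝ) * κ)) *
        ∫⁻ x, ‖f (x + step ρ j i) - f x‖ₑ ^ 2 =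
      ∫⁻ ξ, (∑ i, ∑' j, ENNReal.ofReal (dyad κ j (ρ * ξ i))) * ‖fiL f ξ‖ₑ ^ 2 := by
  have hmeas : AEMeasurable (fun ξ => ‖fiL f ξ‖ₑ ^ 2) volume := (memLp_fiL hf).1.enorm.pow_const 2
  have hd : ∀ (i : Fin n) (j : ℕ), Measurable fun ξ : RR n => ENNReal.ofReal (dyad κ j (ρ * ξ i)) :=
    fun i j => ENNReal.measurable_ofReal.comp
      ((continuous_dyad κ j).comp (by fun_prop : Continuous fun ξ : RR n => ρ * ξ i)).measurable
  have hdm : ∀ (i : Fin n) (j : ℕ), AEMeasurable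
      (fun ξ : RR n => ENNReal.ofReal (dyad κ j (ρ * ξ i)) * ‖fiL f ξ‖ₑ ^ 2) volume :=
    fun i j => (hd i j).aemeasurable.mul hmeas
  simp only [Finset.sum_mul, ← ENNReal.tsum_mul_right]
  rw [lintegral_finsetSum' _ (fun i _ => AEMeasurable.tsum fun j => hdm i j)]
  refine Finset.sum_congr rfl fun i _ => ?_
  rw [lintegral_tsum (hdm i)]
  refine tsum_congr fun j => ?_
  rw [lintegral_translate_sub hf, ← lintegral_const_mul']
  · refine lintegral_congr fun ξ => ?_
    rw [← mul_assoc, ← ENNReal.ofReal_mul (by positivity)]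
    congr 2
    rw [dyad, step, inner_smul_left]
    simp only [EuclideanSpace.inner_single_left]
    simp
    left
    congr 3
    ring
  · exact ENNReal.ofReal_ne_top

lemma isMul_zero_of_bound {a : RR n → ℂ} {S ρ : ℝ} (hS0 : 0 ≤ S) (hS : ∀ᵐ x, ‖a x‖ ≤ S) :
    IsMul a 0 ρ S := by
  intro φ ψ
  have hsn : ∀ ψ : 𝓢(RR n, ℂ), sn ρ 0 ψ = (eLpNorm ψ 2 volume).toReal := fun ψ => by
    rw [sn_eq]
    simp only [wt_zero, Complex.ofReal_one, one_mul]
    have := eLpNorm_fiL (ψ.memLp 2 volume)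
    rw [← this, eLpNorm_congr_ae (fiL_schwartz ψ)]
  have hnn : ∀ ψ : 𝓢(RR n, ℂ), eLpNorm (fun x => (‖ψ x‖ : ℂ)) 2 volume = eLpNorm ψ 2 volume :=
    fun ψ => eLpNorm_congr_norm_ae (Eventually.of_forall fun x => by simp)
  have hmm : ∀ ψ : 𝓢(RR n, ℂ), MemLp (fun x => (‖ψ x‖ : ℂ)) 2 volume := fun ψ =>
    (ψ.memLp 2).norm.ofReal
  have hI : Integrable fun x => ‖φ x‖ * ‖ψ x‖ := (φ.memLp 2).norm.integrable_mul (ψ.memLp 2).norm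
  rw [neg_zero, hsn, hsn]
  calc _ ≤ ∫ x, S * (‖φ x‖ * ‖ψ x‖) := by
        refine norm_integral_le_of_norm_le (hI.const_mul S) ?_
        filter_upwards [hS] with x hx
        rw [norm_mul, norm_mul]
        gcongr
    _ = S * ∫ x, ‖φ x‖ * ‖ψ x‖ := integral_const_mul _ _
    _ ≤ S * ((eLpNorm φ 2 volume).toReal * (eLpNorm ψ 2 volume).toReal) := by
        refine mul_le_mul_of_nonneg_left ?_ hS0
        have := norm_integral_mul_le (hmm φ) (hmm ψ)
        rw [hnn, hnn] at this
        refine le_trans (le_abs_self _) (le_trans (le_of_eq ?_) this)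
        rw [← Real.norm_eq_abs, ← Complex.norm_real, ← integral_complex_ofReal]
        simp
    _ = _ := by ring

lemma lintegral_wt_sq (ρ κ : ℝ) (F : RR n → ℂ) :
    eLpNorm (fun ξ => (wt ρ κ ξ : ℂ) * F ξ) 2 volume ^ 2 =
      ∫⁻ ξ, ENNReal.ofReal (wt ρ κ ξ ^ 2) * ‖F ξ‖ₑ ^ 2 := by
  rw [eLpNorm_two_sq]
  refine lintegral_congr fun ξ => ?_
  rw [enorm_mul, mul_pow, ← ofReal_norm (wt ρ κ ξ : ℂ), Complex.norm_real,
    Real.norm_eq_abs, abs_of_pos (wt_pos _ _ _), ENNReal.ofReal_pow (wt_pos _ _ _).le]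

lemma enorm_add_sq_le (a b : ℂ) : ‖a + b‖ₑ ^ 2 ≤ 2 * ‖a‖ₑ ^ 2 + 2 * ‖b‖ₑ ^ 2 := by
  have : ‖a + b‖ ^ 2 ≤ 2 * ‖a‖ ^ 2 + 2 * ‖b‖ ^ 2 := by
    have := norm_add_le a b
    nlinarith [norm_nonneg (a + b), sq_nonneg (‖a‖ - ‖b‖)]
  have := ENNReal.ofReal_le_ofReal this
  rw [ENNReal.ofReal_add (by positivity) (by positivity), ENNReal.ofReal_mul (by norm_num),
    ENNReal.ofReal_mul (by norm_num)] at this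
  simpa [ENNReal.ofReal_pow, ofReal_norm] using this

/-- Multiplication by a bounded Hölder continuous function in the norm of fractional order. -/
theorem exists_isMul_of_holder {κ ν : ℝ} (h0 : 0 < κ) (h1 : κ < ν) (hν : ν ≤ 1) :
    ∃ C : ℝ, 0 ≤ C ∧ ∀ (G : RR n → ℂ) (S H ρ : ℝ), MemLp G ∞ (volume : Measure (RR n)) →
      0 ≤ S → 0 ≤ H → 0 < ρ → (∀ᵐ x, ‖G x‖ ≤ S) →
      (∀ y, ∀ᵐ x, ‖G (x + y) - G x‖ ≤ H * ‖y‖ ^ ν) → IsMul G κ ρ (C * (S + H * ρ ^ ν)) := by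
  have hκ1 : κ < 1 := h1.trans_le hν
  obtain ⟨C₁, hC₁, hu⟩ := exists_tsum_dyad_le_wt (n := n) h0 hκ1
  set q : ℝ := (4 : ℝ) ^ (κ - ν) with hq
  have hq0 : 0 < q := by positivity
  have hq1 : q < 1 := Real.rpow_lt_one_of_one_lt_of_neg (by norm_num) (by linarith)
  set C₂ : ℝ := (1 - q)⁻¹ with hC₂
  have hC₂0 : 0 ≤ C₂ := (inv_pos.2 (by linarith)).le
  have hs : ∑' j : ℕ, (ENNReal.ofReal q) ^ j = ENNReal.ofReal C₂ := by
    rw [ENNReal.tsum_geometric, hC₂, ENNReal.ofReal_inv_of_pos (by linarith),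
      ENNReal.ofReal_sub _ hq0.le, ENNReal.ofReal_one]
  refine ⟨1 + n + 2 * C₁ + 2 * n * C₂, by positivity, fun G S H ρ hG hS0 hH0 hρ hS hH => ?_⟩
  intro φ ψ
  set C := 1 + (n : ℝ) + 2 * C₁ + 2 * n * C₂ with hC
  have hC1 : 1 ≤ C := by
    have : 0 ≤ (n : ℝ) + 2 * C₁ + 2 * n * C₂ := by positivity
    linarith
  set f : RR n → ℂ := fun x => G x * φ x with hf
  have hfL : MemLp f 2 (volume : Measure (RR n)) := memLp_mul_schwartz hG (φ.memLp 2)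
  set E := ∫⁻ x, ‖φ x‖ₑ ^ 2 with hE
  set X := ∫⁻ ξ, ENNReal.ofReal (wt ρ κ ξ ^ 2) * ‖fiL φ ξ‖ₑ ^ 2 with hX
  have hEX : E ≤ X := by
    rw [hE, ← lintegral_fiL_sq (φ.memLp 2)]
    refine lintegral_mono fun ξ => ?_
    rw [← one_mul (‖fiL φ ξ‖ₑ ^ 2)]
    simp only [one_mul]
    refine le_mul_of_one_le_left (zero_le) ?_
    rw [ENNReal.one_le_ofReal]
    exact one_le_pow₀ (by simpa using wt_mono ρ h0.le ξ)
  have hfE : ∫⁻ x, ‖f x‖ₑ ^ 2 ≤ ENNReal.ofReal (S ^ 2) * E := by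
    rw [hE, ← lintegral_const_mul' _ _ ENNReal.ofReal_ne_top]
    refine lintegral_mono_ae ?_
    filter_upwards [hS] with x hx
    rw [hf, enorm_mul, mul_pow, ENNReal.ofReal_pow hS0, ← ofReal_norm (G x)]
    gcongr
  -- The product rule for differences: one term keeps the difference of φ and costs sup|G|, the
  -- other keeps φ and costs the Hölder bound of G.
  have hD : ∀ y, ∫⁻ x, ‖f (x + y) - f x‖ₑ ^ 2 ≤
      ENNReal.ofReal (2 * S ^ 2) * (∫⁻ x, ‖φ (x + y) - φ x‖ₑ ^ 2) +
        ENNReal.ofReal (2 * (H * ‖y‖ ^ ν) ^ 2) * E := by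
    intro y
    have hm : AEMeasurable (fun x => ENNReal.ofReal (2 * S ^ 2) * ‖φ (x + y) - φ x‖ₑ ^ 2) volume := by
      have : Continuous fun x => φ (x + y) - φ x :=
        (φ.continuous.comp (continuous_id.add continuous_const)).sub φ.continuous
      exact (this.measurable.enorm.pow_const 2).aemeasurable.const_mul _
    rw [hE, ← lintegral_const_mul' _ _ ENNReal.ofReal_ne_top,
      ← lintegral_const_mul' _ _ ENNReal.ofReal_ne_top, ← lintegral_add_left' hm]
    refine lintegral_mono_ae ?_
    have hS' : ∀ᵐ x, ‖G (x + y)‖ ≤ S :=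
      (measurePreserving_add_right volume y).quasiMeasurePreserving.ae hS
    filter_upwards [hS', hH y] with x h1 h2
    have e : f (x + y) - f x = G (x + y) * (φ (x + y) - φ x) + (G (x + y) - G x) * φ x := by
      simp only [hf]; ring
    rw [e]
    refine (enorm_add_sq_le _ _).trans ?_
    rw [ENNReal.ofReal_mul zero_le_two, ENNReal.ofReal_mul zero_le_two, ENNReal.ofReal_pow hS0,
      ENNReal.ofReal_pow (by positivity), enorm_mul, enorm_mul, mul_pow, mul_pow, mul_assoc, mul_assoc,
      ← ofReal_norm (G (x + y)), ← ofReal_norm (G (x + y) - G x)]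
    simp only [ENNReal.ofReal_ofNat]
    gcongr
  -- The Hölder contributions sum to a geometric series of ratio 4^{κ-ν}, which is where κ < ν
  -- enters. The step length ρ/2^j yields the factor ρ^ν that later tends to zero.
  have hgeo : ∀ i : Fin n, ∑' j : ℕ, ENNReal.ofReal ((4 : ℝ) ^ ((j : ℝ) * κ)) *
      (ENNReal.ofReal (2 * (H * ‖(step ρ j i : RR n)‖ ^ ν) ^ 2) * E) =
      ENNReal.ofReal (2 * C₂ * (H * ρ ^ ν) ^ 2) * E := by
    intro i
    have : ∀ j : ℕ, ENNReal.ofReal ((4 : ℝ) ^ ((j : ℝ) * κ)) *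
        (ENNReal.ofReal (2 * (H * ‖(step ρ j i : RR n)‖ ^ ν) ^ 2) * E) =
        ENNReal.ofReal q ^ j * (ENNReal.ofReal (2 * (H * ρ ^ ν) ^ 2) * E) := by
      intro j
      rw [← mul_assoc, ← mul_assoc, ← ENNReal.ofReal_pow hq0.le, ← ENNReal.ofReal_mul (by positivity),
        ← ENNReal.ofReal_mul (by positivity)]
      congr 2
      rw [norm_step hρ.le, Real.div_rpow hρ.le (by positivity), hq, ← Real.rpow_natCast (_ ^ _),
        ← Real.rpow_mul (by norm_num)]
      have e1 : ((2 : ℝ) ^ j) ^ ν ≠ 0 := by positivity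
      have e2 : (4 : ℝ) ^ ((j : ℝ) * κ) = (4 : ℝ) ^ ((κ - ν) * j) * (((2 : ℝ) ^ j) ^ ν) ^ 2 := by
        have : (((2 : ℝ) ^ j) ^ ν) ^ 2 = (4 : ℝ) ^ ((j : ℝ) * ν) := by
          rw [← Real.rpow_natCast (_ ^ ν), ← Real.rpow_mul (by positivity), mul_comm ν,
            Real.rpow_mul (by positivity), Real.rpow_natCast, ← pow_mul, mul_comm j, pow_mul,
            Real.rpow_mul (by norm_num), Real.rpow_natCast]
          norm_num
        rw [this, ← Real.rpow_add (by norm_num)]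
        congr 1; ring
      rw [e2]
      field_simp
    simp only [this]
    rw [ENNReal.tsum_mul_right, hs, ← mul_assoc, ← ENNReal.ofReal_mul hC₂0]
    congr 2; ring
  have hN : ∑ i : Fin n, ∑' j : ℕ, ENNReal.ofReal ((4 : ℝ) ^ ((j : ℝ) * κ)) *
      (∫⁻ x, ‖φ (x + step ρ j i) - φ x‖ₑ ^ 2) ≤ ENNReal.ofReal C₁ * X := by
    rw [tsum_translate_sub (φ.memLp 2), hX, ← lintegral_const_mul' _ _ ENNReal.ofReal_ne_top]
    refine lintegral_mono fun ξ => ?_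
    rw [← mul_assoc, ← ENNReal.ofReal_mul hC₁]
    gcongr
    exact hu ρ ξ
  have hmain : ∫⁻ ξ, ENNReal.ofReal (wt ρ κ ξ ^ 2) * ‖fiL f ξ‖ₑ ^ 2 ≤
      ENNReal.ofReal ((C * (S + H * ρ ^ ν)) ^ 2) * X := by
    calc _ ≤ ∫⁻ ξ, ((1 + n) * ‖fiL f ξ‖ₑ ^ 2 +
          (∑ i, ∑' j, ENNReal.ofReal (dyad κ j (ρ * ξ i))) * ‖fiL f ξ‖ₑ ^ 2) := by
          refine lintegral_mono fun ξ => ?_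
          rw [← add_mul]
          gcongr
          exact wt_sq_le_tsum_dyad h0.le hκ1.le ρ ξ
      _ = (1 + n) * (∫⁻ x, ‖f x‖ₑ ^ 2) + ∑ i : Fin n, ∑' j : ℕ,
          ENNReal.ofReal ((4 : ℝ) ^ ((j : ℝ) * κ)) * ∫⁻ x, ‖f (x + step ρ j i) - f x‖ₑ ^ 2 := by
          have hm := ((memLp_fiL hfL).1.enorm.pow_const 2).const_mul (1 + (n : ℝ≥0∞))
          rw [lintegral_add_left' hm, lintegral_const_mul' _ _ (by simp), lintegral_fiL_sq hfL,
            tsum_translate_sub hfL]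
      _ ≤ (1 + n) * (ENNReal.ofReal (S ^ 2) * E) + ∑ i : Fin n, ∑' j : ℕ,
          ENNReal.ofReal ((4 : ℝ) ^ ((j : ℝ) * κ)) * (ENNReal.ofReal (2 * S ^ 2) *
            (∫⁻ x, ‖φ (x + step ρ j i) - φ x‖ₑ ^ 2) +
            ENNReal.ofReal (2 * (H * ‖(step ρ j i : RR n)‖ ^ ν) ^ 2) * E) := by
          gcongr with i _ j
          exact hD _
      _ = (1 + n) * (ENNReal.ofReal (S ^ 2) * E) + (ENNReal.ofReal (2 * S ^ 2) *
          (∑ i : Fin n, ∑' j : ℕ, ENNReal.ofReal ((4 : ℝ) ^ ((j : ℝ) * κ)) *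
            (∫⁻ x, ‖φ (x + step ρ j i) - φ x‖ₑ ^ 2)) +
            n * (ENNReal.ofReal (2 * C₂ * (H * ρ ^ ν) ^ 2) * E)) := by
          congr 1
          simp only [mul_add, ENNReal.tsum_add, hgeo, Finset.sum_add_distrib]
          congr 1
          · rw [Finset.mul_sum]
            refine Finset.sum_congr rfl fun i _ => ?_
            rw [← ENNReal.tsum_mul_left]
            refine tsum_congr fun j => ?_
            ring
          · simp
      _ ≤ (1 + n) * (ENNReal.ofReal (S ^ 2) * X) + (ENNReal.ofReal (2 * S ^ 2) *
          (ENNReal.ofReal C₁ * X) + n * (ENNReal.ofReal (2 * C₂ * (H * ρ ^ ν) ^ 2) * X)) := by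
          gcongr
      _ = ENNReal.ofReal ((1 + n) * S ^ 2 + (2 * S ^ 2 * C₁ + n * (2 * C₂ * (H * ρ ^ ν) ^ 2))) * X := by
          rw [ENNReal.ofReal_add (by positivity) (by positivity),
            ENNReal.ofReal_add (by positivity) (by positivity),
            ENNReal.ofReal_mul (p := 1 + (n : ℝ)) (by positivity),
            ENNReal.ofReal_add zero_le_one (by positivity), ENNReal.ofReal_one, ENNReal.ofReal_natCast,
            ENNReal.ofReal_mul (p := 2 * S ^ 2) (by positivity),
            ENNReal.ofReal_mul (p := (n : ℝ)) (by positivity), ENNReal.ofReal_natCast]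
          ring
      _ ≤ _ := by
          gcongr
          set B := H * ρ ^ ν with hB
          have hB0 : 0 ≤ B := by positivity
          have a1 : (1 + (n : ℝ)) * S ^ 2 + (2 * S ^ 2 * C₁ + n * (2 * C₂ * B ^ 2)) ≤
              C * (S + B) ^ 2 := by
            have p1 : S ^ 2 ≤ (S + B) ^ 2 := by gcongr; linarith
            have p2 : B ^ 2 ≤ (S + B) ^ 2 := by gcongr; linarith
            have q1 := mul_le_mul_of_nonneg_left p1 (by positivity : 0 ≤ 1 + (n : ℝ) + 2 * C₁)
            have q2 := mul_le_mul_of_nonneg_left p2 (by positivity : 0 ≤ 2 * (n : ℝ) * C₂)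
            rw [hC]
            linarith
          refine a1.trans ?_
          rw [mul_pow]
          gcongr
          nlinarith
  have hXt : X < ⊤ := by
    rw [hX, ← lintegral_wt_sq]
    have := ((memW_iff hρ).1 ((memW_fourierInv κ φ).congr (fiL_schwartz φ).symm)).2
    exact ENNReal.pow_lt_top this
  have hK0 : 0 ≤ C * (S + H * ρ ^ ν) := by positivity
  have hfW : MemLp (fun ξ => (wt ρ κ ξ : ℂ) * fiL f ξ) 2 (volume : Measure (RR n)) := by
    refine ⟨(continuous_wtC _ _).aestronglyMeasurable.mul (memLp_fiL hfL).1, ?_⟩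
    have := hmain.trans_lt (ENNReal.mul_lt_top ENNReal.ofReal_lt_top hXt)
    rw [← lintegral_wt_sq] at this
    rwa [ENNReal.pow_lt_top_iff, or_iff_left (by norm_num)] at this
  have hnW : nW ρ κ (fiL f) ≤ C * (S + H * ρ ^ ν) * sn ρ κ φ := by
    have e1 : nW ρ κ (fiL f) ^ 2 ≤ (C * (S + H * ρ ^ ν) * sn ρ κ φ) ^ 2 := by
      rw [sn_eq_nW, ← nW_congr (fiL_schwartz φ), mul_pow, nW, nW, ← ENNReal.toReal_pow,
        ← ENNReal.toReal_pow, lintegral_wt_sq, lintegral_wt_sq]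
      have := ENNReal.toReal_mono (ENNReal.mul_lt_top ENNReal.ofReal_lt_top hXt).ne hmain
      rwa [ENNReal.toReal_mul, ENNReal.toReal_ofReal (by positivity)] at this
    exact le_of_sq_le_sq e1 (mul_nonneg hK0 (sn_nonneg _ _ _))
  have := norm_integral_mul_schwartz_le hρ hfL ((memW_iff hρ).2 hfW) ψ
  simp only [hf, mul_assoc] at this hnW ⊢
  refine this.trans ?_
  have := mul_le_mul_of_nonneg_right hnW (sn_nonneg ρ (-κ) ψ)
  linarith

/-! ### Raising the order of a multiplier by one -/

lemma sn_le_of_pointwise {ρ κ κ' c : ℝ} {φ ψ : 𝓢(RR n, ℂ)}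
    (h : ∀ ξ, ‖(wt ρ κ ξ : ℂ) * 𝓕⁻ φ ξ‖ ≤ c * ‖(wt ρ κ' ξ : ℂ) * 𝓕⁻ ψ ξ‖) :
    sn ρ κ φ ≤ c * sn ρ κ' ψ := by
  refine Lp.norm_le_mul_norm_of_ae_le_mul ?_
  filter_upwards [(fqL n ρ κ φ).coeFn_toLp 2, (fqL n ρ κ' ψ).coeFn_toLp 2] with ξ h1 h2
  rw [h1, h2, fqL_apply, fqL_apply]
  exact h ξ

lemma sn_mono (ρ : ℝ) {κ κ' : ℝ} (h : κ ≤ κ') (φ : 𝓢(RR n, ℂ)) : sn ρ κ φ ≤ sn ρ κ' φ := by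
  rw [← one_mul (sn ρ κ' φ)]
  refine sn_le_of_pointwise fun ξ => ?_
  simp only [norm_mul, Complex.norm_real, Real.norm_eq_abs, abs_of_pos (wt_pos _ _ _), one_mul]
  exact mul_le_mul_of_nonneg_right (wt_mono ρ h ξ) (norm_nonneg _)

lemma fourierInv_lineDeriv_apply (φ : 𝓢(RR n, ℂ)) (i : Fin n) (ξ : RR n) :
    (𝓕⁻ (∂_{dir i} φ) : 𝓢(RR n, ℂ)) ξ = -(dsym i ξ) * (𝓕⁻ φ : 𝓢(RR n, ℂ)) ξ := by
  have h : (fun ξ : RR n => inner ℝ ξ (dir i : RR n)).HasTemperateGrowth := by fun_prop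
  have e : inner ℝ ξ (dir i : RR n) = ξ i := by simp [EuclideanSpace.inner_single_right]
  rw [SchwartzMap.fourierInv_lineDerivOp_eq]
  simp only [smul_apply, SchwartzMap.smulLeftCLM_apply_apply h, e, dsym, smul_eq_mul,
    Complex.real_smul, neg_mul]
  ring

lemma abs_coord_le_wt (ρ : ℝ) (i : Fin n) (ξ : RR n) : ρ * |ξ i| ≤ wt ρ 1 ξ := by
  have h1 : |ξ i| ≤ ‖ξ‖ := by simpa using PiLp.norm_apply_le ξ i
  have h2 := wt_sq ρ 1 ξ
  rw [Real.rpow_one] at h2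
  refine le_of_sq_le_sq ?_ (wt_pos _ _ _).le
  rw [h2, mul_pow]
  have : |ξ i| ^ 2 ≤ ‖ξ‖ ^ 2 := pow_le_pow_left₀ (abs_nonneg _) h1 2
  nlinarith [mul_le_mul_of_nonneg_left this (sq_nonneg ρ)]

/-- The operator ρ∂ loses one order with a constant independent of the scale; a bare derivative
would cost 1/ρ. -/
lemma sn_lineDeriv_le {ρ : ℝ} (hρ : 0 < ρ) (κ : ℝ) (i : Fin n) (φ : 𝓢(RR n, ℂ)) :
    ρ * sn ρ κ (∂_{dir i} φ) ≤ 2 * Real.pi * sn ρ (κ + 1) φ := by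
  have : sn ρ κ (∂_{dir i} φ) ≤ (2 * Real.pi / ρ) * sn ρ (κ + 1) φ := by
    refine sn_le_of_pointwise fun ξ => ?_
    rw [fourierInv_lineDeriv_apply]
    simp only [norm_mul, norm_neg, Complex.norm_real, Real.norm_eq_abs, abs_of_pos (wt_pos _ _ _),
      norm_dsym]
    have h := abs_coord_le_wt ρ i ξ
    have h' : |ξ i| ≤ wt ρ 1 ξ / ρ := by rw [le_div_iff₀ hρ]; linarith
    rw [wt_add]
    have : 0 ≤ wt ρ κ ξ * ‖(𝓕⁻ φ : 𝓢(RR n, ℂ)) ξ‖ * (2 * Real.pi) := by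
      have := (wt_pos ρ κ ξ).le; positivity
    calc _ = wt ρ κ ξ * ‖(𝓕⁻ φ : 𝓢(RR n, ℂ)) ξ‖ * (2 * Real.pi) * |ξ i| := by ring
      _ ≤ wt ρ κ ξ * ‖(𝓕⁻ φ : 𝓢(RR n, ℂ)) ξ‖ * (2 * Real.pi) * (wt ρ 1 ξ / ρ) := by gcongr
      _ = _ := by ring
  calc _ ≤ ρ * ((2 * Real.pi / ρ) * sn ρ (κ + 1) φ) := by gcongr
    _ = _ := by field_simp

lemma lineDeriv_sm (φ χ : 𝓢(RR n, ℂ)) (v : RR n) :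
    ∂_{v} (sm φ χ) = sm (∂_{v} φ) χ + sm φ (∂_{v} χ) := by
  ext x
  have h : HasFDerivAt (fun x => φ x * χ x) _ x := (φ.hasFDerivAt x).mul (χ.hasFDerivAt x)
  have e : (sm φ χ : RR n → ℂ) = fun x => φ x * χ x := by ext; simp
  rw [SchwartzMap.lineDerivOp_apply_eq_fderiv, e, h.fderiv]
  simp [SchwartzMap.lineDerivOp_apply_eq_fderiv]
  ring

/-- Here χ = (1 - (ρ/2π)² Δ)⁻¹ ψ, whose symbol is exactly the weight of order -2 at scale ρ, so
passing from ψ to χ is isometric with a gain of two orders. -/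
lemma exists_resolvent (ρ : ℝ) (ψ : 𝓢(RR n, ℂ)) : ∃ χ : 𝓢(RR n, ℂ),
    (∀ κ, sn ρ κ χ = sn ρ (κ - 2) ψ) ∧
    ψ = χ - ((ρ / (2 * Real.pi) : ℝ) : ℂ) ^ 2 • ∑ i : Fin n, ∂_{dir i} (∂_{dir i} χ) := by
  set χ : 𝓢(RR n, ℂ) := 𝓕 (fqL n ρ (-2) ψ) with hχ
  have h1 : 𝓕⁻ χ = fqL n ρ (-2) ψ := FourierTransform.fourierInv_fourier_eq _
  refine ⟨χ, fun κ => ?_, ?_⟩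
  · have : fqL n ρ κ χ = fqL n ρ (κ - 2) ψ := by
      ext ξ
      rw [fqL_apply, h1, fqL_apply, fqL_apply, ← mul_assoc]
      rw [← Complex.ofReal_mul, ← wt_add, sub_eq_add_neg]
    rw [sn, sn, this]
  · have inj : Function.Injective (fun φ : 𝓢(RR n, ℂ) => (𝓕⁻ φ : 𝓢(RR n, ℂ))) := fun a b hab => by
      have := congrArg (fun φ : 𝓢(RR n, ℂ) => (𝓕 φ : 𝓢(RR n, ℂ))) hab
      simpa [FourierTransform.fourier_fourierInv_eq] using this
    refine inj ?_
    simp only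
    rw [sub_eq_add_neg, fourierInv_add, FourierTransform.fourierInv_neg, fourierInv_smul]
    have hs : (𝓕⁻ (∑ i : Fin n, ∂_{dir i} (∂_{dir i} χ)) : 𝓢(RR n, ℂ)) =
        ∑ i : Fin n, (𝓕⁻ (∂_{dir i} (∂_{dir i} χ)) : 𝓢(RR n, ℂ)) :=
      map_sum (fourierInvCLM ℂ 𝓢(RR n, ℂ)) _ _
    rw [hs]
    ext ξ
    have hn : ((‖ξ‖ ^ 2 : ℝ) : ℂ) = ∑ i, (ξ i : ℂ) ^ 2 := by
      rw [EuclideanSpace.norm_sq_eq]; simp only [Real.norm_eq_abs, sq_abs]; push_cast; rfl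
    have hw : ((wt ρ 2 ξ : ℝ) : ℂ) = 1 + (ρ : ℂ) ^ 2 * ∑ i, (ξ i : ℂ) ^ 2 := by
      rw [wt_two, ← hn]; push_cast; ring
    have hw2 : ((wt ρ 2 ξ : ℝ) : ℂ) * ((wt ρ (-2) ξ : ℝ) : ℂ) = 1 := by
      rw [← Complex.ofReal_mul, wt_mul_neg, Complex.ofReal_one]
    have hpi : (Real.pi : ℂ) ≠ 0 := by exact_mod_cast Real.pi_ne_zero
    have hterm : ∀ i : Fin n, (𝓕⁻ (∂_{dir i} (∂_{dir i} χ)) : 𝓢(RR n, ℂ)) ξ =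
        -(4 * (Real.pi : ℂ) ^ 2) * (ξ i : ℂ) ^ 2 * (𝓕⁻ χ : 𝓢(RR n, ℂ)) ξ := fun i => by
      rw [fourierInv_lineDeriv_apply, fourierInv_lineDeriv_apply, dsym]
      ring_nf
      rw [Complex.I_sq]
      ring
    simp only [add_apply, neg_apply, smul_apply, smul_eq_mul,
      sum_apply, hterm, ← Finset.sum_mul, ← Finset.mul_sum]
    rw [h1, fqL_apply]
    push_cast
    field_simp
    rw [hw] at hw2
    linear_combination (-4 * (𝓕⁻ ψ : 𝓢(RR n, ℂ)) ξ) * hw2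

/-- Write ψ = χ - c² Δχ with c = ρ/2π and integrate by parts once. The derivative falls on φ, which
the extra order pays for, or on a, which requires the weak derivatives to be multipliers of order κ.
The latter term retains a factor ρ, so bounds for derivatives do not matter at small scales. -/
theorem IsMul.succ {a : RR n → ℂ} {h : Fin n → RR n → ℂ} {κ ρ m₀ m₁ : ℝ} (hρ : 0 < ρ)
    (h0 : 0 ≤ m₀) (h1 : 0 ≤ m₁)
    (ha : MemLp a ∞ (volume : Measure (RR n))) (hh : ∀ i, MemLp (h i) ∞ (volume : Measure (RR n)))
    (H : ∀ i, HasWeakPartial i a (h i)) (hma : IsMul a κ ρ m₀) (hmh : ∀ i, IsMul (h i) κ ρ m₁) :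
    IsMul a (κ + 1) ρ ((1 + n) * m₀ + n * ρ * m₁) := by
  intro φ ψ
  obtain ⟨χ, hχ, hψ⟩ := exists_resolvent ρ ψ
  set c := ρ / (2 * Real.pi) with hc
  have hpi := Real.pi_gt_three
  have hc0 : 0 < c := by positivity
  have hcρ : c ≤ ρ := div_le_self hρ.le (by linarith)
  set Φ := sn ρ (κ + 1) φ with hΦ
  set Ψ := sn ρ (-(κ + 1)) ψ with hΨ
  have hΦ0 : 0 ≤ Φ := sn_nonneg _ _ _
  have hΨ0 : 0 ≤ Ψ := sn_nonneg _ _ _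
  have d1 : ∀ i : Fin n, c * sn ρ (-κ) (∂_{dir i} χ) ≤ Ψ := fun i => by
    have := sn_lineDeriv_le hρ (-κ) i χ
    rw [hχ, show -κ + 1 - 2 = -(κ + 1) by ring] at this
    rw [hc, div_mul_eq_mul_div, div_le_iff₀ (by positivity)]
    linarith
  have d2 : ∀ i : Fin n, c * sn ρ κ (∂_{dir i} φ) ≤ Φ := fun i => by
    have := sn_lineDeriv_le hρ κ i φ
    rw [hc, div_mul_eq_mul_div, div_le_iff₀ (by positivity)]
    linarith
  have d3 : sn ρ κ φ ≤ Φ := sn_mono ρ (by linarith) φ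
  have d4 : sn ρ (-κ) χ ≤ Ψ := by
    rw [hχ]; exact sn_mono ρ (by linarith) ψ
  have I : ∀ (g : RR n → ℂ), MemLp g ∞ (volume : Measure (RR n)) → ∀ ζ η : 𝓢(RR n, ℂ),
      Integrable fun x => g x * (ζ x * η x) := fun g hg ζ η => by
    have := integrable_top_mul hg (sm ζ η).integrable
    simpa using this
  have parts : ∀ i : Fin n, ∫ x, a x * (φ x * (∂_{dir i} (∂_{dir i} χ)) x) =
      -(∫ x, h i x * (φ x * (∂_{dir i} χ) x)) - ∫ x, a x * ((∂_{dir i} φ) x * (∂_{dir i} χ) x) := by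
    intro i
    have := (H i).schwartz ha (hh i) (sm φ (∂_{dir i} χ))
    rw [lineDeriv_sm] at this
    simp only [add_apply, sm_apply, mul_add] at this
    rw [integral_add (I a ha _ _) (I a ha _ _)] at this
    linear_combination this
  have expand : ∫ x, a x * (φ x * ψ x) = (∫ x, a x * (φ x * χ x)) -
      (c : ℂ) ^ 2 * ∑ i : Fin n, ∫ x, a x * (φ x * (∂_{dir i} (∂_{dir i} χ)) x) := by
    rw [← integral_finsetSum _ (fun i _ => I a ha _ _), ← integral_const_mul,
      ← integral_sub (I a ha _ _) ((integrable_finsetSum _ fun i _ => I a ha _ _).const_mul _)]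
    congr 1; ext x
    rw [hψ]
    simp only [sub_apply, smul_apply, sum_apply, smul_eq_mul,
      ← Finset.mul_sum]
    ring
  have b1 : ‖∫ x, a x * (φ x * χ x)‖ ≤ m₀ * Φ * Ψ := by
    refine (hma φ χ).trans ?_
    have := sn_nonneg ρ κ φ
    have := sn_nonneg ρ (-κ) χ
    gcongr
  have b2 : ∀ i : Fin n, ‖(c : ℂ) ^ 2 * ∫ x, a x * (φ x * (∂_{dir i} (∂_{dir i} χ)) x)‖ ≤
      (m₀ + ρ * m₁) * Φ * Ψ := by
    intro i
    have e1 := hmh i φ (∂_{dir i} χ)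
    have e2 := hma (∂_{dir i} φ) (∂_{dir i} χ)
    have n1 := sn_nonneg ρ κ φ
    have n2 := sn_nonneg ρ (-κ) (∂_{dir i} χ)
    have n3 := sn_nonneg ρ κ (∂_{dir i} φ)
    rw [parts, norm_mul, norm_pow, Complex.norm_real, Real.norm_eq_abs, abs_of_pos hc0]
    -- Only one factor c is absorbed by a derivative of χ here; the other survives and is bounded by
    -- ρ. In `e4` both factors are absorbed.
    have e3 : c ^ 2 * (m₁ * sn ρ κ φ * sn ρ (-κ) (∂_{dir i} χ)) ≤ ρ * m₁ * Φ * Ψ := by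
      calc _ = c * m₁ * sn ρ κ φ * (c * sn ρ (-κ) (∂_{dir i} χ)) := by ring
        _ ≤ ρ * m₁ * Φ * Ψ := by gcongr; exact d1 i
    have e4 : c ^ 2 * (m₀ * sn ρ κ (∂_{dir i} φ) * sn ρ (-κ) (∂_{dir i} χ)) ≤ m₀ * Φ * Ψ := by
      calc _ = m₀ * (c * sn ρ κ (∂_{dir i} φ)) * (c * sn ρ (-κ) (∂_{dir i} χ)) := by ring
        _ ≤ m₀ * Φ * Ψ := by gcongr; exacts [d2 i, d1 i]
    have e5 := norm_sub_le (-(∫ x, h i x * (φ x * (∂_{dir i} χ) x)))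
      (∫ x, a x * ((∂_{dir i} φ) x * (∂_{dir i} χ) x))
    rw [norm_neg] at e5
    have e6 := mul_le_mul_of_nonneg_left (e5.trans (add_le_add e1 e2)) (sq_nonneg c)
    linarith
  rw [expand, Finset.mul_sum]
  refine (norm_sub_le _ _).trans ((add_le_add b1 ((norm_sum_le _ _).trans
    (Finset.sum_le_sum fun i _ => b2 i))).trans (le_of_eq ?_))
  simp
  ring

/-! ### Closure properties of the classes `W^μ_∞` -/

lemma rpow_min_le {M L t θ : ℝ} (hM : 0 ≤ M) (hL : 0 ≤ L) (ht : 0 ≤ t) (h0 : 0 ≤ θ) (h1 : θ ≤ 1)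
    {d : ℝ} (d1 : d ≤ M) (d2 : d ≤ L * t) : d ≤ (M + L) * t ^ θ := by
  rcases le_total t 1 with h | h
  · have : t ≤ t ^ θ := by
      rcases ht.eq_or_lt with rfl | ht'
      · exact Real.rpow_nonneg le_rfl θ
      · simpa using Real.rpow_le_rpow_of_exponent_ge ht' h h1
    nlinarith [mul_le_mul_of_nonneg_left this hL, mul_nonneg hM (Real.rpow_nonneg ht θ)]
  · have : 1 ≤ t ^ θ := Real.one_le_rpow h h0
    nlinarith

lemma ae_prod_of_ae {p : RR n → Prop} (h : ∀ᵐ x, p x) :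
    ∀ᵐ z ∂((volume : Measure (RR n)).prod (volume : Measure (RR n))), p z.1 ∧ p z.2 :=
  (Measure.quasiMeasurePreserving_fst.ae h).and (Measure.quasiMeasurePreserving_snd.ae h)

lemma MemWkInfty.lipschitz {k : ℕ} {θ : ℝ} {g : RR n → ℂ} (hg : MemWkInfty (k + 1) θ g) :
    ∃ L : ℝ, 0 ≤ L ∧ ∃ p : RR n → Prop, (∀ᵐ x, p x) ∧
      ∀ x y, p x → p y → ‖g x - g y‖ ≤ L * ‖x - y‖ := by
  choose h h1 h2 using hg.2
  exact exists_lipschitz_of_hasWeakPartial hg.1 (fun i => (h2 i).memLp) h1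

/-- A bounded function with bounded weak gradient is Lipschitz off a null set, hence Hölder with
every exponent θ ∈ [0, 1]. -/
lemma MemWkInfty.down {k : ℕ} {θ θ' : ℝ} (h0 : 0 ≤ θ) (h1 : θ ≤ 1) {g : RR n → ℂ}
    (hg : MemWkInfty (k + 1) θ' g) : MemWkInfty k θ g := by
  induction k generalizing g with
  | zero =>
    refine ⟨hg.1, ?_⟩
    obtain ⟨L, hL, p, hp, hpL⟩ := hg.lipschitz
    obtain ⟨S, hS0, hS⟩ := exists_ae_bound hg.memLp
    refine ⟨2 * S + L, ?_⟩
    filter_upwards [ae_prod_of_ae hp, ae_prod_of_ae hS] with z hz hz'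
    refine rpow_min_le (by positivity) hL (norm_nonneg _) h0 h1 ?_ (hpL _ _ hz.1 hz.2)
    linarith [norm_sub_le (g z.1) (g z.2), hz'.1, hz'.2]
  | succ k ih =>
    refine ⟨hg.1, fun i => ?_⟩
    obtain ⟨h, hh, hk⟩ := hg.2 i
    exact ⟨h, hh, ih hk⟩

lemma integrable_mul_test {g : RR n → ℂ} (hg : MemLp g ∞ (volume : Measure (RR n)))
    (φ : 𝓓((⊤ : Opens (RR n)), ℝ)) : Integrable fun x => g x * ((φ x : ℝ) : ℂ) := by
  have := integrable_top_mul hg (testToSchwartz φ).integrable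
  exact this

lemma integrable_mul_lineDeriv_test {g : RR n → ℂ} (hg : MemLp g ∞ (volume : Measure (RR n)))
    (φ : 𝓓((⊤ : Opens (RR n)), ℝ)) (v : RR n) :
    Integrable fun x => g x * (((∂_{v} φ) x : ℝ) : ℂ) := integrable_mul_test hg (∂_{v} φ)

lemma HasWeakPartial.add {i : Fin n} {g g' h h' : RR n → ℂ}
    (mg : MemLp g ∞ (volume : Measure (RR n))) (mg' : MemLp g' ∞ (volume : Measure (RR n)))
    (mh : MemLp h ∞ (volume : Measure (RR n))) (mh' : MemLp h' ∞ (volume : Measure (RR n)))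
    (H : HasWeakPartial i g h) (H' : HasWeakPartial i g' h') :
    HasWeakPartial i (fun x => g x + g' x) (fun x => h x + h' x) := by
  intro φ
  simp only [add_mul]
  rw [integral_add (integrable_mul_lineDeriv_test mg φ _) (integrable_mul_lineDeriv_test mg' φ _),
    integral_add (integrable_mul_test mh φ) (integrable_mul_test mh' φ), H φ, H' φ]
  ring

lemma HasWeakPartial.star {i : Fin n} {g h : RR n → ℂ} (H : HasWeakPartial i g h) :
    HasWeakPartial i (fun x => star (g x)) (fun x => star (h x)) := by
  intro φ
  have := congrArg (starRingEnd ℂ) (H φ)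
  rw [map_neg, ← integral_conj, ← integral_conj] at this
  simpa using this

lemma testFunction_lineDeriv_schwartz {Ω : Opens (RR n)} (φ : 𝓓(Ω, ℝ)) (v x : RR n) :
    (∂_{v} (testToSchwartz φ)) x = (((∂_{v} φ) x : ℝ) : ℂ) := by
  rw [testFunction_lineDeriv_apply, SchwartzMap.lineDerivOp_apply_eq_fderiv]
  have h : HasFDerivAt (fun x => ((φ x : ℝ) : ℂ)) _ x :=
    Complex.ofRealCLM.hasFDerivAt.comp x
      ((φ.contDiff.differentiable (by simp)) x).hasFDerivAt
  have e : (testToSchwartz φ : RR n → ℂ) = fun x => ((φ x : ℝ) : ℂ) := rfl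
  rw [e, h.fderiv]
  simp

lemma HasWeakPartial.schwartz_mul {i : Fin n} {g h : RR n → ℂ}
    (mg : MemLp g ∞ (volume : Measure (RR n))) (mh : MemLp h ∞ (volume : Measure (RR n)))
    (H : HasWeakPartial i g h) (χ : 𝓢(RR n, ℂ)) :
    HasWeakPartial i (fun x => χ x * g x) (fun x => (∂_{dir i} χ) x * g x + χ x * h x) := by
  intro φ
  have := H.schwartz mg mh (sm χ (testToSchwartz φ))
  rw [lineDeriv_sm] at this
  have I : ∀ (g : RR n → ℂ), MemLp g ∞ (volume : Measure (RR n)) → ∀ ζ η : 𝓢(RR n, ℂ),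
      Integrable fun x => g x * (ζ x * η x) := fun g hg ζ η => by
    have := integrable_top_mul hg (sm ζ η).integrable
    simpa using this
  simp only [add_apply, sm_apply, mul_add] at this
  rw [integral_add (I g mg _ _) (I g mg _ _)] at this
  have e1 : ∀ x, χ x * g x * (((∂_{dir i} φ) x : ℝ) : ℂ) =
      g x * (χ x * (∂_{dir i} (testToSchwartz φ)) x) := fun x => by
    rw [testFunction_lineDeriv_schwartz]; ring
  have e2 : ∀ x, ((∂_{dir i} χ) x * g x + χ x * h x) * ((φ x : ℝ) : ℂ) =
      g x * ((∂_{dir i} χ) x * (testToSchwartz φ) x) + h x * (χ x * (testToSchwartz φ) x) :=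
    fun x => by
      have e : (testToSchwartz φ) x = ((φ x : ℝ) : ℂ) := rfl
      rw [e]; ring
  simp only [e1, e2]
  rw [integral_add (I g mg _ _) (I h mh _ _)]
  linear_combination this

lemma HasWeakPartial.const (i : Fin n) (c : ℂ) :
    HasWeakPartial i (fun _ : RR n => c) (fun _ => 0) := by
  intro φ
  have h := integral_mul_fderiv_eq_neg_fderiv_mul_of_integrable (μ := (volume : Measure (RR n)))
    (f := fun _ : RR n => c) (g := testToSchwartz φ) (v := dir i) (by simp)
    ((∂_{dir i} (testToSchwartz φ)).integrable.const_mul c)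
    ((testToSchwartz φ).integrable.const_mul c) (fun _ _ => differentiableAt_const c)
    (fun _ _ => (testToSchwartz φ).differentiableAt)
  simp only [← testFunction_lineDeriv_schwartz, SchwartzMap.lineDerivOp_apply_eq_fderiv]
  rw [h]
  simp

lemma MemWkInfty.add {k : ℕ} {θ : ℝ} {g g' : RR n → ℂ} (hg : MemWkInfty k θ g)
    (hg' : MemWkInfty k θ g') : MemWkInfty k θ (fun x => g x + g' x) := by
  induction k generalizing g g' with
  | zero =>
    obtain ⟨C, hC⟩ := hg.2
    obtain ⟨C', hC'⟩ := hg'.2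
    refine ⟨hg.1.add hg'.1, C + C', ?_⟩
    filter_upwards [hC, hC'] with z h h'
    rw [add_sub_add_comm, add_mul]
    exact (norm_add_le _ _).trans (add_le_add h h')
  | succ k ih =>
    refine ⟨hg.1.add hg'.1, fun i => ?_⟩
    obtain ⟨h, hh, hk⟩ := hg.2 i
    obtain ⟨h', hh', hk'⟩ := hg'.2 i
    exact ⟨_, hh.add hg.1 hg'.1 hk.memLp hk'.memLp hh', ih hk hk'⟩

lemma MemWkInfty.star {k : ℕ} {θ : ℝ} {g : RR n → ℂ} (hg : MemWkInfty k θ g) :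
    MemWkInfty k θ (fun x => star (g x)) := by
  induction k generalizing g with
  | zero =>
    obtain ⟨C, hC⟩ := hg.2
    refine ⟨hg.1.star, C, ?_⟩
    filter_upwards [hC] with z h
    rwa [← star_sub, norm_star]
  | succ k ih =>
    refine ⟨hg.1.star, fun i => ?_⟩
    obtain ⟨h, hh, hk⟩ := hg.2 i
    exact ⟨_, hh.star, ih hk⟩

lemma memWkInfty_const {k : ℕ} {θ : ℝ} (c : ℂ) : MemWkInfty k θ (fun _ : RR n => c) := by
  induction k generalizing c with
  | zero => exact ⟨memLp_top_const c, 0, Eventually.of_forall fun z => by simp⟩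
  | succ k ih => exact ⟨memLp_top_const c, fun i => ⟨_, HasWeakPartial.const i c, ih 0⟩⟩

lemma exists_schwartz_lipschitz (χ : 𝓢(RR n, ℂ)) : ∃ M L : ℝ, 0 ≤ M ∧ 0 ≤ L ∧
    (∀ x, ‖χ x‖ ≤ M) ∧ ∀ x y, ‖χ x - χ y‖ ≤ L * ‖x - y‖ := by
  refine ⟨SchwartzMap.seminorm ℝ 0 0 χ, SchwartzMap.seminorm ℝ 0 1 χ, by positivity, by positivity,
    fun x => SchwartzMap.norm_le_seminorm ℝ χ x, fun x y => ?_⟩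
  refine Convex.norm_image_sub_le_of_norm_fderiv_le (𝕜 := ℝ) (s := Set.univ)
    (fun z _ => χ.differentiableAt) (fun z _ => ?_) convex_univ trivial trivial
  have := SchwartzMap.le_seminorm ℝ 0 1 χ z
  simpa [norm_iteratedFDeriv_one] using this

/-- Induction by the product rule; the term in which χ is differentiated keeps g itself, which must
first be lowered by one order with `MemWkInfty.down`. -/
lemma MemWkInfty.schwartz_mul {k : ℕ} {θ : ℝ} (h0 : 0 ≤ θ) (h1 : θ ≤ 1) {g : RR n → ℂ}
    (hg : MemWkInfty k θ g) (χ : 𝓢(RR n, ℂ)) : MemWkInfty k θ (fun x => χ x * g x) := by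
  have hm : ∀ {k : ℕ} {g : RR n → ℂ} (χ : 𝓢(RR n, ℂ)), MemWkInfty k θ g →
      MemLp (fun x => χ x * g x) ∞ (volume : Measure (RR n)) :=
    fun χ hg => hg.memLp.mul χ.memLp_top
  induction k generalizing g χ with
  | zero =>
    refine ⟨hm χ hg, ?_⟩
    obtain ⟨M, L, hM, hL, hMb, hLb⟩ := exists_schwartz_lipschitz χ
    obtain ⟨S, hS0, hS⟩ := exists_ae_bound hg.memLp
    obtain ⟨C, hC⟩ := hg.2
    refine ⟨M * C + (2 * M + L) * S, ?_⟩
    filter_upwards [hC, ae_prod_of_ae hS] with z hz hz'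
    have e : χ z.1 * g z.1 - χ z.2 * g z.2 =
        χ z.1 * (g z.1 - g z.2) + (χ z.1 - χ z.2) * g z.2 := by ring
    have hd : ‖χ z.1 - χ z.2‖ ≤ (2 * M + L) * ‖z.1 - z.2‖ ^ θ :=
      rpow_min_le (by positivity) hL (norm_nonneg _) h0 h1
        (by linarith [norm_sub_le (χ z.1) (χ z.2), hMb z.1, hMb z.2]) (hLb _ _)
    rw [e]
    refine (norm_add_le _ _).trans ?_
    rw [norm_mul, norm_mul]
    have t1 := mul_le_mul (hMb z.1) hz (norm_nonneg _) hM
    have t2 := mul_le_mul hd hz'.2 (norm_nonneg _) (by positivity)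
    linarith
  | succ k ih =>
    refine ⟨hm χ hg, fun i => ?_⟩
    obtain ⟨h, hh, hk⟩ := hg.2 i
    exact ⟨_, hh.schwartz_mul hg.1 hk.memLp χ, (ih (hg.down h0 h1) _).add (ih hk χ)⟩

/-! ### Multiplication by functions of class `W^μ_∞` -/

lemma IsMul.mono {a : RR n → ℂ} {κ ρ m m' : ℝ} (h : IsMul a κ ρ m) (hm : m ≤ m') :
    IsMul a κ ρ m' := fun φ ψ => (h φ ψ).trans (by
  have := sn_nonneg ρ κ φ
  have := sn_nonneg ρ (-κ) ψ
  gcongr)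

/-- The Hölder bound holds for almost all pairs, but for fixed y the pairs (x + y, x) form a null
set. Both points are therefore compared with a third point z within |y| of x, good for both; the
constant is 3 because 1 + 2^θ ≤ 3. -/
lemma MemWkInfty.holder_translate {θ : ℝ} (h0 : 0 ≤ θ) (h1 : θ ≤ 1) {g : RR n → ℂ}
    (hg : MemWkInfty 0 θ g) :
    ∃ H : ℝ, 0 ≤ H ∧ ∀ y, ∀ᵐ x, ‖g (x + y) - g x‖ ≤ H * ‖y‖ ^ θ := by
  obtain ⟨C, hC⟩ := hg.2
  have hC' := Measure.ae_ae_of_ae_prod hC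
  refine ⟨3 * |C|, by positivity, fun y => ?_⟩
  rcases eq_or_ne y 0 with rfl | hy
  · refine Eventually.of_forall fun x => ?_
    simp only [add_zero, sub_self, norm_zero]
    positivity
  have hCy := (measurePreserving_add_right (volume : Measure (RR n)) y).quasiMeasurePreserving.ae hC'
  filter_upwards [hC', hCy] with x hx hxy
  have hd := (Measure.dense_of_ae (hx.and hxy)).inter_open_nonempty (Metric.ball x ‖y‖)
    Metric.isOpen_ball ⟨x, Metric.mem_ball_self (norm_pos_iff.2 hy)⟩
  obtain ⟨z, hz, hz1, hz2⟩ := hd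
  have hz' : ‖x - z‖ ≤ ‖y‖ := by
    rw [mem_ball_iff_norm'] at hz; exact hz.le
  have e : g (x + y) - g x = (g (x + y) - g z) - (g x - g z) := by ring
  have b1 : ‖x - z‖ ^ θ ≤ ‖y‖ ^ θ := Real.rpow_le_rpow (norm_nonneg _) hz' h0
  have b2 : ‖x + y - z‖ ^ θ ≤ 2 * ‖y‖ ^ θ := by
    have : ‖x + y - z‖ ≤ 2 * ‖y‖ := by
      have := norm_add_le (x - z) y
      rw [show x - z + y = x + y - z by abel] at this
      linarith
    calc ‖x + y - z‖ ^ θ ≤ (2 * ‖y‖) ^ θ := Real.rpow_le_rpow (norm_nonneg _) this h0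
      _ = 2 ^ θ * ‖y‖ ^ θ := Real.mul_rpow (by norm_num) (norm_nonneg _)
      _ ≤ 2 * ‖y‖ ^ θ := by
        gcongr
        calc (2 : ℝ) ^ θ ≤ 2 ^ (1 : ℝ) := Real.rpow_le_rpow_of_exponent_le (by norm_num) h1
          _ = 2 := by simp
  rw [e]
  have c1 : ‖g x - g z‖ ≤ |C| * ‖y‖ ^ θ :=
    hz1.trans (mul_le_mul (le_abs_self C) b1 (by positivity) (abs_nonneg C))
  have c2 : ‖g (x + y) - g z‖ ≤ |C| * (2 * ‖y‖ ^ θ) :=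
    hz2.trans (mul_le_mul (le_abs_self C) b2 (by positivity) (abs_nonneg C))
  linarith [norm_sub_le (g (x + y) - g z) (g x - g z)]

/-- The exponent is restricted to the two values θ and 1 so that the multiplier constant obtained
from it can be chosen independently of g and k. -/
lemma MemWkInfty.exists_holder_translate {k : ℕ} {θ κ : ℝ} (h0 : 0 ≤ θ) (h1 : θ ≤ 1)
    (hκ0 : 0 < κ) (hκ1 : κ < 1) (hκ : κ ≤ k ∨ κ < k + θ) {g : RR n → ℂ} (hg : MemWkInfty k θ g) :
    ∃ ν : ℝ, (ν = θ ∨ ν = 1) ∧ κ < ν ∧ ν ≤ 1 ∧ ∃ H : ℝ, 0 ≤ H ∧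
      ∀ y, ∀ᵐ x, ‖g (x + y) - g x‖ ≤ H * ‖y‖ ^ ν := by
  cases k with
  | zero =>
    have : κ < θ := by
      simp only [Nat.cast_zero, zero_add] at hκ
      exact hκ.resolve_left (not_le.2 hκ0)
    exact ⟨θ, Or.inl rfl, this, h1, hg.holder_translate h0 h1⟩
  | succ k =>
    obtain ⟨L, hL, p, hp, hpL⟩ := hg.lipschitz
    refine ⟨1, Or.inr rfl, hκ1, le_rfl, L, hL, fun y => ?_⟩
    have hpy := (measurePreserving_add_right (volume : Measure (RR n)) y).quasiMeasurePreserving.ae hp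
    filter_upwards [hp, hpy] with x hx hxy
    simpa using hpL _ _ hxy hx

lemma tendsto_mul_rpow_zero (H : ℝ) {ν : ℝ} (hν : 0 < ν) :
    Tendsto (fun ρ : ℝ => H * ρ ^ ν) (𝓝[>] 0) (𝓝 0) := by
  have h : Tendsto (fun ρ : ℝ => ρ ^ ν) (𝓝[>] 0) (𝓝 ((0 : ℝ) ^ ν)) :=
    (Real.continuousAt_rpow_const 0 ν (Or.inr hν.le)).tendsto.mono_left nhdsWithin_le_nhds
  rw [Real.zero_rpow hν.ne'] at h
  simpa using h.const_mul H

/-- Multiplication by functions of class `W^{k+θ}_∞`: at small scales, the norm of the operator of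
multiplication is controlled by the supremum of the function alone. -/
theorem exists_eventually_isMul {κ θ : ℝ} (hκ0 : 0 ≤ κ) (h0 : 0 ≤ θ) (h1 : θ ≤ 1) :
    ∃ C : ℝ, 0 ≤ C ∧ ∀ (k : ℕ) (g : RR n → ℂ) (S ε : ℝ), (κ ≤ k ∨ κ < k + θ) → MemWkInfty k θ g →
      0 ≤ S → (∀ᵐ x, ‖g x‖ ≤ S) → 0 < ε → ∀ᶠ ρ in 𝓝[>] (0 : ℝ), IsMul g κ ρ (C * S + ε) := by
  -- Induction on the integer part of κ: the base case is Hölder multiplication of order below 1,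
  -- and each step raises the order by `IsMul.succ`.
  obtain ⟨N, hN⟩ : ∃ N : ℕ, κ < N + 1 := ⟨⌊κ⌋₊, Nat.lt_floor_add_one κ⟩
  induction N generalizing κ with
  | zero =>
    rcases hκ0.eq_or_lt with rfl | hκ0'
    · refine ⟨1, zero_le_one, fun k g S ε _ _ hS0 hS hε => Eventually.of_forall fun ρ => ?_⟩
      exact (isMul_zero_of_bound hS0 hS).mono (by linarith)
    · have hκ1 : κ < 1 := by simpa using hN
      obtain ⟨C₁, hC₁, H₁⟩ : ∃ C : ℝ, 0 ≤ C ∧ ∀ (G : RR n → ℂ) (S H ρ : ℝ),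
          MemLp G ∞ (volume : Measure (RR n)) → 0 ≤ S → 0 ≤ H → 0 < ρ → (∀ᵐ x, ‖G x‖ ≤ S) →
          (∀ y, ∀ᵐ x, ‖G (x + y) - G x‖ ≤ H * ‖y‖ ^ (1 : ℝ)) →
          IsMul G κ ρ (C * (S + H * ρ ^ (1 : ℝ))) := exists_isMul_of_holder hκ0' hκ1 le_rfl
      obtain ⟨C₂, hC₂, H₂⟩ : ∃ C : ℝ, 0 ≤ C ∧ (κ < θ → ∀ (G : RR n → ℂ) (S H ρ : ℝ),
          MemLp G ∞ (volume : Measure (RR n)) → 0 ≤ S → 0 ≤ H → 0 < ρ → (∀ᵐ x, ‖G x‖ ≤ S) →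
          (∀ y, ∀ᵐ x, ‖G (x + y) - G x‖ ≤ H * ‖y‖ ^ θ) →
          IsMul G κ ρ (C * (S + H * ρ ^ θ))) := by
        by_cases h : κ < θ
        · obtain ⟨C, hC, hH⟩ := exists_isMul_of_holder (n := n) hκ0' h h1
          exact ⟨C, hC, fun _ => hH⟩
        · exact ⟨0, le_rfl, fun h' => absurd h' h⟩
      refine ⟨C₁ + C₂, by positivity, fun k g S ε hk hg hS0 hS hε => ?_⟩
      obtain ⟨ν, hν, hν1, hν2, H, hH0, hH⟩ := hg.exists_holder_translate h0 h1 hκ0' hκ1 hk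
      have hlim := (tendsto_mul_rpow_zero ((C₁ + C₂) * H) (hκ0'.trans hν1)).eventually_lt_const hε
      filter_upwards [hlim, self_mem_nhdsWithin] with ρ hρ hρ0
      have hρ0 : 0 < ρ := hρ0
      have hI : IsMul g κ ρ ((C₁ + C₂) * (S + H * ρ ^ ν)) := by
        rcases hν with rfl | rfl
        · refine (H₂ hν1 g S H ρ hg.memLp hS0 hH0 hρ0 hS hH).mono ?_
          gcongr; linarith
        · refine (H₁ g S H ρ hg.memLp hS0 hH0 hρ0 hS hH).mono ?_
          gcongr; linarith
      refine hI.mono ?_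
      linarith
  | succ N ih =>
    by_cases hκ1 : κ < 1
    · exact ih hκ0 (by push_cast at hN; linarith [Nat.cast_nonneg (α := ℝ) N])
    push Not at hκ1
    obtain ⟨C, hC, hI⟩ := ih (κ := κ - 1) (by linarith) (by push_cast at hN; linarith)
    refine ⟨(1 + n) * C, by positivity, fun k g S ε hk hg hS0 hS hε => ?_⟩
    obtain ⟨k, rfl⟩ : ∃ k', k = k' + 1 := by
      refine Nat.exists_eq_succ_of_ne_zero fun hk0 => ?_
      subst hk0
      simp only [Nat.cast_zero, zero_add] at hk
      rcases hk with hk | hk <;> linarith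
    have hk' : κ - 1 ≤ k ∨ κ - 1 < k + θ := by
      push_cast at hk
      rcases hk with hk | hk
      · left; linarith
      · right; linarith
    have hk2 : κ - 1 ≤ (k + 1 : ℕ) ∨ κ - 1 < (k + 1 : ℕ) + θ := by
      push_cast
      rcases hk' with hk | hk
      · left; linarith
      · right; linarith
    choose h hw hh using hg.2
    choose T hT0 hT using fun i => exists_ae_bound (hh i).memLp
    -- `IsMul.succ` multiplies this bound by 1 + n, so the error becomes ε/2. The other half absorbs
    -- the derivative term nρB, which vanishes with ρ however large B is.
    have e1 := hI (k + 1) g S (ε / (2 * (1 + n))) hk2 hg hS0 hS (by positivity)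
    have e2 : ∀ᶠ ρ in 𝓝[>] (0 : ℝ), ∀ i, IsMul (h i) (κ - 1) ρ (C * T i + 1) :=
      eventually_all.2 fun i => hI k (h i) (T i) 1 hk' (hh i) (hT0 i) (hT i) one_pos
    set B := ∑ i, (C * T i + 1) with hB
    have hterm : ∀ i, 0 ≤ C * T i + 1 := fun i => by have := hT0 i; positivity
    have hB0 : 0 ≤ B := Finset.sum_nonneg fun i _ => hterm i
    have hlim := (tendsto_mul_rpow_zero (n * B) one_pos).eventually_lt_const (half_pos hε)
    filter_upwards [e1, e2, hlim, self_mem_nhdsWithin] with ρ r1 r2 r3 hρ0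
    have hρ0 : 0 < ρ := hρ0
    have r4 : ∀ i, IsMul (h i) (κ - 1) ρ B := fun i => (r2 i).mono
      (Finset.single_le_sum (f := fun i => C * T i + 1) (fun i _ => hterm i) (Finset.mem_univ i))
    have := IsMul.succ hρ0 (by positivity) hB0 hg.1 (fun i => (hh i).memLp) hw r1 r4
    rw [sub_add_cancel] at this
    refine this.mono ?_
    rw [Real.rpow_one] at r3
    have : (1 + (n : ℝ)) * (ε / (2 * (1 + n))) = ε / 2 := by field_simp
    linarith

/-! ### Multipliers of all orders up to a given one -/

lemma wt_neg (ρ κ : ℝ) (ξ : RR n) : wt ρ (-κ) ξ = (wt ρ κ ξ)⁻¹ :=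
  eq_inv_of_mul_eq_one_left (wt_neg_mul ρ κ ξ)

lemma exists_sn_le (ρ ρ' κ : ℝ) (hρ : 0 < ρ) (hρ' : 0 < ρ') :
    ∃ C : ℝ, 0 ≤ C ∧ ∀ ψ : 𝓢(RR n, ℂ), sn ρ κ ψ ≤ C * sn ρ' κ ψ := by
  obtain ⟨C, hC0, hC⟩ := exists_wt_le (n := n) ρ ρ' κ hρ hρ'
  refine ⟨C, hC0.le, fun ψ => Lp.norm_le_mul_norm_of_ae_le_mul ?_⟩
  filter_upwards [(fqL n ρ κ ψ).coeFn_toLp 2, (fqL n ρ' κ ψ).coeFn_toLp 2] with ξ h1 h2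
  rw [h1, h2, fqL_apply, fqL_apply]
  simp only [norm_mul, Complex.norm_real, Real.norm_eq_abs, abs_of_pos (wt_pos _ _ _)]
  rw [← mul_assoc]
  exact mul_le_mul_of_nonneg_right (hC ξ) (norm_nonneg _)

lemma IsMul.rescale {g : RR n → ℂ} {κ ρ ρ' m : ℝ} (hρ : 0 < ρ) (hρ' : 0 < ρ')
    (h : IsMul g κ ρ m) : ∃ m' : ℝ, 0 ≤ m' ∧ IsMul g κ ρ' m' := by
  obtain ⟨C, hC0, hC⟩ := exists_sn_le (n := n) ρ ρ' κ hρ hρ'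
  obtain ⟨D, hD0, hD⟩ := exists_sn_le (n := n) ρ ρ' (-κ) hρ hρ'
  refine ⟨|m| * C * D, by positivity, fun φ ψ => (h.mono (le_abs_self m) φ ψ).trans ?_⟩
  have := sn_nonneg ρ κ φ
  have := sn_nonneg ρ (-κ) ψ
  have := sn_nonneg ρ' κ φ
  have := sn_nonneg ρ' (-κ) ψ
  calc _ ≤ |m| * (C * sn ρ' κ φ) * (D * sn ρ' (-κ) ψ) := by gcongr; exacts [hC φ, hD ψ]
    _ = _ := by ring

/-- `g` is bounded, and multiplication by `g` is bounded in the norms of all orders in `[-γ, γ]`. -/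
def MulUpTo (γ : ℝ) (g : RR n → ℂ) : Prop :=
  MemLp g ∞ (volume : Measure (RR n)) ∧ ∀ κ, |κ| ≤ γ → ∃ m : ℝ, 0 ≤ m ∧ IsMul g κ 1 m

/-- Boundedness at a single small scale is enough, since scales are comparable; negative orders come
from duality. The alternative in the hypothesis reflects that an integer order γ = k needs only k
bounded derivatives, while a fractional one needs a strictly better Hölder exponent. -/
theorem MemWkInfty.mulUpTo {k : ℕ} {θ γ : ℝ} (h0 : 0 ≤ θ) (h1 : θ ≤ 1) (hγ : γ ≤ k ∨ γ < k + θ)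
    {g : RR n → ℂ} (hg : MemWkInfty k θ g) : MulUpTo γ g := by
  have pos : ∀ κ, 0 ≤ κ → κ ≤ γ → ∃ m : ℝ, 0 ≤ m ∧ IsMul g κ 1 m := by
    intro κ hκ0 hκ
    obtain ⟨C, -, hI⟩ := exists_eventually_isMul (n := n) hκ0 h0 h1
    obtain ⟨S, hS0, hS⟩ := exists_ae_bound hg.memLp
    have := hI k g S 1 (hγ.imp hκ.trans hκ.trans_lt) hg hS0 hS one_pos
    obtain ⟨ρ, hρ, hρ0⟩ := (this.and self_mem_nhdsWithin).exists
    exact hρ.rescale hρ0 one_pos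
  refine ⟨hg.memLp, fun κ hκ => ?_⟩
  rcases abs_cases κ with ⟨h, h'⟩ | ⟨h, h'⟩
  · exact pos κ h' (h ▸ hκ)
  · obtain ⟨m, hm, hI⟩ := pos (-κ) (by linarith) (h ▸ hκ)
    exact ⟨m, hm, by simpa using hI.neg⟩

lemma mulUpTo_schwartz (γ : ℝ) (χ : 𝓢(RR n, ℂ)) : MulUpTo γ χ := by
  have := (memWkInfty_const (n := n) (k := ⌈γ⌉₊) (θ := 0) 1).schwartz_mul le_rfl zero_le_one χ
  simp only [mul_one] at this
  exact this.mulUpTo le_rfl zero_le_one (Or.inl (Nat.le_ceil γ))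

lemma exists_isMul_schwartz (κ : ℝ) (χ : 𝓢(RR n, ℂ)) : ∃ m : ℝ, 0 ≤ m ∧ IsMul χ κ 1 m :=
  (mulUpTo_schwartz |κ| χ).2 κ le_rfl

lemma MulUpTo.hasOrd {γ : ℝ} (hγ : 0 ≤ γ) {g : RR n → ℂ} (hg : MulUpTo γ g) (ψ : 𝓢(RR n, ℂ)) :
    HasOrd γ (fun x => g x * ψ x) := by
  obtain ⟨m, hm, hI⟩ := hg.2 γ (abs_of_nonneg hγ).le
  exact (hI.hasOrd hg.1 one_pos hm ψ).1

/-- Multiplication of a distribution of order `t` by a coefficient. -/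
lemma MulUpTo.exists_mul {γ t t' : ℝ} (hγ : 0 ≤ γ) {g : RR n → ℂ} (hg : MulUpTo γ g)
    (htt : t' ≤ t) (ht : -γ ≤ t) (ht' : t' ≤ γ) {F : RR n → ℂ} (hF : MemW t F) :
    ∃ H : RR n → ℂ, MemW t' H ∧ ∀ ψ : 𝓢(RR n, ℂ), pair F (fun x => g x * ψ x) = act H ψ := by
  -- Multiplication must be performed at an order in [-γ, γ] lying between t' and t; this is the
  -- smallest one.
  obtain ⟨m, hm, hI⟩ := hg.2 (max t' (-γ)) (abs_le.2 ⟨le_max_right _ _, max_le ht' (by linarith)⟩)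
  obtain ⟨H, hH, -, hp⟩ := hI.exists_mul hg.1 one_pos hm (hF.mono (max_le htt ht))
  exact ⟨H, hH.mono (le_max_left _ _), hp⟩

/-! ### Products with Schwartz functions -/

/-- The distribution `φ F`, where `φ` is a Schwartz function. -/
def IsProd (φ : 𝓢(RR n, ℂ)) (F F' : RR n → ℂ) : Prop :=
  ∀ ψ : 𝓢(RR n, ℂ), act F (sm φ ψ) = act F' ψ

lemma exists_isProd (φ : 𝓢(RR n, ℂ)) {t : ℝ} {F : RR n → ℂ} (hF : MemW t F) :
    ∃ F', MemW t F' ∧ IsProd φ F F' := by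
  obtain ⟨m, hm, hI⟩ := exists_isMul_schwartz t φ
  obtain ⟨H, hH, -, hp⟩ := hI.exists_mul φ.memLp_top one_pos hm hF
  refine ⟨H, hH, fun ψ => ?_⟩
  rw [← hp, ← pair_schwartz]
  congr 1
  ext; simp

/-- Moves the cutoff from the test side to the distribution. The function gψ is in general only of
order γ and not Schwartz, so the approximation argument of `pair_schwartz_mul` is needed. -/
lemma MulUpTo.pair_prod {γ : ℝ} (hγ : 0 ≤ γ) {g : RR n → ℂ} (hg : MulUpTo γ g)
    {φ : 𝓢(RR n, ℂ)} {F F' : RR n → ℂ} (hF : MemW (-γ) F) (hF' : MemW (-γ) F')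
    (hP : IsProd φ F F') (ψ : 𝓢(RR n, ℂ)) :
    pair F (fun x => g x * (φ x * ψ x)) = pair F' (fun x => g x * ψ x) := by
  obtain ⟨m, hm, hI⟩ := exists_isMul_schwartz γ φ
  rw [← pair_schwartz_mul hI hF hF' (hg.hasOrd hγ ψ) hP]
  congr 1; ext x; ring

lemma act_dsym_mul (F : RR n → ℂ) (j : Fin n) (ψ : 𝓢(RR n, ℂ)) :
    act (fun ξ => dsym j ξ * F ξ) ψ = - act F (∂_{dir j} ψ) := by
  rw [act, act, ← integral_neg]
  refine integral_congr_ae (Eventually.of_forall fun ξ => ?_)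
  simp only
  rw [fourierInv_lineDeriv_apply]
  ring

lemma act_add_left {t : ℝ} {F G : RR n → ℂ} (hF : MemW t F) (hG : MemW t G) (ψ : 𝓢(RR n, ℂ)) :
    act (fun ξ => F ξ + G ξ) ψ = act F ψ + act G ψ := by
  simp only [act, add_mul]
  exact integral_add (integrable_act hF ψ) (integrable_act hG ψ)

lemma act_sub_left {t : ℝ} {F G : RR n → ℂ} (hF : MemW t F) (hG : MemW t G) (ψ : 𝓢(RR n, ℂ)) :
    act (fun ξ => F ξ - G ξ) ψ = act F ψ - act G ψ := by
  simp only [act, sub_mul]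
  exact integral_sub (integrable_act hF ψ) (integrable_act hG ψ)

lemma act_const_mul (c : ℂ) (F : RR n → ℂ) (ψ : 𝓢(RR n, ℂ)) :
    act (fun ξ => c * F ξ) ψ = c * act F ψ := by
  simp only [act, mul_assoc]
  exact integral_const_mul _ _

lemma act_sum_left {t : ℝ} {ι : Type*} (s : Finset ι) {F : ι → RR n → ℂ}
    (hF : ∀ i ∈ s, MemW t (F i)) (ψ : 𝓢(RR n, ℂ)) :
    act (fun ξ => ∑ i ∈ s, F i ξ) ψ = ∑ i ∈ s, act (F i) ψ := by
  simp only [act, Finset.sum_mul]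
  exact integral_finsetSum _ fun i hi => integrable_act (hF i hi) ψ

lemma act_add_right {t : ℝ} {F : RR n → ℂ} (hF : MemW t F) (ψ η : 𝓢(RR n, ℂ)) :
    act F (ψ + η) = act F ψ + act F η := by
  simp only [act, fourierInv_add, add_apply, mul_add]
  exact integral_add (integrable_act hF ψ) (integrable_act hF η)

/-! ### A contraction argument -/

lemma nW_add_le {ρ κ : ℝ} (hρ : 0 < ρ) {F G : RR n → ℂ} (hF : MemW κ F) (hG : MemW κ G) :
    nW ρ κ (fun ξ => F ξ + G ξ) ≤ nW ρ κ F + nW ρ κ G := by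
  have hF' := (memW_iff hρ).1 hF
  have hG' := (memW_iff hρ).1 hG
  have h := eLpNorm_add_le hF'.1 hG'.1 (by norm_num : (1 : ℝ≥0∞) ≤ 2)
  have h2 := ENNReal.toReal_mono (ENNReal.add_ne_top.2 ⟨hF'.2.ne, hG'.2.ne⟩) h
  rw [ENNReal.toReal_add hF'.2.ne hG'.2.ne] at h2
  refine le_trans (le_of_eq ?_) h2
  rw [nW]
  congr 2
  ext ξ
  simp [mul_add]

lemma nW_zero (ρ κ : ℝ) : nW ρ κ (fun _ : RR n => 0) = 0 := by simp [nW]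

lemma nW_sum_le {ρ κ : ℝ} (hρ : 0 < ρ) {ι : Type*} (s : Finset ι) {F : ι → RR n → ℂ}
    (hF : ∀ i, MemW κ (F i)) :
    nW ρ κ (fun ξ => ∑ i ∈ s, F i ξ) ≤ ∑ i ∈ s, nW ρ κ (F i) := by
  classical
  induction s using Finset.induction_on with
  | empty => simp [nW_zero]
  | insert a s ha ih =>
    simp only [Finset.sum_insert ha]
    exact (nW_add_le hρ (hF a) (MemW.sum s fun i _ => hF i)).trans (by gcongr)

lemma nW_symbol_le {ρ κ B : ℝ} (hρ : 0 < ρ) (hB : 0 ≤ B) {K F : RR n → ℂ} (hF : MemW κ F)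
    (hK : ∀ ξ, ‖K ξ‖ ≤ B) : nW ρ κ (fun ξ => K ξ * F ξ) ≤ B * nW ρ κ F := by
  have hF' := (memW_iff hρ).1 hF
  have h : eLpNorm (fun ξ => (wt ρ κ ξ : ℂ) * (K ξ * F ξ)) 2 volume ≤
      ENNReal.ofReal B * eLpNorm (fun ξ => (wt ρ κ ξ : ℂ) * F ξ) 2 volume := by
    refine eLpNorm_le_mul_eLpNorm_of_ae_le_mul (Eventually.of_forall fun ξ => ?_) 2
    simp only [norm_mul]
    have := mul_le_mul_of_nonneg_left (hK ξ) (by positivity : 0 ≤ ‖(wt ρ κ ξ : ℂ)‖ * ‖F ξ‖)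
    linarith
  have h2 := ENNReal.toReal_mono (ENNReal.mul_ne_top ENNReal.ofReal_ne_top hF'.2.ne) h
  rwa [ENNReal.toReal_mul, ENNReal.toReal_ofReal hB] at h2

lemma MemW.bounded_mul {κ B : ℝ} {F K : RR n → ℂ} (hF : MemW κ F)
    (hK : AEStronglyMeasurable K volume) (h : ∀ ξ, ‖K ξ‖ ≤ B) : MemW κ (fun ξ => K ξ * F ξ) :=
  hF.symbol (C := B) hK fun ξ => by simpa using h ξ

lemma pair_add_left {μ : ℝ} {F F' h : RR n → ℂ} (hF : MemW (-μ) F) (hF' : MemW (-μ) F')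
    (hh : HasOrd μ h) : pair (fun ξ => F ξ + F' ξ) h = pair F h + pair F' h := by
  rw [pair, pair, pair, ← integral_add (integrable_pair hF hh) (integrable_pair hF' hh)]
  simp only [add_mul]

/-- A solution of order `τ` of a system `F = G + K (a F)`, where the operators of multiplication by
`a` have small norms in the orders `τ` and `τ'`, is of order `τ'` if `G` is. -/
theorem memW_of_contraction {I J : Type*} [Fintype I] [Fintype J] {τ τ' ρ m B : ℝ} (hρ : 0 < ρ)
    (hm : 0 ≤ m) (hB : 0 ≤ B) (hτ : τ ≤ τ') (hsmall : Fintype.card J * (B * m) ≤ 1 / 2)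
    {F G : I → RR n → ℂ} {K : I → J → RR n → ℂ} {r : J → I} {a H : J → RR n → ℂ}
    (hF : ∀ i, MemW τ (F i)) (hG : ∀ i, MemW τ' (G i)) (hH : ∀ j, MemW τ (H j))
    (hK : ∀ i j, AEStronglyMeasurable (K i j) volume) (hKB : ∀ i j ξ, ‖K i j ξ‖ ≤ B)
    (ha : ∀ j, MemLp (a j) ∞ (volume : Measure (RR n)))
    (hm1 : ∀ j, IsMul (a j) τ ρ m) (hm2 : ∀ j, IsMul (a j) τ' ρ m)
    (hHa : ∀ j (ψ : 𝓢(RR n, ℂ)), pair (F (r j)) (fun x => a j x * ψ x) = act (H j) ψ)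
    (hFG : ∀ i, F i =ᵐ[volume] fun ξ => G i ξ + ∑ j, K i j ξ * H j ξ) (i : I) : MemW τ' (F i) := by
  set g := ∑ i, nW ρ τ' (G i) with hg
  set D := ∑ i, nW ρ τ (F i) with hD
  have hg0 : 0 ≤ g := Finset.sum_nonneg fun i _ => nW_nonneg _ _ _
  have hD0 : 0 ≤ D := Finset.sum_nonneg fun i _ => nW_nonneg _ _ _
  have hgi : ∀ i, nW ρ τ' (G i) ≤ g := fun i =>
    Finset.single_le_sum (f := fun i => nW ρ τ' (G i)) (fun i _ => nW_nonneg _ _ _) (Finset.mem_univ i)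
  have hDi : ∀ i, nW ρ τ (F i) ≤ D := fun i =>
    Finset.single_le_sum (f := fun i => nW ρ τ (F i)) (fun i _ => nW_nonneg _ _ _) (Finset.mem_univ i)
  -- Picard iterates of V ↦ G + K(aV) starting from zero: they stay bounded by 2g in order τ' and
  -- approach F at rate 2^{-N} in order τ. Only linearity and smallness are used.
  have step : ∀ N : ℕ, ∃ V : I → RR n → ℂ, (∀ i, MemW τ' (V i)) ∧ (∀ i, nW ρ τ' (V i) ≤ 2 * g) ∧
      ∀ i, nW ρ τ (fun ξ => F i ξ - V i ξ) ≤ (1 / 2) ^ N * D := by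
    intro N
    induction N with
    | zero =>
      refine ⟨fun _ _ => 0, fun i => MemW.zero, fun i => ?_, fun i => ?_⟩
      · rw [nW_zero]; positivity
      · simpa using hDi i
    | succ N ih =>
      obtain ⟨V, hV, hV1, hV2⟩ := ih
      choose H' hH' hH'1 hH'2 using fun j => (hm2 j).exists_mul (ha j) hρ hm (hV (r j))
      choose H'' hH'' hH''1 hH''2 using fun j => (hm1 j).exists_mul (ha j) hρ hm
        ((hF (r j)).sub ((hV (r j)).mono hτ))
      have hdiff : ∀ j, H'' j =ᵐ[volume] fun ξ => H j ξ - H' j ξ := by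
        intro j
        have mH' := (hH' j).mono hτ
        refine act_ext (hH'' j) ((hH j).sub mH') fun ψ => ?_
        have ho : HasOrd (-τ) (fun x => a j x * ψ x) :=
          ((hm1 j).neg.hasOrd (ha j) hρ hm ψ).1
        rw [← hH''2, act_sub_left (hH j) mH', ← hHa, ← hH'2]
        exact pair_sub_left (by simpa using hF (r j)) (by simpa using (hV (r j)).mono hτ) ho
      refine ⟨fun i ξ => G i ξ + ∑ j, K i j ξ * H' j ξ, fun i => ?_, fun i => ?_, fun i => ?_⟩
      · exact (hG i).add (MemW.sum _ fun j _ => (hH' j).bounded_mul (hK i j) (hKB i j))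
      · have hb : ∀ j, MemW τ' (fun ξ => K i j ξ * H' j ξ) := fun j =>
          (hH' j).bounded_mul (hK i j) (hKB i j)
        have h1 : ∑ j, nW ρ τ' (fun ξ => K i j ξ * H' j ξ) ≤ Fintype.card J * (B * m) * (2 * g) := by
          calc _ ≤ ∑ _j : J, B * (m * (2 * g)) := Finset.sum_le_sum fun j _ =>
                (nW_symbol_le hρ hB (hH' j) (hKB i j)).trans (by
                  gcongr
                  exact (hH'1 j).trans (by gcongr; exact hV1 _))
            _ = _ := by simp; ring
        have h2 := (nW_add_le hρ (hG i) (MemW.sum Finset.univ fun j _ => hb j)).trans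
          (add_le_add (hgi i) (nW_sum_le hρ Finset.univ hb))
        have h3 := mul_le_mul_of_nonneg_right hsmall (by positivity : 0 ≤ 2 * g)
        linarith
      · have hb : ∀ j, MemW τ (fun ξ => K i j ξ * H'' j ξ) := fun j =>
          (hH'' j).bounded_mul (hK i j) (hKB i j)
        have e : (fun ξ => F i ξ - (G i ξ + ∑ j, K i j ξ * H' j ξ)) =ᵐ[volume]
            fun ξ => ∑ j, K i j ξ * H'' j ξ := by
          filter_upwards [hFG i, eventually_all.2 hdiff] with ξ h1 h2
          simp only [h1, h2, mul_sub, Finset.sum_sub_distrib]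
          ring
        rw [nW_congr e]
        refine (nW_sum_le hρ Finset.univ hb).trans ?_
        calc _ ≤ ∑ _j : J, B * (m * ((1 / 2) ^ N * D)) := Finset.sum_le_sum fun j _ =>
              (nW_symbol_le hρ hB (hH'' j) (hKB i j)).trans (by
                gcongr
                exact (hH''1 j).trans (by gcongr; exact hV2 _))
          _ = Fintype.card J * (B * m) * ((1 / 2) ^ N * D) := by simp; ring
          _ ≤ 1 / 2 * ((1 / 2) ^ N * D) := by gcongr
          _ = _ := by rw [pow_succ]; ring
  choose V hV hV1 hV2 using step
  -- No convergence in order τ' is required: the uniform bound survives weak convergence, and Riesz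
  -- representation turns the resulting bound on `act (F i)` into membership in order τ'.
  have hlim : ∀ ψ : 𝓢(RR n, ℂ), ‖act (F i) ψ‖ ≤ 2 * g * sn ρ (-τ') ψ := by
    intro ψ
    have hb : ∀ N, ‖act (F i) ψ‖ ≤ 2 * g * sn ρ (-τ') ψ + (1 / 2) ^ N * (D * sn ρ (-τ) ψ) := by
      intro N
      have mV := (hV N i).mono hτ
      have e : act (F i) ψ = act (V N i) ψ + act (fun ξ => F i ξ - V N i ξ) ψ := by
        rw [act_sub_left (hF i) mV]; ring
      rw [e]
      have b1 := norm_act_le hρ (hV N i) ψ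
      have b2 := norm_act_le hρ ((hF i).sub mV) ψ
      have b3 := mul_le_mul_of_nonneg_right (hV1 N i) (sn_nonneg ρ (-τ') ψ)
      have b4 := mul_le_mul_of_nonneg_right (hV2 N i) (sn_nonneg ρ (-τ) ψ)
      refine (norm_add_le _ _).trans ?_
      linarith
    have ht : Tendsto (fun N : ℕ => 2 * g * sn ρ (-τ') ψ + (1 / 2 : ℝ) ^ N * (D * sn ρ (-τ) ψ)) atTop
        (𝓝 (2 * g * sn ρ (-τ') ψ)) := by
      have := (tendsto_pow_atTop_nhds_zero_of_lt_one (by norm_num : (0 : ℝ) ≤ 1 / 2)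
        (by norm_num)).mul_const (D * sn ρ (-τ) ψ)
      simpa using this.const_add (2 * g * sn ρ (-τ') ψ)
    exact ge_of_tendsto' ht hb
  let Λ : 𝓢(RR n, ℂ) →ₗ[ℂ] ℂ :=
    { toFun := fun ψ => act (F i) ψ
      map_add' := fun ψ η => act_add_right (hF i) ψ η
      map_smul' := fun c ψ => by
        simp only [act, fourierInv_smul, smul_apply, smul_eq_mul, RingHom.id_apply]
        rw [← integral_const_mul]
        congr 1; ext ξ; ring }
  obtain ⟨F', hF', -, hact⟩ := exists_memW_of_bound hρ (by positivity) Λ hlim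
  exact hF'.congr (act_ext' hF' (hF i) fun ψ => (hact ψ).symm)

/-! ### Localisation of the equation -/

/-- The functional `T` on Schwartz functions is given by a distribution of order `t`. -/
def Reg (t : ℝ) (T : 𝓢(RR n, ℂ) → ℂ) : Prop := ∃ g : RR n → ℂ, MemW t g ∧ ∀ ψ, T ψ = act g ψ

namespace Reg

variable {t t' : ℝ} {T T' : 𝓢(RR n, ℂ) → ℂ}

lemma mono (h : Reg t T) (ht : t' ≤ t) : Reg t' T := by
  obtain ⟨g, hg, hT⟩ := h
  exact ⟨g, hg.mono ht, hT⟩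

lemma add (h : Reg t T) (h' : Reg t T') : Reg t (fun ψ => T ψ + T' ψ) := by
  obtain ⟨g, hg, hT⟩ := h
  obtain ⟨g', hg', hT'⟩ := h'
  exact ⟨_, hg.add hg', fun ψ => by rw [act_add_left hg hg', ← hT, ← hT']⟩

lemma sub (h : Reg t T) (h' : Reg t T') : Reg t (fun ψ => T ψ - T' ψ) := by
  obtain ⟨g, hg, hT⟩ := h
  obtain ⟨g', hg', hT'⟩ := h'
  exact ⟨_, hg.sub hg', fun ψ => by rw [act_sub_left hg hg', ← hT, ← hT']⟩

lemma sum {ι : Type*} (s : Finset ι) {T : ι → 𝓢(RR n, ℂ) → ℂ} (h : ∀ i, Reg t (T i)) :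
    Reg t (fun ψ => ∑ i ∈ s, T i ψ) := by
  choose g hg hT using h
  exact ⟨_, MemW.sum s fun i _ => hg i, fun ψ => by
    rw [act_sum_left s (fun i _ => hg i)]; simp only [hT]⟩

lemma lineDeriv (h : Reg t T) (i : Fin n) : Reg (t - 1) (fun ψ : 𝓢(RR n, ℂ) => T (∂_{dir i} ψ)) := by
  obtain ⟨g, hg, hT⟩ := h
  refine ⟨_, (hg.dsym_mul i).const_mul (-1), fun ψ => ?_⟩
  rw [act_const_mul, act_dsym_mul, ← hT]
  ring

end Reg

lemma reg_pair {γ t t' : ℝ} (hγ : 0 ≤ γ) {g : RR n → ℂ} (hg : MulUpTo γ g) (htt : t' ≤ t)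
    (ht : -γ ≤ t) (ht' : t' ≤ γ) {F : RR n → ℂ} (hF : MemW t F) :
    Reg t' (fun ψ : 𝓢(RR n, ℂ) => pair F (fun x => g x * ψ x)) := hg.exists_mul hγ htt ht ht' hF

lemma reg_pair_prod {γ t t' : ℝ} (hγ : 0 ≤ γ) {g : RR n → ℂ} (hg : MulUpTo γ g) (htt : t' ≤ t)
    (ht : -γ ≤ t) (ht' : t' ≤ γ) {φ : 𝓢(RR n, ℂ)} {F F' : RR n → ℂ} (hF : MemW (-γ) F)
    (hF' : MemW t F') (hP : IsProd φ F F') :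
    Reg t' (fun ψ : 𝓢(RR n, ℂ) => pair F (fun x => g x * (φ x * ψ x))) := by
  have := reg_pair hγ hg htt ht ht' hF'
  simpa only [hg.pair_prod hγ hF (hF'.mono ht) hP] using this

/-- The Leibniz rule φ ∂F = ∂(φF) - (∂φ)F for distributions. -/
lemma IsProd.dsym_mul {φ : 𝓢(RR n, ℂ)} {F w w' : RR n → ℂ} {t : ℝ} {j : Fin n} (hF : ∃ s, MemW s F)
    (hw : MemW t w) (hw' : MemW t w') (h : IsProd φ F w) (h' : IsProd (∂_{dir j} φ) F w') :
    IsProd φ (fun ξ => dsym j ξ * F ξ) (fun ξ => dsym j ξ * w ξ - w' ξ) := by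
  obtain ⟨s, hF⟩ := hF
  intro ψ
  rw [act_sub_left (hw.dsym_mul j) (hw'.mono (by linarith)), act_dsym_mul, act_dsym_mul, lineDeriv_sm,
    act_add_right hF, h, h']
  ring

lemma tsupport_sm_subset (φ ψ : 𝓢(RR n, ℂ)) : tsupport (sm φ ψ : 𝓢(RR n, ℂ)) ⊆ tsupport φ := by
  have e : (sm φ ψ : RR n → ℂ) = fun x => φ x * ψ x := by ext; simp
  rw [e]
  exact tsupport_mul_subset_left

/-- A second-order system
`-∑ ∂_i (a_ij ∂_j u) + ∑ b_j ∂_j u - ∑ ∂_j (d_j u) + c u = f`, with `u` and `f` represented by their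
Fourier transforms, together with orders `α, β, δ, γ` up to which the coefficients are multipliers. -/
structure Sys (n m : ℕ) where
  a : Fin n → Fin n → Fin m → Fin m → RR n → ℂ
  b : Fin n → Fin m → Fin m → RR n → ℂ
  d : Fin n → Fin m → Fin m → RR n → ℂ
  c : Fin m → Fin m → RR n → ℂ
  F : Fin m → RR n → ℂ
  Φ : Fin m → RR n → ℂ
  α : ℝ
  β : ℝ
  δ : ℝ
  γ : ℝ

/-- The system holds in the open set `V`, with solution of order `σ₁ + 1`, right-hand side of order
`σ₂ - 1`, and coefficients which are multipliers of suitable orders. -/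
structure Sys.Good {m : ℕ} (X : Sys n m) (V : Set (RR n)) (σ₁ σ₂ : ℝ) : Prop where
  hα : 0 ≤ X.α
  hβ : 0 ≤ X.β
  hδ : 0 ≤ X.δ
  hγ : 0 ≤ X.γ
  ha : ∀ i j k l, MulUpTo X.α (X.a i j k l)
  hb : ∀ j k l, MulUpTo X.β (X.b j k l)
  hd : ∀ j k l, MulUpTo X.δ (X.d j k l)
  hc : ∀ k l, MulUpTo X.γ (X.c k l)
  α₁ : -X.α ≤ σ₁
  α₂ : σ₂ ≤ X.α
  β₁ : -X.β ≤ σ₁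
  β₂ : σ₂ - 1 ≤ X.β
  δ₁ : -X.δ ≤ σ₁ + 1
  δ₂ : σ₂ ≤ X.δ
  γ₁ : -X.γ ≤ σ₁ + 1
  γ₂ : σ₂ - 1 ≤ X.γ
  hF : ∀ l, MemW (σ₁ + 1) (X.F l)
  hΦ : ∀ k, MemW (σ₂ - 1) (X.Φ k)
  eq : ∀ ψ : 𝓢(RR n, ℂ), HasCompactSupport ψ → tsupport ψ ⊆ V → ∀ k,
    (∑ i : Fin n, ∑ j : Fin n, ∑ l, pair (fun ξ => dsym j ξ * X.F l ξ) (fun x => X.a i j k l x * (∂_{dir i} ψ) x)) +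
    (∑ j : Fin n, ∑ l, pair (fun ξ => dsym j ξ * X.F l ξ) (fun x => X.b j k l x * ψ x)) +
    (∑ j : Fin n, ∑ l, pair (X.F l) (fun x => X.d j k l x * (∂_{dir j} ψ) x)) +
    ∑ l, pair (X.F l) (fun x => X.c k l x * ψ x) = act (X.Φ k) ψ

/-- For all cutoff functions `φ` supported in `B`, `φ F` is of order `t`. -/
def RegOn {m : ℕ} (F : Fin m → RR n → ℂ) (B : Set (RR n)) (t : ℝ) : Prop :=
  ∀ φ : 𝓢(RR n, ℂ), HasCompactSupport φ → tsupport φ ⊆ B → ∀ l,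
    ∃ F', MemW t F' ∧ IsProd φ (F l) F'

/-- The equation is tested with φψ. Every term other than the principal part of φu involves u or ∂u
multiplied by a cutoff from B, of order τ + 1 or τ, with at most one further outer derivative in the
former case. As τ' ≤ τ + 1, all these terms reach order τ' - 1, provided the coefficients multiply
in the orders used. -/
theorem Sys.Good.localize {m : ℕ} {X : Sys n m} {V B : Set (RR n)} {σ₁ σ₂ τ τ' : ℝ}
    (hX : X.Good V σ₁ σ₂) (hBV : B ⊆ V) (h1 : σ₁ ≤ τ) (h3 : τ' ≤ τ + 1) (h4 : τ' ≤ σ₂)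
    (hR : RegOn X.F B (τ + 1)) {φ : 𝓢(RR n, ℂ)} (hφc : HasCompactSupport φ) (hφ : tsupport φ ⊆ B)
    {w : Fin m → RR n → ℂ}
    (hw : ∀ l, MemW (τ + 1) (w l)) (hφw : ∀ l, IsProd φ (X.F l) (w l)) (k : Fin m) :
    Reg (τ' - 1) (fun ψ : 𝓢(RR n, ℂ) => ∑ i : Fin n, ∑ j : Fin n, ∑ l, pair (fun ξ => dsym j ξ * w l ξ)
      (fun x => X.a i j k l x * (∂_{dir i} ψ) x)) := by
  have hα := hX.hα; have hβ := hX.hβ; have hδ := hX.hδ; have hγ := hX.hγ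
  have α₁ := hX.α₁; have α₂ := hX.α₂; have β₁ := hX.β₁; have β₂ := hX.β₂
  have δ₁ := hX.δ₁; have δ₂ := hX.δ₂; have γ₁ := hX.γ₁; have γ₂ := hX.γ₂
  have hd : ∀ j : Fin n, tsupport (∂_{dir j} φ : 𝓢(RR n, ℂ)) ⊆ B := fun j =>
    (SchwartzMap.tsupport_lineDerivOp_subset _ φ).trans hφ
  have hdc : ∀ j : Fin n, HasCompactSupport (∂_{dir j} φ : 𝓢(RR n, ℂ)) := fun j =>
    hφc.mono' (subset_closure.trans (SchwartzMap.tsupport_lineDerivOp_subset _ φ))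
  have hdd : ∀ i j : Fin n, tsupport (∂_{dir j} (∂_{dir i} φ) : 𝓢(RR n, ℂ)) ⊆ B := fun i j =>
    (SchwartzMap.tsupport_lineDerivOp_subset _ _).trans (hd i)
  have hddc : ∀ i j : Fin n, HasCompactSupport (∂_{dir j} (∂_{dir i} φ) : 𝓢(RR n, ℂ)) := fun i j =>
    (hdc i).mono' (subset_closure.trans (SchwartzMap.tsupport_lineDerivOp_subset _ _))
  choose w₁ hw₁ hp₁ using fun j => hR (∂_{dir j} φ) (hdc j) (hd j)
  choose w₂ hw₂ hp₂ using fun i j => hR (∂_{dir j} (∂_{dir i} φ)) (hddc i j) (hdd i j)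
  have hdF : ∀ j l, MemW σ₁ (fun ξ => dsym j ξ * X.F l ξ) := fun j l => by
    simpa using (hX.hF l).dsym_mul j
  have hD : ∀ j l, MemW τ (fun ξ => dsym j ξ * w l ξ - w₁ j l ξ) := fun j l => by
    simpa using ((hw l).dsym_mul j).sub ((hw₁ j l).mono (by linarith : τ + 1 - 1 ≤ τ + 1))
  have hE : ∀ i j l, MemW τ (fun ξ => dsym j ξ * w₁ i l ξ - w₂ i j l ξ) := fun i j l => by
    simpa using ((hw₁ i l).dsym_mul j).sub ((hw₂ i j l).mono (by linarith : τ + 1 - 1 ≤ τ + 1))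
  have pD : ∀ j l, IsProd φ (fun ξ => dsym j ξ * X.F l ξ) (fun ξ => dsym j ξ * w l ξ - w₁ j l ξ) :=
    fun j l => IsProd.dsym_mul ⟨_, hX.hF l⟩ (hw l) (hw₁ j l) (hφw l) (hp₁ j l)
  have pE : ∀ i j l, IsProd (∂_{dir i} φ) (fun ξ => dsym j ξ * X.F l ξ)
      (fun ξ => dsym j ξ * w₁ i l ξ - w₂ i j l ξ) :=
    fun i j l => IsProd.dsym_mul ⟨_, hX.hF l⟩ (hw₁ i l) (hw₂ i j l) (hp₁ i l) (hp₂ i j l)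
  -- The commutators are sorted by where the derivative acts. In `r1` and `r5` an outer derivative
  -- lowers a product of order τ' to τ' - 1; in the other coefficient terms the derivative has
  -- fallen on the cutoff or on u.
  have r1 : ∀ (i j : Fin n) l, Reg (τ' - 1) (fun ψ : 𝓢(RR n, ℂ) => pair (w₁ j l)
      (fun x => X.a i j k l x * (∂_{dir i} ψ) x)) := fun i j l =>
    (reg_pair hα (hX.ha i j k l) h3 (by linarith) (by linarith) (hw₁ j l)).lineDeriv i
  have r2 : ∀ (i j : Fin n) l, Reg (τ' - 1) (fun ψ : 𝓢(RR n, ℂ) => pair (fun ξ => dsym j ξ * X.F l ξ)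
      (fun x => X.a i j k l x * ((∂_{dir i} φ) x * ψ x))) := fun i j l =>
    reg_pair_prod hα (hX.ha i j k l) (t := τ) (by linarith) (by linarith) (by linarith)
      ((hdF j l).mono (by linarith)) (hE i j l) (pE i j l)
  have r3 : Reg (τ' - 1) (fun ψ : 𝓢(RR n, ℂ) => act (X.Φ k) (sm φ ψ)) := by
    obtain ⟨g, hg, hP⟩ := exists_isProd φ (hX.hΦ k)
    exact ⟨g, hg.mono (by linarith), hP⟩
  have r4 : ∀ (j : Fin n) l, Reg (τ' - 1) (fun ψ : 𝓢(RR n, ℂ) => pair (fun ξ => dsym j ξ * X.F l ξ)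
      (fun x => X.b j k l x * (φ x * ψ x))) := fun j l =>
    reg_pair_prod hβ (hX.hb j k l) (t := τ) (by linarith) (by linarith) (by linarith)
      ((hdF j l).mono (by linarith)) (hD j l) (pD j l)
  have r5 : ∀ (j : Fin n) l, Reg (τ' - 1) (fun ψ : 𝓢(RR n, ℂ) => pair (X.F l)
      (fun x => X.d j k l x * (φ x * (∂_{dir j} ψ) x))) := fun j l =>
    (reg_pair_prod hδ (hX.hd j k l) h3 (by linarith) (by linarith)
      ((hX.hF l).mono (by linarith)) (hw l) (hφw l)).lineDeriv j
  have r6 : ∀ (j : Fin n) l, Reg (τ' - 1) (fun ψ : 𝓢(RR n, ℂ) => pair (X.F l)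
      (fun x => X.d j k l x * ((∂_{dir j} φ) x * ψ x))) := fun j l =>
    (reg_pair_prod hδ (hX.hd j k l) h3 (by linarith) (by linarith)
      ((hX.hF l).mono (by linarith)) (hw₁ j l) (hp₁ j l)).mono (by linarith)
  have r7 : ∀ l, Reg (τ' - 1) (fun ψ : 𝓢(RR n, ℂ) => pair (X.F l) (fun x => X.c k l x * (φ x * ψ x))) := fun l =>
    reg_pair_prod hγ (hX.hc k l) (t := τ + 1) (by linarith) (by linarith) (by linarith)
      ((hX.hF l).mono (by linarith)) (hw l) (hφw l)
  have key : ∀ ψ : 𝓢(RR n, ℂ), ∑ i : Fin n, ∑ j : Fin n, ∑ l, pair (fun ξ => dsym j ξ * w l ξ)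
      (fun x => X.a i j k l x * (∂_{dir i} ψ) x) =
      (∑ i : Fin n, ∑ j : Fin n, ∑ l, (pair (w₁ j l) (fun x => X.a i j k l x * (∂_{dir i} ψ) x) -
        pair (fun ξ => dsym j ξ * X.F l ξ) (fun x => X.a i j k l x * ((∂_{dir i} φ) x * ψ x)))) +
      (act (X.Φ k) (sm φ ψ) -
        (∑ j : Fin n, ∑ l, pair (fun ξ => dsym j ξ * X.F l ξ) (fun x => X.b j k l x * (φ x * ψ x))) -
        (∑ j : Fin n, ∑ l, (pair (X.F l) (fun x => X.d j k l x * (φ x * (∂_{dir j} ψ) x)) +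
          pair (X.F l) (fun x => X.d j k l x * ((∂_{dir j} φ) x * ψ x)))) -
        ∑ l, pair (X.F l) (fun x => X.c k l x * (φ x * ψ x))) := by
    intro ψ
    have hsupp : tsupport (sm φ ψ : 𝓢(RR n, ℂ)) ⊆ V :=
      (tsupport_sm_subset φ ψ).trans (hφ.trans hBV)
    have hsc : HasCompactSupport (sm φ ψ : 𝓢(RR n, ℂ)) :=
      hφc.mono' (subset_closure.trans (tsupport_sm_subset φ ψ))
    have e1 : ∀ (i j : Fin n) l, pair (fun ξ => dsym j ξ * w l ξ) (fun x => X.a i j k l x * (∂_{dir i} ψ) x) =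
        (pair (w₁ j l) (fun x => X.a i j k l x * (∂_{dir i} ψ) x) -
        pair (fun ξ => dsym j ξ * X.F l ξ) (fun x => X.a i j k l x * ((∂_{dir i} φ) x * ψ x))) +
        pair (fun ξ => dsym j ξ * X.F l ξ) (fun x => X.a i j k l x * (∂_{dir i} (sm φ ψ)) x) := by
      intro i j l
      have o1 := (hX.ha i j k l).hasOrd hα (∂_{dir i} ψ)
      have o2 := (hX.ha i j k l).hasOrd hα (∂_{dir i} (sm φ ψ))
      have o3 := (hX.ha i j k l).hasOrd hα (sm (∂_{dir i} φ) ψ)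
      have s1 : (fun ξ => dsym j ξ * w l ξ) =
          fun ξ => (dsym j ξ * w l ξ - w₁ j l ξ) + w₁ j l ξ := by ext; ring
      have s2 : (fun x => X.a i j k l x * (φ x * (∂_{dir i} ψ) x)) =
          fun x => X.a i j k l x * (∂_{dir i} (sm φ ψ)) x -
            X.a i j k l x * (sm (∂_{dir i} φ) ψ) x := by
        ext x; rw [lineDeriv_sm]; simp; ring
      rw [s1, pair_add_left ((hD j l).mono (by linarith)) ((hw₁ j l).mono (by linarith)) o1,
        ← (hX.ha i j k l).pair_prod hα ((hdF j l).mono (by linarith)) ((hD j l).mono (by linarith))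
          (pD j l), s2, pair_sub_right ((hdF j l).mono (by linarith)) o2 o3]
      simp only [sm_apply]
      ring
    have e2 : ∀ (j : Fin n) l, pair (X.F l) (fun x => X.d j k l x * (∂_{dir j} (sm φ ψ)) x) =
        pair (X.F l) (fun x => X.d j k l x * (φ x * (∂_{dir j} ψ) x)) +
          pair (X.F l) (fun x => X.d j k l x * ((∂_{dir j} φ) x * ψ x)) := by
      intro j l
      have o1 := (hX.hd j k l).hasOrd hδ (sm φ (∂_{dir j} ψ))
      have o2 := (hX.hd j k l).hasOrd hδ (sm (∂_{dir j} φ) ψ)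
      have := pair_add_right ((hX.hF l).mono (by linarith)) o1 o2
      simp only [sm_apply] at this
      rw [← this, lineDeriv_sm]
      congr 1; ext x; simp; ring
    have e3 := hX.eq (sm φ ψ) hsc hsupp k
    simp only [e2] at e3
    simp only [sm_apply] at e3
    simp only [e1, Finset.sum_add_distrib (f := fun _ => _ - _), ← e3]
    simp only [Finset.sum_add_distrib]
    ring
  simp only [key]
  refine (Reg.sum _ fun i => Reg.sum _ fun j => Reg.sum _ fun l => (r1 i j l).sub (r2 i j l)).add
    (((r3.sub (Reg.sum _ fun j => Reg.sum _ fun l => r4 j l)).sub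
      (Reg.sum _ fun j => Reg.sum _ fun l => (r5 j l).add (r6 j l))).sub (Reg.sum _ fun l => r7 l))

/-! ### The inverse of the frozen symbol -/

/-- The symbol `1 + 4π² θ ∑ a_ij ξ_i ξ_j`. -/
def frozenSymbol {m : ℕ} (θ : Matrix (Fin m) (Fin m) ℂ) (a : Fin n → Fin n → Matrix (Fin m) (Fin m) ℂ)
    (ξ : RR n) : Matrix (Fin m) (Fin m) ℂ :=
  1 + ((4 * Real.pi ^ 2 : ℝ) : ℂ) • (θ * ∑ i, ∑ j, ((ξ i * ξ j : ℝ) : ℂ) • a i j)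

lemma continuous_frozenSymbol {m : ℕ} (θ : Matrix (Fin m) (Fin m) ℂ)
    (a : Fin n → Fin n → Matrix (Fin m) (Fin m) ℂ) : Continuous (frozenSymbol θ a) := by
  have h : Continuous fun ξ : RR n => ∑ i, ∑ j, ((ξ i * ξ j : ℝ) : ℂ) • a i j :=
    continuous_finsetSum _ fun i _ => continuous_finsetSum _ fun j _ =>
      Continuous.smul (Complex.continuous_ofReal.comp (by fun_prop)) continuous_const
  have h2 := (continuous_const.matrix_mul (A := fun _ => θ) h).const_smul ((4 * Real.pi ^ 2 : ℝ) : ℂ)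
  exact continuous_const.add h2

/-- Coercivity and Cauchy–Schwarz bound the matrix from below, hence its inverse from above, without
any symmetry. -/
lemma norm_mulVec_ge_of_re_ge {m : ℕ} {N : Matrix (Fin m) (Fin m) ℂ} {c : ℝ}
    (h : ∀ ζ : EuclideanSpace ℂ (Fin m), c * ‖ζ‖ ^ 2 ≤ (∑ k, ∑ l, star (ζ k) * N k l * ζ l).re)
    (ζ : EuclideanSpace ℂ (Fin m)) : c * ‖ζ‖ ≤ ‖(WithLp.toLp 2 (N.mulVec ζ) : EuclideanSpace ℂ (Fin m))‖ := by
  rcases (norm_nonneg ζ).eq_or_lt with h0 | h0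
  · rw [← h0, mul_zero]; exact norm_nonneg _
  set η : EuclideanSpace ℂ (Fin m) := WithLp.toLp 2 (N.mulVec ζ) with hη
  have e : ∑ k, ∑ l, star (ζ k) * N k l * ζ l = inner ℂ ζ η := by
    rw [PiLp.inner_apply]
    refine Finset.sum_congr rfl fun k _ => ?_
    simp only [hη, Matrix.mulVec, dotProduct, RCLike.inner_apply, Finset.sum_mul]
    refine Finset.sum_congr rfl fun l _ => ?_
    simp only [starRingEnd_apply]
    ring
  have h1 := h ζ
  rw [e] at h1
  have h2 : (inner ℂ ζ η).re ≤ ‖ζ‖ * ‖η‖ := (Complex.re_le_norm _).trans (norm_inner_le_norm ζ η)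
  have : c * ‖ζ‖ * ‖ζ‖ ≤ ‖η‖ * ‖ζ‖ := by nlinarith
  exact le_of_mul_le_mul_right this h0

/-- The identity added in `frozenSymbol` keeps the symbol coercive at ξ = 0, where the principal
part vanishes. Coercivity with constant 1 + 4π²C|ξ|² gives invertibility and decay of order -2;
continuity follows from the adjugate formula. -/
lemma exists_frozenSymbol_inv {m : ℕ} {θ : Matrix (Fin m) (Fin m) ℂ}
    {a : Fin n → Fin n → Matrix (Fin m) (Fin m) ℂ} {C : ℝ} (hC : 0 < C)
    (h : ∀ (ξ : RR n) (ζ : EuclideanSpace ℂ (Fin m)), C * ‖ξ‖ ^ 2 * ‖ζ‖ ^ 2 ≤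
      (∑ k, ∑ l, star (ζ k) * (θ * ∑ i, ∑ j, ((ξ i * ξ j : ℝ) : ℂ) • a i j) k l * ζ l).re) :
    ∃ P : RR n → Matrix (Fin m) (Fin m) ℂ, (∀ k l, Continuous fun ξ => P ξ k l) ∧
      (∀ ξ, P ξ * frozenSymbol θ a ξ = 1) ∧
      ∀ ξ k l, ‖P ξ k l‖ ≤ (1 + 1 / (4 * Real.pi ^ 2 * C)) * wt 1 (-2) ξ := by
  have hN : ∀ ξ (ζ : EuclideanSpace ℂ (Fin m)), (1 + 4 * Real.pi ^ 2 * C * ‖ξ‖ ^ 2) * ‖ζ‖ ^ 2 ≤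
      (∑ k, ∑ l, star (ζ k) * frozenSymbol θ a ξ k l * ζ l).re := by
    intro ξ ζ
    set Q := θ * ∑ i, ∑ j, ((ξ i * ξ j : ℝ) : ℂ) • a i j with hQ
    have e : ∑ k, ∑ l, star (ζ k) * frozenSymbol θ a ξ k l * ζ l =
        ((‖ζ‖ ^ 2 : ℝ) : ℂ) + ((4 * Real.pi ^ 2 : ℝ) : ℂ) * ∑ k, ∑ l, star (ζ k) * Q k l * ζ l := by
      have e1 : ((‖ζ‖ ^ 2 : ℝ) : ℂ) = ∑ k, ∑ l, star (ζ k) * (1 : Matrix (Fin m) (Fin m) ℂ) k l * ζ l := by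
        rw [EuclideanSpace.norm_sq_eq]
        push_cast
        refine Finset.sum_congr rfl fun k _ => ?_
        simp only [Matrix.one_apply, mul_ite, ite_mul, mul_one, mul_zero, zero_mul,
          Finset.sum_ite_eq, Finset.mem_univ, if_true]
        exact (Complex.conj_mul' (ζ k)).symm
      rw [e1, Finset.mul_sum, ← Finset.sum_add_distrib]
      refine Finset.sum_congr rfl fun k _ => ?_
      rw [Finset.mul_sum, ← Finset.sum_add_distrib]
      refine Finset.sum_congr rfl fun l _ => ?_
      simp only [frozenSymbol, ← hQ, Matrix.add_apply, Matrix.smul_apply, smul_eq_mul]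
      ring
    rw [e, Complex.add_re, Complex.ofReal_re, Complex.re_ofReal_mul]
    have := mul_le_mul_of_nonneg_left (h ξ ζ) (by positivity : 0 ≤ 4 * Real.pi ^ 2)
    linarith
  have hpos : ∀ ξ : RR n, 0 < 1 + 4 * Real.pi ^ 2 * C * ‖ξ‖ ^ 2 := fun ξ => by positivity
  have hunit : ∀ ξ, IsUnit (frozenSymbol θ a ξ).det := by
    intro ξ
    rw [isUnit_iff_ne_zero]
    intro h0
    obtain ⟨v, hv, hv0⟩ := Matrix.exists_mulVec_eq_zero_iff.2 h0
    have := norm_mulVec_ge_of_re_ge (hN ξ) (WithLp.toLp 2 v)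
    simp only [hv0] at this
    have h3 : ‖(WithLp.toLp 2 v : EuclideanSpace ℂ (Fin m))‖ ≤ 0 := by
      have h4 := hpos ξ
      by_contra hcon
      push Not at hcon
      have := mul_pos h4 hcon
      simp at *
      linarith
    have h5 : (WithLp.toLp 2 v : EuclideanSpace ℂ (Fin m)) = 0 := norm_le_zero_iff.1 h3
    exact hv (by simpa using h5)
  refine ⟨fun ξ => (frozenSymbol θ a ξ)⁻¹, fun k l => ?_, fun ξ => Matrix.nonsing_inv_mul _ (hunit ξ),
    fun ξ k l => ?_⟩
  · have hc := continuous_frozenSymbol θ a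
    have : Continuous fun ξ => (frozenSymbol θ a ξ)⁻¹ := by
      simp only [Matrix.inv_def, Ring.inverse_eq_inv']
      exact (hc.matrix_det.inv₀ fun ξ => (hunit ξ).ne_zero).smul hc.matrix_adjugate
    exact this.matrix_elem k l
  · set ζ : EuclideanSpace ℂ (Fin m) :=
      WithLp.toLp 2 ((frozenSymbol θ a ξ)⁻¹.mulVec (Pi.single l 1)) with hζ
    have h1 := norm_mulVec_ge_of_re_ge (hN ξ) ζ
    have h2 : (frozenSymbol θ a ξ).mulVec ζ = Pi.single l 1 := by
      simp only [hζ, Matrix.mulVec_mulVec]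
      rw [Matrix.mul_nonsing_inv _ (hunit ξ), Matrix.one_mulVec]
    rw [h2] at h1
    have h3 : ‖(WithLp.toLp 2 (Pi.single l 1) : EuclideanSpace ℂ (Fin m))‖ = 1 := by
      simp
    rw [h3] at h1
    have h4 : ‖ζ k‖ ≤ ‖ζ‖ := PiLp.norm_apply_le ζ k
    have h5 : ζ k = (frozenSymbol θ a ξ)⁻¹ k l := by simp [hζ]
    rw [h5] at h4
    refine h4.trans ?_
    have h6 : ‖ζ‖ ≤ (1 + 4 * Real.pi ^ 2 * C * ‖ξ‖ ^ 2)⁻¹ := by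
      rw [← one_div, le_div_iff₀' (hpos ξ)]
      exact h1
    refine h6.trans ?_
    have hc : 0 < 4 * Real.pi ^ 2 * C := by positivity
    rw [wt_neg, wt_two, ← div_eq_mul_inv, ← one_div, div_le_div_iff₀ (hpos ξ) (by positivity)]
    have h7 : 1 / (4 * Real.pi ^ 2 * C) * (4 * Real.pi ^ 2 * C * ‖ξ‖ ^ 2) = ‖ξ‖ ^ 2 := by field_simp
    have h8 : 0 ≤ 1 / (4 * Real.pi ^ 2 * C) := by positivity
    have h9 : 0 ≤ 4 * Real.pi ^ 2 * C * ‖ξ‖ ^ 2 := by positivity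
    linarith

/-- Adding w to both sides of the frozen equation multiplied by θ makes the symbol invertible. The
price is the term Pw, which is two orders smoother than w and thus harmless. -/
lemma frozen_solve {m : ℕ} {θ P : Matrix (Fin m) (Fin m) ℂ}
    {a : Fin n → Fin n → Matrix (Fin m) (Fin m) ℂ} {ξ : RR n} (hP : P * frozenSymbol θ a ξ = 1)
    {w g h : Fin m → ℂ} (hg : ∀ k, g k = (∑ i, ∑ j, ∑ l, -(a i j k l * (dsym i ξ * (dsym j ξ * w l)))) - h k)
    (p : Fin m) : w p = (∑ s, P p s * w s) + ∑ k, (P * θ) p k * (g k + h k) := by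
  set S : Matrix (Fin m) (Fin m) ℂ := ∑ i, ∑ j, ((ξ i * ξ j : ℝ) : ℂ) • a i j with hS
  have e1 : (fun k => g k + h k) = ((4 * Real.pi ^ 2 : ℝ) : ℂ) • S.mulVec w := by
    ext k
    rw [hg, sub_add_cancel]
    simp only [hS, Pi.smul_apply, Matrix.mulVec, dotProduct, Matrix.sum_apply, Matrix.smul_apply,
      smul_eq_mul, Finset.sum_mul, Finset.mul_sum]
    rw [Finset.sum_comm' (t' := Finset.univ) (s' := fun _ => Finset.univ) (by simp)]
    rw [Finset.sum_congr rfl fun j _ => Finset.sum_comm' (t' := Finset.univ) (s' := fun _ => Finset.univ) (by simp)]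
    rw [Finset.sum_comm' (t' := Finset.univ) (s' := fun _ => Finset.univ) (by simp)]
    refine Finset.sum_congr rfl fun l _ => ?_
    rw [Finset.sum_comm' (t' := Finset.univ) (s' := fun _ => Finset.univ) (by simp)]
    refine Finset.sum_congr rfl fun i _ => Finset.sum_congr rfl fun j _ => ?_
    simp only [dsym]
    push_cast
    linear_combination (-4 * (Real.pi : ℂ) ^ 2 * (ξ i : ℂ) * (ξ j : ℂ) * a i j k l * w l) * Complex.I_sq
  have e2 : (frozenSymbol θ a ξ).mulVec w = w + θ.mulVec (fun k => g k + h k) := by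
    rw [e1, frozenSymbol, ← hS, Matrix.add_mulVec, Matrix.one_mulVec, Matrix.smul_mulVec,
      Matrix.mulVec_smul, Matrix.mulVec_mulVec]
  have e3 : w = P.mulVec w + (P * θ).mulVec (fun k => g k + h k) := by
    rw [← Matrix.mulVec_mulVec, ← Matrix.mulVec_add, ← e2, Matrix.mulVec_mulVec, hP, Matrix.one_mulVec]
  exact congrFun e3 p

/-! ### The regularity step -/

lemma MemWkInfty.ae_ae_holder {k : ℕ} {θ : ℝ} (hk : 0 < k + θ) {g : RR n → ℂ}
    (hg : MemWkInfty k θ g) : ∃ ν H : ℝ, 0 < ν ∧ 0 ≤ H ∧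
      ∀ᵐ x : RR n, ∀ᵐ y : RR n, ‖g y - g x‖ ≤ H * ‖y - x‖ ^ ν := by
  cases k with
  | zero =>
    obtain ⟨C, hC⟩ := hg.2
    refine ⟨θ, |C|, by simpa using hk, abs_nonneg C, ?_⟩
    filter_upwards [Measure.ae_ae_of_ae_prod hC] with x hx
    filter_upwards [hx] with y hy
    rw [norm_sub_rev, norm_sub_rev y]
    exact hy.trans (mul_le_mul_of_nonneg_right (le_abs_self C) (by positivity))
  | succ k =>
    obtain ⟨L, hL, p, hp, hpL⟩ := hg.lipschitz
    refine ⟨1, L, one_pos, hL, ?_⟩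
    filter_upwards [hp] with x hx
    filter_upwards [hp] with y hy
    simpa using hpL y x hy hx

lemma MemWkInfty.eventually_osc_le {k : ℕ} {θ : ℝ} (hk : 0 < k + θ) {g : RR n → ℂ}
    (hg : MemWkInfty k θ g) {δ : ℝ} (hδ : 0 < δ) (x₀ : RR n) : ∀ᶠ R in 𝓝[>] (0 : ℝ),
      ∀ᵐ x : RR n, x ∈ Metric.ball x₀ R → ∀ᵐ y : RR n, y ∈ Metric.ball x₀ R → ‖g y - g x‖ ≤ δ := by
  obtain ⟨ν, H, hν, hH, h⟩ := hg.ae_ae_holder hk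
  have hlim := (tendsto_mul_rpow_zero (H * 2 ^ ν) hν).eventually_lt_const hδ
  filter_upwards [hlim, self_mem_nhdsWithin] with R hR hR0
  have hR0 : 0 < R := hR0
  filter_upwards [h] with x hx hxb
  filter_upwards [hx] with y hy hyb
  refine hy.trans (le_trans ?_ hR.le)
  rw [mul_assoc, ← Real.mul_rpow (by norm_num) hR0.le]
  have : ‖y - x‖ ≤ 2 * R := by
    rw [Metric.mem_ball] at hxb hyb
    rw [← dist_eq_norm]
    linarith [dist_triangle_right y x x₀]
  gcongr

/-- Uses ⟨ξ⟩ ≤ 1 + ∑ 2π|ξ_q|: control of F and of all its first derivatives is control of one more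
order. -/
lemma memW_add_one {κ : ℝ} {F : RR n → ℂ} (hF : MemW κ F)
    (hd : ∀ q, MemW κ (fun ξ => dsym q ξ * F ξ)) : MemW (κ + 1) F := by
  have hs : MemLp (fun ξ => ‖(wt 1 κ ξ : ℂ) * F ξ‖ + ∑ q, ‖(wt 1 κ ξ : ℂ) * (dsym q ξ * F ξ)‖) 2
      (volume : Measure (RR n)) := by
    have h1 : MemLp (fun ξ => ∑ q : Fin n, ‖(wt 1 κ ξ : ℂ) * (dsym q ξ * F ξ)‖) 2
        (volume : Measure (RR n)) := memLp_finsetSum _ fun q _ => (hd q).norm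
    exact hF.norm.add h1
  refine hs.mono' ((continuous_wtC _ _).aestronglyMeasurable.mul hF.aesm)
    (Eventually.of_forall fun ξ => ?_)
  simp only [norm_mul, Complex.norm_real, Real.norm_eq_abs, abs_of_pos (wt_pos _ _ _), norm_dsym]
  have h1 : wt 1 1 ξ ≤ 1 + ∑ q, 2 * Real.pi * |ξ q| := by
    have hs0 : 0 ≤ ∑ q, |ξ q| := Finset.sum_nonneg fun q _ => abs_nonneg _
    have h2 : wt 1 1 ξ ≤ 1 + ∑ q, |ξ q| := by
      refine le_of_sq_le_sq ?_ (by positivity)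
      have h3 := wt_sq_eq_sum 1 1 ξ
      rw [Real.rpow_one] at h3
      rw [h3]
      have h4 : ∑ q, (1 * ξ q) ^ 2 ≤ (∑ q, |ξ q|) ^ 2 := by
        simp only [one_mul]
        rw [Finset.sum_congr rfl fun q _ => (sq_abs (ξ q)).symm]
        exact Finset.sum_sq_le_sq_sum_of_nonneg fun q _ => abs_nonneg _
      nlinarith
    rw [← Finset.mul_sum]
    nlinarith [Real.pi_gt_three]
  rw [wt_add]
  have h5 : 0 ≤ wt 1 κ ξ * ‖F ξ‖ := mul_nonneg (wt_pos _ _ _).le (norm_nonneg _)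
  calc _ = wt 1 κ ξ * ‖F ξ‖ * wt 1 1 ξ := by ring
    _ ≤ wt 1 κ ξ * ‖F ξ‖ * (1 + ∑ q, 2 * Real.pi * |ξ q|) := by gcongr
    _ = _ := by
      rw [mul_add, mul_one, Finset.mul_sum]
      congr 1
      refine Finset.sum_congr rfl fun q _ => ?_
      ring

/-- A cutoff function around `x₀`, as a Schwartz function. -/
def cutoff (x₀ : RR n) {R : ℝ} (hR : 0 < R) : 𝓢(RR n, ℂ) :=
  let f : ContDiffBump x₀ := ⟨R / 2, R, by positivity, by linarith⟩
  HasCompactSupport.toSchwartzMap (f := fun x => ((f x : ℝ) : ℂ))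
    (f.hasCompactSupport.comp_left (g := fun r : ℝ => (r : ℂ)) Complex.ofReal_zero)
    (Complex.ofRealCLM.contDiff.comp f.contDiff)

lemma cutoff_eq_one {x₀ : RR n} {R : ℝ} (hR : 0 < R) {x : RR n} (hx : x ∈ Metric.ball x₀ (R / 2)) :
    cutoff x₀ hR x = 1 := by
  let f : ContDiffBump x₀ := ⟨R / 2, R, by positivity, by linarith⟩
  have : f x = 1 := f.one_of_mem_closedBall (Metric.ball_subset_closedBall hx)
  change ((f x : ℝ) : ℂ) = 1
  rw [this, Complex.ofReal_one]

lemma norm_cutoff_le {x₀ : RR n} {R : ℝ} (hR : 0 < R) (x : RR n) : ‖cutoff x₀ hR x‖ ≤ 1 := by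
  let f : ContDiffBump x₀ := ⟨R / 2, R, by positivity, by linarith⟩
  change ‖((f x : ℝ) : ℂ)‖ ≤ 1
  rw [Complex.norm_real, Real.norm_eq_abs, abs_of_nonneg f.nonneg]
  exact f.le_one

lemma cutoff_eq_zero {x₀ : RR n} {R : ℝ} (hR : 0 < R) {x : RR n} (hx : x ∉ Metric.ball x₀ R) :
    cutoff x₀ hR x = 0 := by
  let f : ContDiffBump x₀ := ⟨R / 2, R, by positivity, by linarith⟩
  have : f x = 0 := f.zero_of_le_dist (by simpa using hx)
  change ((f x : ℝ) : ℂ) = 0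
  rw [this, Complex.ofReal_zero]

/-- The cutoff is 1 near the support of φ, so it acts as the identity on ∂(φF). This permits
replacing a - a(z) by its product with the cutoff, which is small everywhere and not merely near x₀.
-/
lemma isProd_cutoff_dsym {x₀ : RR n} {R : ℝ} (hR : 0 < R) {φ : 𝓢(RR n, ℂ)}
    (hφ : tsupport φ ⊆ Metric.ball x₀ (R / 2)) {F w : RR n → ℂ} (hP : IsProd φ F w) (j : Fin n) :
    IsProd (cutoff x₀ hR) (fun ξ => dsym j ξ * w ξ) (fun ξ => dsym j ξ * w ξ) := by
  intro ψ
  rw [act_dsym_mul, act_dsym_mul, ← hP, ← hP]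
  congr 2
  ext x
  rw [lineDeriv_sm, sm_apply, sm_apply, add_apply, sm_apply, sm_apply]
  by_cases hx : x ∈ tsupport φ
  · have hb := hφ hx
    have h1 : (cutoff x₀ hR : RR n → ℂ) =ᶠ[𝓝 x] fun _ => 1 := by
      filter_upwards [Metric.isOpen_ball.mem_nhds hb] with y hy
      exact cutoff_eq_one hR hy
    rw [SchwartzMap.lineDerivOp_apply_eq_fderiv, h1.fderiv_eq, cutoff_eq_one hR hb]
    simp
  · rw [image_eq_zero_of_notMem_tsupport hx]
    simp

/-- The localised equation after freezing the coefficients, on the frequency side. -/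
lemma frozen_equation {m : ℕ} {τ α : ℝ} (hα : |τ| ≤ α) {χ : 𝓢(RR n, ℂ)}
    {a : Fin n → Fin n → Fin m → Fin m → RR n → ℂ} {a₀ : Fin n → Fin n → Matrix (Fin m) (Fin m) ℂ}
    (ha₀ : ∀ i j k l, MulUpTo α (fun x => a i j k l x + -(a₀ i j k l)))
    {w : Fin m → RR n → ℂ} (hw : ∀ l, MemW (τ + 1) (w l))
    (hχ : ∀ j l, IsProd χ (fun ξ => dsym j ξ * w l ξ) (fun ξ => dsym j ξ * w l ξ))
    {H : Fin n → Fin n → Fin m → Fin m → RR n → ℂ} (hH : ∀ i j k l, MemW τ (H i j k l))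
    (hHa : ∀ i j k l (ψ : 𝓢(RR n, ℂ)), pair (fun ξ => dsym j ξ * w l ξ)
      (fun x => χ x * (a i j k l x + -(a₀ i j k l)) * ψ x) = act (H i j k l) ψ)
    {k : Fin m} {g : RR n → ℂ} (hg : MemW (τ - 1) g)
    (hgk : ∀ ψ : 𝓢(RR n, ℂ), ∑ i : Fin n, ∑ j : Fin n, ∑ l, pair (fun ξ => dsym j ξ * w l ξ)
      (fun x => a i j k l x * (∂_{dir i} ψ) x) = act g ψ) :
    g =ᵐ[volume] fun ξ => (∑ i, ∑ j, ∑ l, -(a₀ i j k l * (dsym i ξ * (dsym j ξ * w l ξ)))) -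
      ∑ i, ∑ j, ∑ l, dsym i ξ * H i j k l ξ := by
  have hα0 : 0 ≤ α := (abs_nonneg _).trans hα
  have hτα : -α ≤ τ := (abs_le.1 hα).1
  have hdw : ∀ j l, MemW τ (fun ξ => dsym j ξ * w l ξ) := fun j l => by
    simpa using (hw l).dsym_mul j
  have hdd : ∀ i j l, MemW (τ - 1) (fun ξ => dsym i ξ * (dsym j ξ * w l ξ)) := fun i j l =>
    (hdw j l).dsym_mul i
  have hdH : ∀ i j l, MemW (τ - 1) (fun ξ => dsym i ξ * H i j k l ξ) := fun i j l =>
    (hH i j k l).dsym_mul i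
  have hda : ∀ i j l, MemW (τ - 1) (fun ξ => -a₀ i j k l * (dsym i ξ * (dsym j ξ * w l ξ))) :=
    fun i j l => (hdd i j l).const_mul _
  have hM : ∀ i j l, MemW (τ - 1) (fun ξ =>
      -a₀ i j k l * (dsym i ξ * (dsym j ξ * w l ξ)) - dsym i ξ * H i j k l ξ) :=
    fun i j l => (hda i j l).sub (hdH i j l)
  have hS := MemW.sum Finset.univ fun i _ => MemW.sum Finset.univ fun j _ =>
    MemW.sum Finset.univ fun l _ => hM i j l
  have h1 := act_ext hg hS (fun ψ => by
    rw [← hgk, act_sum_left _ fun i _ => MemW.sum Finset.univ fun j _ =>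
      MemW.sum Finset.univ fun l _ => hM i j l]
    refine Finset.sum_congr rfl fun i _ => ?_
    rw [act_sum_left _ fun j _ => MemW.sum Finset.univ fun l _ => hM i j l]
    refine Finset.sum_congr rfl fun j _ => ?_
    rw [act_sum_left _ fun l _ => hM i j l]
    refine Finset.sum_congr rfl fun l _ => ?_
    rw [act_sub_left (hda i j l) (hdH i j l), act_const_mul, act_dsym_mul (fun ξ => dsym j ξ * w l ξ) i ψ,
      act_dsym_mul (H i j k l) i ψ, ← hHa]
    have hmem : MemW (-α) (fun ξ => dsym j ξ * w l ξ) := (hdw j l).mono hτα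
    -- The cutoff on a - a(z) is absorbed by ∂w; the constant part a(z) then contributes a genuine
    -- Fourier multiplier.
    have e1 := (ha₀ i j k l).pair_prod hα0 hmem hmem (hχ j l) (∂_{dir i} ψ)
    have e2 : (fun x => χ x * (a i j k l x + -(a₀ i j k l)) * (∂_{dir i} ψ) x) =
        fun x => (a i j k l x + -(a₀ i j k l)) * (χ x * (∂_{dir i} ψ) x) := by ext x; ring
    have e3 := pair_add_right hmem ((ha₀ i j k l).hasOrd hα0 (∂_{dir i} ψ))
      ((hasOrd_schwartz α (∂_{dir i} ψ)).const_mul (a₀ i j k l))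
    rw [pair_const_mul_right ((∂_{dir i} ψ).memLp 2), pair_schwartz] at e3
    rw [e2, e1]
    have e4 : (fun x => a i j k l x * (∂_{dir i} ψ) x) = fun x =>
        (a i j k l x + -(a₀ i j k l)) * (∂_{dir i} ψ) x + a₀ i j k l * (∂_{dir i} ψ) x := by
      ext x; ring
    rw [e4, e3]
    ring)
  filter_upwards [h1] with ξ hξ
  rw [hξ]
  simp only [Finset.sum_sub_distrib, neg_mul]

/-- `F` is of order `t` locally in `V`. -/
def LocReg {m : ℕ} (F : Fin m → RR n → ℂ) (V : Opens (RR n)) (t : ℝ) : Prop :=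
  ∀ x₀ ∈ V, ∃ r > 0, RegOn F (Metric.ball x₀ r) t

lemma IsMul.of_abs {a : RR n → ℂ} {κ ρ m : ℝ} (h : IsMul a |κ| ρ m) : IsMul a κ ρ m := by
  rcases abs_cases κ with ⟨e, -⟩ | ⟨e, -⟩
  · rwa [e] at h
  · rw [e] at h; simpa using h.neg

lemma RegOn.subset {m : ℕ} {F : Fin m → RR n → ℂ} {B B' : Set (RR n)} {t : ℝ} (h : RegOn F B t)
    (hB : B' ⊆ B) : RegOn F B' t := fun φ hc hφ => h φ hc (hφ.trans hB)

/-- At a suitable point near `x₀` the coefficients can be frozen: they oscillate little near `x₀`,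
and the frozen system is strongly elliptic. -/
lemma exists_freeze {m : ℕ} {V : Opens (RR n)} {k : ℕ} {θ : ℝ} (hk : 0 < k + θ)
    {a : Fin n → Fin n → Fin m → Fin m → RR n → ℂ}
    (ha : ∀ i j p q, MemWkInfty k θ (a i j p q)) {P : RR n → Prop}
    (hP : ∀ᵐ x ∂(volume.restrict (V : Set (RR n))), P x) {δ : ℝ} (hδ : 0 < δ) {x₀ : RR n}
    (hx₀ : x₀ ∈ V) {r : ℝ} (hr : 0 < r) :
    ∃ R : ℝ, 0 < R ∧ R < r ∧ Metric.ball x₀ R ⊆ V ∧ ∃ z ∈ V, P z ∧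
      ∀ i j p q, ∀ᵐ y : RR n, y ∈ Metric.ball x₀ R → ‖a i j p q y - a i j p q z‖ ≤ δ := by
  obtain ⟨r', hr', hV⟩ := Metric.isOpen_iff.1 V.isOpen x₀ hx₀
  have h1 : ∀ᶠ R in 𝓝[>] (0 : ℝ), ∀ i j p q, ∀ᵐ x : RR n, x ∈ Metric.ball x₀ R →
      ∀ᵐ y : RR n, y ∈ Metric.ball x₀ R → ‖a i j p q y - a i j p q x‖ ≤ δ :=
    eventually_all.2 fun i => eventually_all.2 fun j => eventually_all.2 fun p =>
      eventually_all.2 fun q => (ha i j p q).eventually_osc_le hk hδ x₀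
  have h2 : ∀ᶠ R in 𝓝[>] (0 : ℝ), R < min r r' :=
    nhdsWithin_le_nhds (eventually_lt_nhds (lt_min hr hr'))
  obtain ⟨R, ⟨hR1, hR2⟩, hR0⟩ := ((h1.and h2).and self_mem_nhdsWithin).exists
  have hR0 : 0 < R := hR0
  have hball : Metric.ball x₀ R ⊆ V :=
    (Metric.ball_subset_ball (hR2.le.trans (min_le_right _ _))).trans hV
  rw [ae_restrict_iff' V.isOpen.measurableSet] at hP
  have h3 : ∀ᵐ x : RR n, (x ∈ (V : Set (RR n)) → P x) ∧ ∀ i j p q, x ∈ Metric.ball x₀ R →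
      ∀ᵐ y : RR n, y ∈ Metric.ball x₀ R → ‖a i j p q y - a i j p q x‖ ≤ δ :=
    hP.and (eventually_all.2 fun i => eventually_all.2 fun j => eventually_all.2 fun p =>
      eventually_all.2 fun q => hR1 i j p q)
  -- The point x₀ itself may lie in the exceptional null sets, so the coefficients are frozen at a
  -- nearby point of the dense set of good ones.
  obtain ⟨z, hzb, hz1, hz2⟩ := (Measure.dense_of_ae h3).inter_open_nonempty (Metric.ball x₀ R)
    Metric.isOpen_ball ⟨x₀, Metric.mem_ball_self hR0⟩
  exact ⟨R, hR0, hR2.trans_le (min_le_left _ _), hball, z, hball hzb, hz1 (hball hzb),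
    fun i j p q => hz2 i j p q hzb⟩

lemma norm_mul_theta_le {m : ℕ} {P θ : Matrix (Fin m) (Fin m) ℂ} {D M : ℝ} (hD : 0 ≤ D)
    (hP : ∀ k l, ‖P k l‖ ≤ D) (hθ : ∀ k l, ‖θ k l‖ ≤ M) (p k : Fin m) :
    ‖(P * θ) p k‖ ≤ m * M * D := by
  rw [Matrix.mul_apply]
  refine (norm_sum_le _ _).trans ?_
  calc _ ≤ ∑ _s : Fin m, D * M := Finset.sum_le_sum fun s _ => by
        rw [norm_mul]
        exact mul_le_mul (hP _ _) (hθ _ _) (norm_nonneg _) hD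
    _ = _ := by simp; ring

/-- The gain of regularity in one step. -/
theorem Sys.Good.step {m : ℕ} {X : Sys n m} {V : Opens (RR n)} {σ₁ σ₂ τ τ' : ℝ}
    (hX : X.Good V σ₁ σ₂) {k : ℕ} {θ : ℝ} (h0 : 0 ≤ θ) (h1 : θ ≤ 1) (hk : 0 < k + θ)
    (hα : X.α ≤ k ∨ X.α < k + θ) (ha : ∀ i j p q, MemWkInfty k θ (X.a i j p q))
    (hell : StronglyElliptic V (fun i j x => Matrix.of fun p q => X.a i j p q x))
    (t1 : σ₁ ≤ τ) (t2 : τ ≤ τ') (t3 : τ' ≤ τ + 1) (t4 : τ' ≤ σ₂)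
    (hR : LocReg X.F V (τ + 1)) : LocReg X.F V (τ' + 1) := by
  intro x₀ hx₀
  obtain ⟨r, hr, hreg⟩ := hR x₀ hx₀
  obtain ⟨Θ, ⟨M, hM⟩, C, hC, hell⟩ := hell
  have hτα : |τ| ≤ X.α := abs_le.2 ⟨hX.α₁.trans t1, (t2.trans t4).trans hX.α₂⟩
  have hτα' : |τ'| ≤ X.α := abs_le.2 ⟨hX.α₁.trans (t1.trans t2), t4.trans hX.α₂⟩
  obtain ⟨C₁, hC₁, hI₁⟩ := exists_eventually_isMul (n := n) (abs_nonneg τ) h0 h1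
  obtain ⟨C₂, hC₂, hI₂⟩ := exists_eventually_isMul (n := n) (abs_nonneg τ') h0 h1
  set D := 1 + 1 / (4 * Real.pi ^ 2 * C) with hD
  have hD0 : 0 ≤ D := by positivity
  -- Bounds the symbol of ∂_q P θ(z) ∂_i, of order zero since the two derivatives balance the order
  -- -2 of P.
  set B := (2 * Real.pi) ^ 2 * (m * |M| * D) with hB
  have hB0 : 0 ≤ B := by positivity
  set J := Fin n × Fin n × Fin m × Fin m with hJ
  set μ := 1 / (2 * (Fintype.card J * B + 1)) with hμ
  have hμ0 : 0 < μ := by positivity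
  have hsmall : Fintype.card J * (B * μ) ≤ 1 / 2 := by
    rw [hμ, ← mul_assoc, mul_one_div, div_le_div_iff₀ (by positivity) two_pos]
    nlinarith [show 0 ≤ (Fintype.card J : ℝ) * B by positivity]
  -- The admissible multiplier norm μ is split: oscillation δ uses at most half of it after
  -- multiplication by C₁ or C₂, and the error of the small-scale estimate uses the other half. The
  -- constants C₁, C₂ do not depend on the coefficients, so δ can be fixed before the ball is
  -- chosen.
  set δ := μ / (2 * (C₁ + C₂ + 1)) with hδ
  have hδ0 : 0 < δ := by positivity
  have hCδ : ∀ c, 0 ≤ c → c ≤ C₁ + C₂ → c * δ + μ / 2 ≤ μ := by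
    intro c hc0 hc
    have : c * δ ≤ μ / 2 := by
      rw [hδ, ← mul_div_assoc, div_le_div_iff₀ (by positivity) two_pos]
      nlinarith
    linarith
  obtain ⟨R, hR0, hRr, hRV, z, hzV, hz, hosc⟩ := exists_freeze hk ha hell hδ0 hx₀ hr
  set a₀ : Fin n → Fin n → Matrix (Fin m) (Fin m) ℂ :=
    fun i j => Matrix.of fun p q => X.a i j p q z with ha₀
  obtain ⟨P, hPc, hPinv, hPb⟩ := exists_frozenSymbol_inv hC hz
  have hMz : ∀ k l, ‖Θ z k l‖ ≤ |M| := fun k l => (hM z hzV k l).trans (le_abs_self M)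
  set χ := cutoff x₀ hR0 with hχ
  have hã : ∀ i j p q, MemWkInfty k θ (fun x => X.a i j p q x + -(a₀ i j p q)) := fun i j p q =>
    (ha i j p q).add (memWkInfty_const _)
  have hχa : ∀ i j p q, MemWkInfty k θ (fun x => χ x * (X.a i j p q x + -(a₀ i j p q))) :=
    fun i j p q => (hã i j p q).schwartz_mul h0 h1 χ
  have hχδ : ∀ i j p q, ∀ᵐ x : RR n, ‖χ x * (X.a i j p q x + -(a₀ i j p q))‖ ≤ δ := by
    intro i j p q
    filter_upwards [hosc i j p q] with x hx
    by_cases hxb : x ∈ Metric.ball x₀ R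
    · rw [norm_mul]
      have := mul_le_mul (norm_cutoff_le (x₀ := x₀) hR0 x) (hx hxb) (norm_nonneg _) zero_le_one
      rwa [one_mul] at this
    · rw [hχ, cutoff_eq_zero hR0 hxb, zero_mul, norm_zero]
      exact hδ0.le
  have hev : ∀ᶠ ρ in 𝓝[>] (0 : ℝ), ∀ i j p q,
      IsMul (fun x => χ x * (X.a i j p q x + -(a₀ i j p q))) |τ| ρ (C₁ * δ + μ / 2) ∧
      IsMul (fun x => χ x * (X.a i j p q x + -(a₀ i j p q))) |τ'| ρ (C₂ * δ + μ / 2) :=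
    eventually_all.2 fun i => eventually_all.2 fun j => eventually_all.2 fun p =>
      eventually_all.2 fun q =>
        (hI₁ k _ δ (μ / 2) (hα.imp hτα.trans hτα.trans_lt) (hχa i j p q) hδ0.le (hχδ i j p q)
          (half_pos hμ0)).and
        (hI₂ k _ δ (μ / 2) (hα.imp hτα'.trans hτα'.trans_lt) (hχa i j p q) hδ0.le (hχδ i j p q)
          (half_pos hμ0))
  -- A single scale serves both orders and all coefficients. The estimates are for |τ| and |τ'|
  -- because the small-scale theorem covers nonnegative orders only.
  obtain ⟨ρ, hρ, hρ0⟩ := (hev.and self_mem_nhdsWithin).exists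
  have hρ0 : 0 < ρ := hρ0
  have hm1 : ∀ i j p q, IsMul (fun x => χ x * (X.a i j p q x + -(a₀ i j p q))) τ ρ μ :=
    fun i j p q => (hρ i j p q).1.of_abs.mono (hCδ C₁ hC₁ (by linarith))
  have hm2 : ∀ i j p q, IsMul (fun x => χ x * (X.a i j p q x + -(a₀ i j p q))) τ' ρ μ :=
    fun i j p q => (hρ i j p q).2.of_abs.mono (hCδ C₂ hC₂ (by linarith))
  refine ⟨R / 2, half_pos hR0, fun φ hφc hφ => ?_⟩
  have hreg' : RegOn X.F (Metric.ball x₀ (R / 2)) (τ + 1) :=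
    hreg.subset (Metric.ball_subset_ball (by linarith))
  choose w hw hφw using hreg' φ hφc hφ
  have hBV : Metric.ball x₀ (R / 2) ⊆ (V : Set (RR n)) :=
    (Metric.ball_subset_ball (by linarith)).trans hRV
  choose g hg hgk using fun p =>
    hX.localize hBV t1 t3 t4 hreg' hφc hφ hw hφw p
  have hdw : ∀ j l, MemW τ (fun ξ => dsym j ξ * w l ξ) := fun j l => by
    simpa using (hw l).dsym_mul j
  choose H hH _ hHa using fun i j p q =>
    (hm1 i j p q).exists_mul (hχa i j p q).memLp hρ0 hμ0.le (hdw j q)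
  have hfe := fun p => frozen_equation hτα
    (fun i j p q => (hã i j p q).mulUpTo h0 h1 hα) hw
    (fun j l => isProd_cutoff_dsym hR0 hφ (hφw l) j) hH hHa
    ((hg p).mono (by linarith)) (hgk p)
  have hdP : ∀ ξ k l, ‖P ξ k l‖ ≤ D * wt 1 (-2) ξ := hPb
  have hPΘ : ∀ ξ p k, ‖(P ξ * Θ z) p k‖ ≤ m * |M| * (D * wt 1 (-2) ξ) := fun ξ p k =>
    norm_mul_theta_le (mul_nonneg hD0 (wt_pos _ _ _).le) (hdP ξ) hMz p k
  have hPΘc : ∀ p k, Continuous fun ξ => (P ξ * Θ z) p k := fun p k => by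
    simp only [Matrix.mul_apply]
    exact continuous_finsetSum _ fun s _ => (hPc p s).mul continuous_const
  have w21 : ∀ ξ : RR n, wt 1 1 ξ * wt 1 (-2) ξ = wt 1 (-1) ξ := fun ξ => by
    rw [← wt_add]; norm_num
  have w22 : ∀ ξ : RR n, wt 1 1 ξ * wt 1 1 ξ * wt 1 (-2) ξ = 1 := fun ξ => by
    rw [← wt_add, ← wt_add]; norm_num
  have hpi := Real.pi_pos
  have hwp := fun κ (ξ : RR n) => (wt_pos 1 κ ξ).le
  have hG1 : ∀ q p s, MemW τ' (fun ξ => dsym q ξ * P ξ p s * w s ξ) := fun q p s => by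
    refine ((hw s).mono t3).bounded_mul (B := 2 * Real.pi * D)
      ((continuous_dsym q).mul (hPc p s)).aestronglyMeasurable fun ξ => ?_
    rw [norm_mul]
    calc _ ≤ (2 * Real.pi * wt 1 1 ξ) * (D * wt 1 (-2) ξ) :=
          mul_le_mul (norm_dsym_le q ξ) (hdP ξ p s) (norm_nonneg _)
            (mul_nonneg (by positivity) (hwp _ _))
      _ = 2 * Real.pi * D * wt 1 (-1) ξ := by rw [← w21]; ring
      _ ≤ 2 * Real.pi * D * 1 := by
          gcongr; exact wt_le_one 1 (by norm_num) ξ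
      _ = _ := mul_one _
  have hG2 : ∀ q p s, MemW τ' (fun ξ => dsym q ξ * (P ξ * Θ z) p s * g s ξ) := fun q p s => by
    refine (hg s).symbol (C := 2 * Real.pi * (m * |M| * D))
      ((continuous_dsym q).mul (hPΘc p s)).aestronglyMeasurable fun ξ => ?_
    rw [norm_mul, show τ' - 1 - τ' = -1 by ring]
    calc _ ≤ (2 * Real.pi * wt 1 1 ξ) * (m * |M| * (D * wt 1 (-2) ξ)) :=
          mul_le_mul (norm_dsym_le q ξ) (hPΘ ξ p s) (norm_nonneg _)
            (mul_nonneg (by positivity) (hwp _ _))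
      _ = _ := by rw [← w21]; ring
  have hsum : ∀ f : J → ℂ, ∑ x, f x = ∑ i, ∑ j, ∑ k, ∑ l, f (i, j, k, l) := fun f => by
    change ∑ x : Fin n × Fin n × Fin m × Fin m, f x = _
    simp only [Fintype.sum_prod_type]
  -- The contraction is applied to the family of all first derivatives ∂_q(φu), not to φu: the
  -- perturbation involves only these, and for them the frozen solution operator is of order zero.
  have hdw' : ∀ pq : Fin m × Fin n, MemW τ' (fun ξ => dsym pq.2 ξ * w pq.1 ξ) := by
    refine memW_of_contraction (I := Fin m × Fin n) (J := J) hρ0 hμ0.le hB0 t2 hsmall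
      (G := fun pq ξ => (∑ s, dsym pq.2 ξ * P ξ pq.1 s * w s ξ) +
        ∑ s, dsym pq.2 ξ * (P ξ * Θ z) pq.1 s * g s ξ)
      (K := fun pq j ξ => dsym pq.2 ξ * (P ξ * Θ z) pq.1 j.2.2.1 * dsym j.1 ξ)
      (r := fun j => (j.2.2.2, j.2.1))
      (a := fun j x => χ x * (X.a j.1 j.2.1 j.2.2.1 j.2.2.2 x + -(a₀ j.1 j.2.1 j.2.2.1 j.2.2.2)))
      (H := fun j => H j.1 j.2.1 j.2.2.1 j.2.2.2)
      (fun pq => hdw _ _) (fun pq => (MemW.sum _ fun s _ => hG1 _ _ s).add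
        (MemW.sum _ fun s _ => hG2 _ _ s)) (fun j => hH _ _ _ _)
      (fun pq j => (((continuous_dsym _).mul (hPΘc _ _)).mul (continuous_dsym _)).aestronglyMeasurable)
      (fun pq j ξ => ?_) (fun j => (hχa _ _ _ _).memLp) (fun j => hm1 _ _ _ _) (fun j => hm2 _ _ _ _)
      (fun j ψ => hHa _ _ _ _ ψ) (fun pq => ?_)
    · rw [norm_mul, norm_mul]
      calc _ ≤ (2 * Real.pi * wt 1 1 ξ) * (m * |M| * (D * wt 1 (-2) ξ)) * (2 * Real.pi * wt 1 1 ξ) := by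
            have i1 := norm_dsym_le pq.2 ξ
            have i2 := norm_dsym_le j.1 ξ
            have i3 := hPΘ ξ pq.1 j.2.2.1
            have i4 : 0 ≤ 2 * Real.pi * wt 1 1 ξ := mul_nonneg (by positivity) (hwp _ _)
            exact mul_le_mul (mul_le_mul i1 i3 (norm_nonneg _) i4) i2 (norm_nonneg _)
              (mul_nonneg i4 ((norm_nonneg _).trans i3))
        _ = B * (wt 1 1 ξ * wt 1 1 ξ * wt 1 (-2) ξ) := by rw [hB]; ring
        _ = B := by rw [w22, mul_one]
    · filter_upwards [eventually_all.2 hfe] with ξ hξ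
      have := frozen_solve (hPinv ξ) (w := fun l => w l ξ) (g := fun k => g k ξ)
        (h := fun k => ∑ i, ∑ j, ∑ l, dsym i ξ * H i j k l ξ) hξ pq.1
      rw [this]
      simp only [hsum, mul_add, Finset.sum_add_distrib, Finset.mul_sum, mul_assoc,
        add_assoc]
      congr 2
      rw [Finset.sum_comm]
      refine Finset.sum_congr rfl fun i _ => ?_
      rw [Finset.sum_comm]
  exact fun l => ⟨w l, memW_add_one ((hw l).mono t3) fun q => hdw' (l, q), hφw l⟩

/-- Local regularity of the solution. -/
theorem Sys.Good.locReg {m : ℕ} {X : Sys n m} {V : Opens (RR n)} {σ₁ σ₂ : ℝ} (hσ : σ₁ ≤ σ₂)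
    (hX : X.Good V σ₁ σ₂) {k : ℕ} {θ : ℝ} (h0 : 0 ≤ θ) (h1 : θ ≤ 1) (hk : 0 < k + θ)
    (hα : X.α ≤ k ∨ X.α < k + θ) (ha : ∀ i j p q, MemWkInfty k θ (X.a i j p q))
    (hell : StronglyElliptic V (fun i j x => Matrix.of fun p q => X.a i j p q x)) :
    LocReg X.F V (σ₂ + 1) := by
  -- Each step gains one order until σ₂ caps the gain; the last step may be fractional.
  have key : ∀ N : ℕ, LocReg X.F V (min (σ₁ + N) σ₂ + 1) := by
    intro N
    induction N with
    | zero =>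
      intro x₀ _
      refine ⟨1, one_pos, fun φ _ _ l => ?_⟩
      obtain ⟨F', hF', hP⟩ := exists_isProd φ (hX.hF l)
      exact ⟨F', hF'.mono (by simp), hP⟩
    | succ N ih =>
      refine hX.step h0 h1 hk hα ha hell ?_ ?_ ?_ (min_le_right _ _) ih
      · exact le_min (by linarith [Nat.cast_nonneg (α := ℝ) N]) hσ
      · push_cast
        exact min_le_min_right _ (by linarith)
      · push_cast
        rcases min_cases (σ₁ + N) σ₂ with ⟨e, -⟩ | ⟨e, -⟩
        · rw [e]; exact (min_le_left _ _).trans (by linarith)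
        · rw [e]; exact (min_le_right _ _).trans (by linarith)
  obtain ⟨N, hN⟩ := exists_nat_ge (σ₂ - σ₁)
  have := key N
  rwa [min_eq_right (by linarith)] at this

/-! ### Sobolev spaces and the Sobolev duality on the frequency side -/

lemma besselPotential_lp (κ : ℝ) (b : Lp ℂ 2 (volume : Measure (RR n))) (ψ : 𝓢(RR n, ℂ)) :
    besselPotential (RR n) ℂ κ (b : 𝓢'(RR n, ℂ)) ψ =
      act (fun ξ => (wt 1 κ ξ : ℂ) * (𝓕 b : Lp ℂ 2 (volume : Measure (RR n))) ξ) ψ := by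
  have hg : (fun x : RR n => ((((1 + ‖x‖ ^ 2) ^ (κ / 2) : ℝ)) : ℂ)) = fun x => ((wt 1 κ x : ℝ) : ℂ) := by
    ext x; simp [wt]
  rw [besselPotential, TemperedDistribution.fourierMultiplierCLM_apply_apply,
    ← TemperedDistribution.fourier_apply, Lp.fourier_toTemperedDistribution_eq,
    Lp.toTemperedDistribution_apply, act, hg]
  congr 1
  ext ξ
  rw [SchwartzMap.smulLeftCLM_apply_apply (hasTemperateGrowth_wtC _ _), smul_eq_mul, smul_eq_mul]
  ring

lemma memW_wt_mul (κ : ℝ) {F : RR n → ℂ} (hF : MemLp F 2 (volume : Measure (RR n))) :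
    MemW (-κ) (fun ξ => (wt 1 κ ξ : ℂ) * F ξ) := by
  refine (memLp_congr_ae (Eventually.of_forall fun ξ => ?_)).1 hF
  simp only
  rw [← mul_assoc]
  norm_cast
  rw [wt_neg_mul]; simp

lemma exists_memSobolev {κ : ℝ} {F : RR n → ℂ} (hF : MemW κ F) :
    ∃ U : 𝓢'(RR n, ℂ), MemSobolev κ 2 U ∧ ∀ ψ, U ψ = act F ψ := by
  set b : Lp ℂ 2 (volume : Measure (RR n)) := 𝓕⁻ (MemLp.toLp _ hF)
  refine ⟨besselPotential (RR n) ℂ (-κ) (b : 𝓢'(RR n, ℂ)), ?_, fun ψ => ?_⟩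
  · rw [memSobolev_besselPotential_iff, neg_add_cancel, memSobolev_zero_iff]
    exact ⟨b, rfl⟩
  · rw [besselPotential_lp, act, act]
    refine integral_congr_ae ?_
    have hb : (𝓕 b : Lp ℂ 2 (volume : Measure (RR n))) = MemLp.toLp _ hF :=
      FourierTransform.fourier_fourierInv_eq _
    rw [hb]
    filter_upwards [MemLp.coeFn_toLp hF] with ξ hξ
    rw [hξ, ← mul_assoc]
    norm_cast
    rw [wt_neg_mul]; simp

lemma besselL2_spec {s : ℝ} {U : 𝓢'(RR n, ℂ)} (hU : MemSobolev s 2 U) :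
    besselPotential (RR n) ℂ s U = (besselL2 s U : 𝓢'(RR n, ℂ)) := by
  rw [besselL2, dif_pos hU]; exact hU.choose_spec

/-- The frequency function of an element of a Sobolev space. -/
def freq (s : ℝ) (U : 𝓢'(RR n, ℂ)) : RR n → ℂ :=
  fun ξ => (wt 1 (-s) ξ : ℂ) * (𝓕 (besselL2 s U) : Lp ℂ 2 (volume : Measure (RR n))) ξ

lemma memW_freq (s : ℝ) (U : 𝓢'(RR n, ℂ)) : MemW s (freq s U) := by
  have := memW_wt_mul (-s) (Lp.memLp (𝓕 (besselL2 s U) : Lp ℂ 2 (volume : Measure (RR n))))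
  rwa [neg_neg] at this

lemma apply_eq_act_freq {s : ℝ} {U : 𝓢'(RR n, ℂ)} (hU : MemSobolev s 2 U) (ψ : 𝓢(RR n, ℂ)) :
    U ψ = act (freq s U) ψ := by
  refine Eq.trans ?_ (besselPotential_lp (-s) (besselL2 s U) ψ)
  rw [← besselL2_spec hU]
  simp

/-- `sobolevDual` treats its arguments asymmetrically, by 𝓕⁻ and 𝓕, whereas `freq` uses 𝓕
throughout; this reflection reconciles the two. -/
lemma fourier_ae_eq_fourierInv_neg (b : Lp ℂ 2 (volume : Measure (RR n))) :
    ((𝓕 b : Lp ℂ 2 (volume : Measure (RR n))) : RR n → ℂ) =ᵐ[volume]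
      fun ξ => (𝓕⁻ b : Lp ℂ 2 (volume : Measure (RR n))) (-ξ) := by
  have hb : MemLp (b : RR n → ℂ) 2 volume := Lp.memLp b
  have hf : fiL (b : RR n → ℂ) = ((𝓕⁻ b : Lp ℂ 2 (volume : Measure (RR n))) : RR n → ℂ) := by
    rw [fiL_of_memLp hb, Lp.toLp_coeFn]
  rw [← hf]
  refine act_ext (κ := 0) (memW_zero_iff.2 (Lp.memLp _)) (memW_zero_iff.2 (memLp_fiL hb)).comp_neg
    fun ψ => ?_
  rw [← integral_mul_eq_act hb]
  have h1 := congrArg (fun T : 𝓢'(RR n, ℂ) => T (𝓕⁻ ψ))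
    (Lp.fourier_toTemperedDistribution_eq (E := RR n) (F := ℂ) b)
  simp only [TemperedDistribution.fourier_apply, FourierTransform.fourier_fourierInv_eq,
    Lp.toTemperedDistribution_apply, smul_eq_mul] at h1
  rw [act]
  simp only [mul_comm] at h1 ⊢
  exact h1.symm

lemma ofFun_apply {g : RR n → ℂ} (hg : MemLp g 2 (volume : Measure (RR n))) (ψ : 𝓢(RR n, ℂ)) :
    ofFun g ψ = act (fun ξ => fiL g (-ξ)) ψ := by
  rw [← integral_mul_eq_act hg, ofFun, dif_pos hg, Lp.toTemperedDistribution_apply]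
  refine integral_congr_ae ?_
  filter_upwards [hg.coeFn_toLp] with x hx
  rw [hx, smul_eq_mul, mul_comm]

/-- The Bessel weights of order s and -s cancel, and the substitution ξ ↦ -ξ turns the duality into
`pair`. The frequency function F is arbitrary, which allows dsym·F for derivatives. -/
lemma sobolevDual_ofFun {s : ℝ} {U : 𝓢'(RR n, ℂ)} (hU : MemSobolev s 2 U) {F g : RR n → ℂ}
    (hF : MemW s F) (hUF : ∀ ψ, U ψ = act F ψ) (hg : HasOrd (-s) g) :
    sobolevDual s U (ofFun g) = pair F g := by
  have hV : MemSobolev (-s) 2 (ofFun g) := by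
    obtain ⟨V, hV, e⟩ := exists_memSobolev hg.2.comp_neg
    convert hV using 1
    ext ψ
    rw [ofFun_apply hg.1, e]
  have h1 : freq s U =ᵐ[volume] F :=
    act_ext (memW_freq s U) hF fun ψ => by rw [← apply_eq_act_freq hU, hUF]
  have h2 : freq (-s) (ofFun g) =ᵐ[volume] fun ξ => fiL g (-ξ) :=
    act_ext (memW_freq (-s) _) hg.2.comp_neg fun ψ => by
      rw [← apply_eq_act_freq hV, ofFun_apply hg.1]
  have h3 := fourier_ae_eq_fourierInv_neg (besselL2 s U)
  have n1 := measurePreserving_neg' (n := n)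
  have h2' := n1.quasiMeasurePreserving.ae h2
  rw [sobolevDual, pair, ← integral_neg_eq_self]
  refine integral_congr_ae ?_
  filter_upwards [h1, h2', h3] with ξ e1 e2 e3
  rw [← e3]
  simp only [freq, neg_neg, wt_neg_arg] at e1 e2
  rw [← e1, ← e2]
  have : (wt 1 (-s) ξ : ℂ) * wt 1 s ξ = 1 := by
    norm_cast; exact wt_neg_mul _ _ _
  linear_combination (-(𝓕 (besselL2 s U) : Lp ℂ 2 (volume : Measure (RR n))) ξ *
    (𝓕 (besselL2 (-s) (ofFun g)) : Lp ℂ 2 (volume : Measure (RR n))) (-ξ)) * this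

lemma lineDeriv_apply_eq_act {U : 𝓢'(RR n, ℂ)} {F : RR n → ℂ} (hUF : ∀ ψ, U ψ = act F ψ)
    (j : Fin n) (ψ : 𝓢(RR n, ℂ)) : (∂_{dir j} U) ψ = act (fun ξ => dsym j ξ * F ξ) ψ := by
  rw [TemperedDistribution.lineDerivOp_apply_apply, act_dsym_mul, map_neg, hUF]

lemma sobolevDual_lineDeriv_ofFun {s : ℝ} {U : 𝓢'(RR n, ℂ)} (hU : MemSobolev s 2 U)
    {F g : RR n → ℂ} (hF : MemW s F) (hUF : ∀ ψ, U ψ = act F ψ) (j : Fin n)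
    (hg : HasOrd (1 - s) g) :
    sobolevDual (s - 1) (∂_{dir j} U) (ofFun g) = pair (fun ξ => dsym j ξ * F ξ) g :=
  sobolevDual_ofFun hU.lineDerivOp (hF.dsym_mul j) (lineDeriv_apply_eq_act hUF j)
    (by rwa [neg_sub])

/-! ### Extending the coefficients from a relatively compact open set -/

lemma MemWkInfty.mono_exponent {k : ℕ} {θ θ' : ℝ} (h0 : 0 ≤ θ') (h1 : θ' ≤ θ) {g : RR n → ℂ}
    (hg : MemWkInfty k θ g) : MemWkInfty k θ' g := by
  induction k generalizing g with
  | zero =>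
    obtain ⟨C, hC⟩ := hg.2
    obtain ⟨S, hS0, hS⟩ := exists_ae_bound hg.1
    refine ⟨hg.1, 2 * S + |C|, ?_⟩
    filter_upwards [hC, ae_prod_of_ae hS] with z hz hz'
    have t0 := norm_nonneg (z.1 - z.2)
    have p0 := Real.rpow_nonneg t0 θ'
    rcases le_total ‖z.1 - z.2‖ 1 with h | h
    · have := Real.rpow_le_rpow_of_exponent_ge' t0 h h0 h1
      have h2 : C * ‖z.1 - z.2‖ ^ θ ≤ |C| * ‖z.1 - z.2‖ ^ θ' :=
        mul_le_mul (le_abs_self C) this (Real.rpow_nonneg t0 θ) (abs_nonneg C)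
      nlinarith
    · have := Real.one_le_rpow h h0
      have h2 := norm_sub_le (g z.1) (g z.2)
      nlinarith [hz'.1, hz'.2, abs_nonneg C]
  | succ k ih =>
    refine ⟨hg.1, fun i => ?_⟩
    obtain ⟨h, hw, hm⟩ := hg.2 i
    exact ⟨h, hw, ih hm⟩

lemma MemWkInfty.down_add {k : ℕ} (j : ℕ) {θ θ' : ℝ} (h0 : 0 ≤ θ) (h1 : θ ≤ 1) {g : RR n → ℂ}
    (hg : MemWkInfty (k + j + 1) θ' g) : MemWkInfty k θ g := by
  induction j generalizing θ' with
  | zero => exact hg.down h0 h1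
  | succ j ih => exact ih (θ' := θ) (hg.down h0 h1)

/-- All coefficients of a finite family get the same k and θ. For integer μ this is θ = 0. Otherwise
each member has its own exponent above μ, and every θ slightly larger than the fractional part of μ
works for all of them. -/
lemma exists_extension {Ω : Opens (RR n)} {μ : ℝ} (hμ : 0 ≤ μ) {ι : Type*} [Finite ι]
    {g : ι → RR n → ℂ} (hg : ∀ i, MemCbarPlus Ω μ (g i)) :
    ∃ (k : ℕ) (θ : ℝ) (G : ι → RR n → ℂ), 0 ≤ θ ∧ θ ≤ 1 ∧ (μ ≤ k ∨ μ < k + θ) ∧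
      ∀ i, MemWkInfty k θ (G i) ∧ ∀ᵐ x ∂(volume.restrict (Ω : Set (RR n))), g i x = G i x := by
  by_cases hk : ∃ k : ℕ, (k : ℝ) = μ
  · obtain ⟨k, rfl⟩ := hk
    have : ∀ i, MemCbar Ω k (g i) := fun i => ((hg i).resolve_right fun h => h.1 ⟨k, rfl⟩).2
    choose G hG e using this
    refine ⟨k, 0, G, le_rfl, zero_le_one, Or.inl le_rfl, fun i => ⟨?_, e i⟩⟩
    simpa [MemWInfty] using hG i
  · have : ∀ i, ∃ ν : ℝ, μ < ν ∧ MemCbar Ω ν (g i) := fun i =>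
      ((hg i).resolve_left fun h => hk h.1).2
    choose ν hν G hG e using this
    have ev : ∀ i, ∀ᶠ θ in 𝓝[>] (Int.fract μ), MemWkInfty ⌊μ⌋₊ θ (G i) := by
      intro i
      have hν0 : 0 ≤ ν i := hμ.trans (hν i).le
      rcases (Nat.floor_mono (hν i).le).eq_or_lt with h | h
      · have hlt : Int.fract μ < Int.fract (ν i) := by
          have e1 : μ - ⌊μ⌋₊ = Int.fract μ := by rw [natCast_floor_eq_intCast_floor hμ]; rfl
          have e2 : ν i - ⌊ν i⌋₊ = Int.fract (ν i) := by
            rw [natCast_floor_eq_intCast_floor hν0]; rfl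
          rw [← e1, ← e2, h]
          linarith [hν i]
        filter_upwards [Ioo_mem_nhdsGT hlt] with θ hθ
        have := hG i
        rw [MemWInfty, ← h] at this
        exact this.mono_exponent ((Int.fract_nonneg μ).trans hθ.1.le) hθ.2.le
      · filter_upwards [Ioo_mem_nhdsGT (Int.fract_lt_one μ)] with θ hθ
        obtain ⟨j, hj⟩ := Nat.exists_eq_add_of_lt h
        have := hG i
        rw [MemWInfty, hj] at this
        exact this.down_add j ((Int.fract_nonneg μ).trans hθ.1.le) hθ.2.le
    obtain ⟨θ, hθ, hθ'⟩ := ((eventually_all.2 ev).and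
      (Ioo_mem_nhdsGT (Int.fract_lt_one μ))).exists
    refine ⟨⌊μ⌋₊, θ, G, (Int.fract_nonneg μ).trans hθ'.1.le, hθ'.2.le, Or.inr ?_,
      fun i => ⟨hθ i, e i⟩⟩
    have e1 : μ - ⌊μ⌋₊ = Int.fract μ := by rw [natCast_floor_eq_intCast_floor hμ]; rfl
    linarith [hθ'.1]

lemma MemCbarPlus.max {Ω : Opens (RR n)} {μ μ' : ℝ} {g : RR n → ℂ} (h : MemCbarPlus Ω μ g)
    (h' : MemCbarPlus Ω μ' g) : MemCbarPlus Ω (max μ μ') g := by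
  rcases max_choice μ μ' with e | e <;> rwa [e]

/-! ### The local system -/

lemma tsupport_testToSchwartz {Ω : Opens (RR n)} (φ : 𝓓(Ω, ℝ)) :
    tsupport (testToSchwartz φ : RR n → ℂ) = tsupport φ := by
  have : Function.support (testToSchwartz φ : RR n → ℂ) = Function.support φ := by
    ext x
    change ((φ x : ℝ) : ℂ) ≠ 0 ↔ φ x ≠ 0
    exact_mod_cast Iff.rfl
  rw [tsupport, tsupport, this]

lemma mul_ae_eq_of_ae_restrict {V : Opens (RR n)} {g G : RR n → ℂ}
    (e : ∀ᵐ x ∂(volume.restrict (V : Set (RR n))), g x = G x) {χ : RR n → ℂ}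
    (hχ : tsupport χ ⊆ V) :
    (fun x => g x * χ x) =ᵐ[volume] fun x => G x * χ x := by
  rw [ae_restrict_iff' V.isOpen.measurableSet] at e
  filter_upwards [e] with x hx
  by_cases h : x ∈ V
  · rw [hx h]
  · rw [image_eq_zero_of_notMem_tsupport fun h' => h (hχ h')]; simp

lemma HasOrd.congr {μ : ℝ} {h h' : RR n → ℂ} (hh : HasOrd μ h) (e : h =ᵐ[volume] h') :
    HasOrd μ h' := by
  rw [HasOrd, ← fiL_congr e]
  exact ⟨(memLp_congr_ae e).1 hh.1, hh.2⟩

lemma MemCbarPlus.hasOrd {V : Opens (RR n)} {γ : ℝ} (hγ : 0 ≤ γ) {g : RR n → ℂ}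
    (hg : MemCbarPlus V γ g) {χ : 𝓢(RR n, ℂ)} (hχ : tsupport (χ : RR n → ℂ) ⊆ V) :
    HasOrd γ (fun x => g x * χ x) := by
  obtain ⟨k, θ, G, h0, h1, h2, h⟩ := exists_extension hγ (ι := Unit) fun _ => hg
  exact (((h ()).1.mulUpTo h0 h1 h2).hasOrd hγ χ).congr (mul_ae_eq_of_ae_restrict (h ()).2 hχ).symm

lemma StronglyElliptic.congr {m : ℕ} {Ω V : Opens (RR n)} (hV : V ≤ Ω)
    {a a' : Fin n → Fin n → RR n → Matrix (Fin m) (Fin m) ℂ} (h : StronglyElliptic Ω a)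
    (e : ∀ i j k l, ∀ᵐ x ∂(volume.restrict (V : Set (RR n))), a i j x k l = a' i j x k l) :
    StronglyElliptic V a' := by
  obtain ⟨θ, ⟨M, hM⟩, C, hC, hE⟩ := h
  refine ⟨θ, ⟨M, fun x hx => hM x (hV hx)⟩, C, hC, ?_⟩
  have e' := ae_all_iff.2 fun i => ae_all_iff.2 fun j => ae_all_iff.2 fun k =>
    ae_all_iff.2 fun l => e i j k l
  filter_upwards [e', ae_restrict_of_ae_restrict_of_subset hV hE] with x hx hxE
  have : ∀ i j, a i j x = a' i j x := fun i j => by ext k l; exact hx i j k l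
  simpa only [this] using hxE

/-- The equations are given for real test functions; complex ones are recovered through real and
imaginary parts, which requires T to be linear, as `Reg` ensures. -/
lemma Reg.eq_zero_of_real {t : ℝ} {T : 𝓢(RR n, ℂ) → ℂ} (hT : Reg t T) {Ω V : Opens (RR n)}
    (hV : V ≤ Ω) (h : ∀ r : 𝓓(Ω, ℝ), tsupport r ⊆ V → T (testToSchwartz r) = 0)
    {ψ : 𝓢(RR n, ℂ)} (hc : HasCompactSupport ψ) (hψ : tsupport ψ ⊆ V) : T ψ = 0 := by
  obtain ⟨H, hH, e⟩ := hT
  have sub_re : tsupport (fun x => (ψ x).re) ⊆ tsupport ψ :=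
    closure_mono fun x hx h0 => hx (by simp [h0])
  have sub_im : tsupport (fun x => (ψ x).im) ⊆ tsupport ψ :=
    closure_mono fun x hx h0 => hx (by simp [h0])
  let p : 𝓓(Ω, ℝ) := ⟨fun x => (ψ x).re, Complex.reCLM.contDiff.comp (ψ.smooth _),
    hc.comp_left (g := Complex.re) rfl, sub_re.trans (hψ.trans hV)⟩
  let q : 𝓓(Ω, ℝ) := ⟨fun x => (ψ x).im, Complex.imCLM.contDiff.comp (ψ.smooth _),
    hc.comp_left (g := Complex.im) rfl, sub_im.trans (hψ.trans hV)⟩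
  have hp := h p (sub_re.trans hψ)
  have hq := h q (sub_im.trans hψ)
  have eψ : ψ = testToSchwartz p + Complex.I • testToSchwartz q := by
    ext x
    change ψ x = ((ψ x).re : ℂ) + Complex.I * ((ψ x).im : ℂ)
    rw [mul_comm]
    exact (Complex.re_add_im _).symm
  have hI : act H (Complex.I • testToSchwartz q) = Complex.I * act H (testToSchwartz q) := by
    rw [act, act, ← integral_const_mul]
    refine integral_congr_ae (Eventually.of_forall fun ξ => ?_)
    simp only [fourierInv_smul, smul_apply, smul_eq_mul]
    ring
  rw [e, eψ, act_add_right hH, hI, ← e, ← e, hp, hq]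
  simp

/-- The equation of the system `X`, tested with `ψ`. -/
def Sys.Eqn {m : ℕ} (X : Sys n m) (ψ : 𝓢(RR n, ℂ)) (k : Fin m) : Prop :=
  (∑ i : Fin n, ∑ j : Fin n, ∑ l, pair (fun ξ => dsym j ξ * X.F l ξ) (fun x => X.a i j k l x * (∂_{dir i} ψ) x)) +
  (∑ j : Fin n, ∑ l, pair (fun ξ => dsym j ξ * X.F l ξ) (fun x => X.b j k l x * ψ x)) +
  (∑ j : Fin n, ∑ l, pair (X.F l) (fun x => X.d j k l x * (∂_{dir j} ψ) x)) +
  ∑ l, pair (X.F l) (fun x => X.c k l x * ψ x) = act (X.Φ k) ψ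

theorem Sys.eqn_of_real {m : ℕ} {X : Sys n m} {σ₁ σ₂ : ℝ} (hσ : σ₁ ≤ σ₂) (hα : 0 ≤ X.α) (hβ : 0 ≤ X.β)
    (hδ : 0 ≤ X.δ) (hγ : 0 ≤ X.γ) (ha : ∀ i j k l, MulUpTo X.α (X.a i j k l))
    (hb : ∀ j k l, MulUpTo X.β (X.b j k l)) (hd : ∀ j k l, MulUpTo X.δ (X.d j k l))
    (hc : ∀ k l, MulUpTo X.γ (X.c k l)) (α₁ : -X.α ≤ σ₁) (β₁ : -X.β ≤ σ₁) (δ₁ : -X.δ ≤ σ₁ + 1)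
    (γ₁ : -X.γ ≤ σ₁ + 1) (hF : ∀ l, MemW (σ₁ + 1) (X.F l)) (hΦ : ∀ k, MemW (σ₂ - 1) (X.Φ k))
    {Ω V : Opens (RR n)} (hV : V ≤ Ω) {k : Fin m}
    (h : ∀ r : 𝓓(Ω, ℝ), tsupport r ⊆ V → X.Eqn (testToSchwartz r) k)
    {ψ : 𝓢(RR n, ℂ)} (hψc : HasCompactSupport ψ) (hψ : tsupport ψ ⊆ V) : X.Eqn ψ k := by
  -- An order low enough for each term to be a product within its multiplier range, whatever the
  -- sign of σ₁; it serves only to express the whole equation as one linear functional.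
  set t := min σ₁ 0
  have t1 : t ≤ σ₁ := min_le_left _ _
  have t2 : t ≤ 0 := min_le_right _ _
  have hdF : ∀ j l, MemW σ₁ (fun ξ => dsym j ξ * X.F l ξ) := fun j l => by
    simpa using (hF l).dsym_mul j
  have Ra : Reg (t - 1) (fun ψ : 𝓢(RR n, ℂ) => ∑ i : Fin n, ∑ j : Fin n, ∑ l,
      pair (fun ξ => dsym j ξ * X.F l ξ) (fun x => X.a i j k l x * (∂_{dir i} ψ) x)) :=
    Reg.sum _ fun i => Reg.sum _ fun j => Reg.sum _ fun l =>
      (reg_pair hα (ha i j k l) t1 α₁ (t2.trans hα) (hdF j l)).lineDeriv i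
  have Rb : Reg (t - 1) (fun ψ : 𝓢(RR n, ℂ) => ∑ j : Fin n, ∑ l,
      pair (fun ξ => dsym j ξ * X.F l ξ) (fun x => X.b j k l x * ψ x)) :=
    Reg.sum _ fun j => Reg.sum _ fun l =>
      reg_pair hβ (hb j k l) (by linarith) β₁ (by linarith) (hdF j l)
  have Rd : Reg (t - 1) (fun ψ : 𝓢(RR n, ℂ) => ∑ j : Fin n, ∑ l,
      pair (X.F l) (fun x => X.d j k l x * (∂_{dir j} ψ) x)) :=
    Reg.sum _ fun j => Reg.sum _ fun l =>
      (reg_pair hδ (hd j k l) (by linarith) δ₁ (by linarith) (hF l)).lineDeriv j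
  have Rc : Reg (t - 1) (fun ψ : 𝓢(RR n, ℂ) => ∑ l, pair (X.F l) (fun x => X.c k l x * ψ x)) :=
    Reg.sum _ fun l => reg_pair hγ (hc k l) (by linarith) γ₁ (by linarith) (hF l)
  have RΦ : Reg (t - 1) (fun ψ : 𝓢(RR n, ℂ) => act (X.Φ k) ψ) :=
    ⟨_, (hΦ k).mono (by linarith), fun _ => rfl⟩
  have R := (((Ra.add Rb).add Rd).add Rc).sub RΦ
  exact sub_eq_zero.1 (R.eq_zero_of_real hV (fun r hr => sub_eq_zero.2 (h r hr)) hψc hψ)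

/-- The coefficients are prescribed only on V, and pairings with test functions supported in V do
not see changes outside; so they are replaced by globally defined extensions, to which the
multiplier theory applies. -/
theorem Sys.exists_regOn {m : ℕ} (X : Sys n m) {σ₁ σ₂ : ℝ} (hσ : σ₁ < σ₂) (hα : X.α = max |σ₁| |σ₂|) (hβ : 0 ≤ X.β)
    (hδ : 0 ≤ X.δ) (hγ : 0 ≤ X.γ) {Ω V : Opens (RR n)} (hV : V ≤ Ω)
    (ha : ∀ i j k l, MemCbarPlus V X.α (X.a i j k l))
    (hb : ∀ j k l, MemCbarPlus V X.β (X.b j k l)) (hd : ∀ j k l, MemCbarPlus V X.δ (X.d j k l))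
    (hc : ∀ k l, MemCbarPlus V X.γ (X.c k l)) (β₁ : -X.β ≤ σ₁) (β₂ : σ₂ - 1 ≤ X.β)
    (δ₁ : -X.δ ≤ σ₁ + 1) (δ₂ : σ₂ ≤ X.δ) (γ₁ : -X.γ ≤ σ₁ + 1) (γ₂ : σ₂ - 1 ≤ X.γ)
    (hF : ∀ l, MemW (σ₁ + 1) (X.F l)) (hΦ : ∀ k, MemW (σ₂ - 1) (X.Φ k))
    (hell : StronglyElliptic V (fun i j x => Matrix.of fun p q => X.a i j p q x))
    (h : ∀ r : 𝓓(Ω, ℝ), tsupport r ⊆ V → ∀ k, X.Eqn (testToSchwartz r) k) :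
    LocReg X.F V (σ₂ + 1) := by
  -- If the maximum vanished, σ₁ and σ₂ would both be 0. Positivity is what makes the leading
  -- coefficients Hölder continuous.
  have hα0 : 0 < X.α := by
    rw [hα, lt_max_iff, abs_pos, abs_pos]
    by_contra! h0
    linarith
  obtain ⟨k, θ, a, h0, h1, h2, ea⟩ := exists_extension hα0.le (ι := Fin n × Fin n × Fin m × Fin m)
    (fun p => ha p.1 p.2.1 p.2.2.1 p.2.2.2)
  obtain ⟨kb, θb, b, hb0, hb1, hb2, eb⟩ := exists_extension hβ (ι := Fin n × Fin m × Fin m)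
    (fun p => hb p.1 p.2.1 p.2.2)
  obtain ⟨kd, θd, d, hd0, hd1, hd2, ed⟩ := exists_extension hδ (ι := Fin n × Fin m × Fin m)
    (fun p => hd p.1 p.2.1 p.2.2)
  obtain ⟨kc, θc, c, hc0, hc1, hc2, ec⟩ := exists_extension hγ (ι := Fin m × Fin m)
    (fun p => hc p.1 p.2)
  let Y : Sys n m := { X with
    a := fun i j p q => a (i, j, p, q)
    b := fun j p q => b (j, p, q)
    d := fun j p q => d (j, p, q)
    c := fun p q => c (p, q) }
  have Ya : ∀ i j p q, MulUpTo Y.α (Y.a i j p q) := fun i j p q => (ea (i, j, p, q)).1.mulUpTo h0 h1 h2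
  have Yb : ∀ j p q, MulUpTo Y.β (Y.b j p q) := fun j p q => (eb (j, p, q)).1.mulUpTo hb0 hb1 hb2
  have Yd : ∀ j p q, MulUpTo Y.δ (Y.d j p q) := fun j p q => (ed (j, p, q)).1.mulUpTo hd0 hd1 hd2
  have Yc : ∀ p q, MulUpTo Y.γ (Y.c p q) := fun p q => (ec (p, q)).1.mulUpTo hc0 hc1 hc2
  have α₁ : -X.α ≤ σ₁ := by
    have := neg_abs_le σ₁
    have := le_max_left |σ₁| |σ₂|
    linarith
  have α₂ : σ₂ ≤ X.α := by
    have := le_abs_self σ₂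
    have := le_max_right |σ₁| |σ₂|
    linarith
  have hY : ∀ r : 𝓓(Ω, ℝ), tsupport r ⊆ V → ∀ k, Y.Eqn (testToSchwartz r) k := by
    intro r hr k
    have hr' : tsupport (testToSchwartz r : RR n → ℂ) ⊆ V := by rwa [tsupport_testToSchwartz]
    have hr'' : ∀ i : Fin n, tsupport (∂_{dir i} (testToSchwartz r) : 𝓢(RR n, ℂ)) ⊆ V := fun i =>
      (SchwartzMap.tsupport_lineDerivOp_subset _ _).trans hr'
    have := h r hr k
    simp only [Sys.Eqn] at this ⊢
    rw [← this]
    congr 1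
    · congr 1
      · congr 1
        · refine Finset.sum_congr rfl fun i _ => Finset.sum_congr rfl fun j _ =>
            Finset.sum_congr rfl fun l _ => pair_congr_right
              (mul_ae_eq_of_ae_restrict (ea (i, j, k, l)).2 (hr'' i)).symm
        · refine Finset.sum_congr rfl fun j _ =>
            Finset.sum_congr rfl fun l _ => pair_congr_right
              (mul_ae_eq_of_ae_restrict (eb (j, k, l)).2 hr').symm
      · refine Finset.sum_congr rfl fun j _ =>
            Finset.sum_congr rfl fun l _ => pair_congr_right
              (mul_ae_eq_of_ae_restrict (ed (j, k, l)).2 (hr'' j)).symm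
    · refine Finset.sum_congr rfl fun l _ => pair_congr_right
              (mul_ae_eq_of_ae_restrict (ec (k, l)).2 hr').symm
  have good : Y.Good V σ₁ σ₂ :=
    { hα := hα0.le, hβ := hβ, hδ := hδ, hγ := hγ, ha := Ya, hb := Yb, hd := Yd, hc := Yc
      α₁ := α₁, α₂ := α₂, β₁ := β₁, β₂ := β₂, δ₁ := δ₁, δ₂ := δ₂, γ₁ := γ₁, γ₂ := γ₂
      hF := hF, hΦ := hΦ
      eq := fun ψ hψc hψ k => Sys.eqn_of_real (X := Y) hσ.le hα0.le hβ hδ hγ Ya Yb Yd Yc α₁ β₁ δ₁ γ₁ hF hΦ hV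
        (fun r hr => hY r hr k) hψc hψ }
  refine Sys.Good.locReg (X := Y) hσ.le good h0 h1 ?_ h2 (fun i j p q => (ea (i, j, p, q)).1)
    (hell.congr le_rfl fun i j p q => (ea (i, j, p, q)).2)
  rcases h2 with h2 | h2 <;> linarith

/-! ### Gluing -/

lemma testFunction_sum_apply {Ω : Opens (RR n)} {ι : Type*} (s : Finset ι) (f : ι → 𝓓(Ω, ℝ)) (x : RR n) :
    (∑ i ∈ s, f i) x = ∑ i ∈ s, f i x := by
  classical
  induction s using Finset.induction_on with
  | empty => simp
  | insert i s hi ih => rw [Finset.sum_insert hi, Finset.sum_insert hi, ← ih]; rfl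

lemma exists_partition {Ω : Opens (RR n)} (φ : 𝓓(Ω, ℝ)) (r : RR n → ℝ) (hr : ∀ x ∈ Ω, 0 < r x) :
    ∃ (t : Finset (RR n)) (f : t → 𝓓(Ω, ℝ)), (∀ i : t, (i : RR n) ∈ Ω) ∧
      (∀ i : t, tsupport (f i) ⊆ Metric.ball (i : RR n) (r i)) ∧ φ = ∑ i, f i := by
  obtain ⟨t, ht, hc⟩ := φ.hasCompactSupport.isCompact.elim_nhds_subcover
    (fun x => Metric.ball x (r x))
    (fun x hx => Metric.ball_mem_nhds x (hr x (φ.tsupport_subset hx)))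
  obtain ⟨ρ, hρ⟩ := SmoothPartitionOfUnity.exists_isSubordinate (modelWithCornersSelf ℝ (RR n))
    (isClosed_tsupport φ) (fun i : t => Metric.ball (i : RR n) (r i)) (fun _ => Metric.isOpen_ball)
    (fun x hx => by simpa using hc hx)
  let f : t → 𝓓(Ω, ℝ) := fun i => ⟨fun x => ρ i x * φ x,
    (ρ i).contMDiff.contDiff.mul φ.contDiff, φ.hasCompactSupport.mul_left,
    tsupport_mul_subset_right.trans φ.tsupport_subset⟩
  refine ⟨t, f, fun i => φ.tsupport_subset (ht i i.2), fun i => tsupport_mul_subset_left.trans (hρ i), ?_⟩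
  ext x
  rw [testFunction_sum_apply]
  change φ x = ∑ i, ρ i x * φ x
  by_cases hx : x ∈ tsupport φ
  · have := ρ.sum_eq_one hx
    rw [finsum_eq_sum_of_fintype] at this
    rw [← Finset.sum_mul, this, one_mul]
  · rw [image_eq_zero_of_notMem_tsupport hx]; simp

/-- A test function is split into pieces supported in the balls of local regularity; each product
with a piece is globally of order t, and the finite sum represents φg on Ω. -/
theorem memHsLoc_of_local {Ω : Opens (RR n)} {t : ℝ} {g : 𝓓'(Ω, ℂ)}
    (h : ∀ x₀ ∈ Ω, ∃ r > 0, ∃ F : RR n → ℂ,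
      (∀ ψ : 𝓓(Ω, ℝ), tsupport ψ ⊆ Metric.ball x₀ r → act F (testToSchwartz ψ) = g ψ) ∧
      ∀ φ : 𝓢(RR n, ℂ), HasCompactSupport φ → tsupport φ ⊆ Metric.ball x₀ r →
        ∃ F', MemW t F' ∧ IsProd φ F F') : MemHsLoc Ω t g := by
  intro φ
  choose! r hr F hF hP using h
  obtain ⟨s, f, hs, hf, rfl⟩ := exists_partition φ r hr
  have hc : ∀ i, HasCompactSupport (testToSchwartz (f i) : RR n → ℂ) := fun i =>
    (f i).hasCompactSupport.comp_left (g := fun r : ℝ => (r : ℂ)) Complex.ofReal_zero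
  choose G hG hGP using fun i : s => hP i (hs i) (testToSchwartz (f i)) (hc i)
    (by rw [tsupport_testToSchwartz]; exact hf i)
  obtain ⟨U, hU, e⟩ := exists_memSobolev (MemW.sum Finset.univ fun i _ => hG i)
  refine ⟨U, hU, fun ψ => ?_⟩
  have hm : testMul (∑ i, f i) ψ = ∑ i, testMul (f i) ψ := by
    ext x
    rw [testFunction_sum_apply]
    change (∑ i, f i) x * ψ x = ∑ i, f i x * ψ x
    rw [testFunction_sum_apply, Finset.sum_mul]
  rw [e, act_sum_left _ (fun i _ => hG i), hm, map_sum]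
  refine Finset.sum_congr rfl fun i _ => ?_
  rw [← hF i (hs i) _ ((tsupport_mul_subset_left (f := f i) (g := ψ)).trans (hf i)), ← hGP i]
  congr 1
  ext x
  rw [sm_apply]
  change ((f i x : ℝ) : ℂ) * ((ψ x : ℝ) : ℂ) = ((f i x * ψ x : ℝ) : ℂ)
  push_cast
  rfl

/-- The distribution is multiplied by a bump supported in the closed ball and equal to 1 on the
smaller ball, where it therefore is unchanged. -/
lemma exists_local_extension {Ω : Opens (RR n)} {s : ℝ} {g : 𝓓'(Ω, ℂ)} (hg : MemHsLoc Ω s g)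
    {x₀ : RR n} {R : ℝ} (hR : 0 < R) (hΩ : Metric.closedBall x₀ R ⊆ (Ω : Set (RR n))) :
    ∃ U : 𝓢'(RR n, ℂ), MemSobolev s 2 U ∧
      ∀ ψ : 𝓓(Ω, ℝ), tsupport ψ ⊆ Metric.ball x₀ (R / 2) → U (testToSchwartz ψ) = g ψ := by
  let f : ContDiffBump x₀ := ⟨R / 2, R, by positivity, by linarith⟩
  let η : 𝓓(Ω, ℝ) := ⟨f, f.contDiff, f.hasCompactSupport, by rw [f.tsupport_eq]; exact hΩ⟩
  obtain ⟨U, hU, e⟩ := hg η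
  refine ⟨U, hU, fun ψ hψ => ?_⟩
  rw [e]
  congr 1
  ext x
  change f x * ψ x = ψ x
  by_cases hx : x ∈ tsupport ψ
  · rw [f.one_of_mem_closedBall (Metric.ball_subset_closedBall (hψ hx)), one_mul]
  · rw [image_eq_zero_of_notMem_tsupport hx, mul_zero]

/-! ### The forms on the frequency side -/

lemma exists_local_data {m : ℕ} {Ω : Opens (RR n)} {s₁ s₂ : ℝ} {u f : Fin m → 𝓓'(Ω, ℂ)}
    (hu : ∀ k, MemHsLoc Ω s₁ (u k)) (hf : ∀ k, MemHsLoc Ω s₂ (f k)) {x₀ : RR n} (hx₀ : x₀ ∈ Ω) :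
    ∃ V : Opens (RR n), x₀ ∈ V ∧ IsCompact (closure (V : Set (RR n))) ∧
      closure (V : Set (RR n)) ⊆ (Ω : Set (RR n)) ∧ ∃ U G : Fin m → 𝓢'(RR n, ℂ),
        (∀ l, MemSobolev s₁ 2 (U l)) ∧ (∀ l, MemSobolev s₂ 2 (G l)) ∧
        (∀ l, ∀ ψ : 𝓓(Ω, ℝ), tsupport ψ ⊆ V → U l (testToSchwartz ψ) = u l ψ) ∧
        ∀ l, ∀ ψ : 𝓓(Ω, ℝ), tsupport ψ ⊆ V → G l (testToSchwartz ψ) = f l ψ := by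
  obtain ⟨R, hR, hΩ⟩ := Metric.nhds_basis_closedBall.mem_iff.1 (Ω.isOpen.mem_nhds hx₀)
  choose U hU eU using fun l => exists_local_extension (hu l) hR hΩ
  choose G hG eG using fun l => exists_local_extension (hf l) hR hΩ
  have hcl : closure (Metric.ball x₀ (R / 2)) ⊆ Metric.closedBall x₀ R :=
    Metric.closure_ball_subset_closedBall.trans (Metric.closedBall_subset_closedBall (by linarith))
  exact ⟨⟨Metric.ball x₀ (R / 2), Metric.isOpen_ball⟩, Metric.mem_ball_self (by positivity),
    (isCompact_closedBall x₀ R).of_isClosed_subset isClosed_closure hcl, hcl.trans hΩ,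
    U, G, hU, hG, eU, eG⟩

lemma pair_zero_right (F : RR n → ℂ) : pair F (fun _ => 0) = 0 := by
  have := pair_const_mul_right (F := F) (h := fun _ : RR n => (0 : ℂ)) (by simp) 0
  simpa using this

lemma MemCbarPlus.sobolevDual_eq {V : Opens (RR n)} {γ s : ℝ} (hγ : 0 ≤ γ) (hs : -γ ≤ s)
    {g : RR n → ℂ} (hg : MemCbarPlus V γ g) {χ : 𝓢(RR n, ℂ)} (hχ : tsupport (χ : RR n → ℂ) ⊆ V)
    {U : 𝓢'(RR n, ℂ)} (hU : MemSobolev s 2 U) :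
    sobolevDual s U (ofFun fun x => g x * χ x) = pair (freq s U) (fun x => g x * χ x) :=
  sobolevDual_ofFun hU (memW_freq s U) (apply_eq_act_freq hU)
    ((hg.hasOrd hγ hχ).mono (by linarith))

lemma MemCbarPlus.sobolevDual_lineDeriv_eq {V : Opens (RR n)} {γ s : ℝ} (hγ : 0 ≤ γ)
    (hs : -γ ≤ s - 1) {g : RR n → ℂ} (hg : MemCbarPlus V γ g) {χ : 𝓢(RR n, ℂ)}
    (hχ : tsupport (χ : RR n → ℂ) ⊆ V) {U : 𝓢'(RR n, ℂ)} (hU : MemSobolev s 2 U) (j : Fin n) :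
    sobolevDual (s - 1) (∂_{dir j} U) (ofFun fun x => g x * χ x) =
      pair (fun ξ => dsym j ξ * freq s U ξ) (fun x => g x * χ x) :=
  sobolevDual_lineDeriv_ofFun hU (memW_freq s U) (apply_eq_act_freq hU) j
    ((hg.hasOrd hγ hχ).mono (by linarith))

lemma testToSchwartz_zero {Ω : Opens (RR n)} : testToSchwartz (0 : 𝓓(Ω, ℝ)) = 0 := by
  ext x; exact Complex.ofReal_zero

lemma tsupport_single {m : ℕ} {Ω V : Opens (RR n)} {r : 𝓓(Ω, ℝ)} (hr : tsupport r ⊆ V) (k k' : Fin m) :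
    tsupport ((Pi.single k r : Fin m → 𝓓(Ω, ℝ)) k') ⊆ V := by
  by_cases h : k' = k
  · subst h; simpa using hr
  · rw [Pi.single_eq_of_ne h]
    exact (tsupport_eq_empty_iff.2 rfl : tsupport ((0 : 𝓓(Ω, ℝ)) : RR n → ℝ) = ∅).subset.trans
      (Set.empty_subset _)

lemma tsupport_testToSchwartz_single {m : ℕ} {Ω V : Opens (RR n)} {r : 𝓓(Ω, ℝ)} (hr : tsupport r ⊆ V)
    (k k' : Fin m) : tsupport (testToSchwartz ((Pi.single k r : Fin m → 𝓓(Ω, ℝ)) k') : RR n → ℂ) ⊆ V := by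
  rw [tsupport_testToSchwartz]; exact tsupport_single hr k k'

lemma tsupport_lineDeriv_single {m : ℕ} {Ω V : Opens (RR n)} {r : 𝓓(Ω, ℝ)} (hr : tsupport r ⊆ V)
    (k k' : Fin m) (i : Fin n) :
    tsupport (∂_{dir i} (testToSchwartz ((Pi.single k r : Fin m → 𝓓(Ω, ℝ)) k')) : 𝓢(RR n, ℂ)) ⊆ V :=
  (SchwartzMap.tsupport_lineDerivOp_subset _ _).trans (tsupport_testToSchwartz_single hr k k')

/-- Testing with a vector having one nonzero component isolates the k-th equation of the system. -/
lemma Coeffs.form_single {m : ℕ} (A : Coeffs n m) {Ω V : Opens (RR n)} {s α β γ : ℝ}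
    (hα : 0 ≤ α) (hβ : 0 ≤ β) (hγ : 0 ≤ γ) (α₁ : -α ≤ s - 1) (β₁ : -β ≤ s - 1) (γ₁ : -γ ≤ s)
    (ha : ∀ i j k l, MemCbarPlus V α (fun x => A.a i j x k l))
    (hb : ∀ j k l, MemCbarPlus V β (fun x => A.b j x k l))
    (hc : ∀ k l, MemCbarPlus V γ (fun x => A.c x k l))
    {U : Fin m → 𝓢'(RR n, ℂ)} (hU : ∀ l, MemSobolev s 2 (U l)) {r : 𝓓(Ω, ℝ)} (hr : tsupport r ⊆ V)
    (k : Fin m) :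
    A.form s U (Pi.single k r) =
      (∑ i : Fin n, ∑ j : Fin n, ∑ l, pair (fun ξ => dsym j ξ * freq s (U l) ξ)
        (fun x => A.a i j x k l * (∂_{dir i} (testToSchwartz r)) x)) +
      (∑ j : Fin n, ∑ l, pair (fun ξ => dsym j ξ * freq s (U l) ξ)
        (fun x => A.b j x k l * (testToSchwartz r) x)) +
      ∑ l, pair (freq s (U l)) (fun x => A.c x k l * (testToSchwartz r) x) := by
  have e : ∀ (v : 𝓓(Ω, ℝ)) x, ((v x : ℝ) : ℂ) = testToSchwartz v x := fun _ _ => rfl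
  simp only [Coeffs.form, ← testFunction_lineDeriv_schwartz]
  simp only [e, (ha _ _ _ _).sobolevDual_lineDeriv_eq hα α₁ (tsupport_lineDeriv_single hr k _ _) (hU _),
    (hb _ _ _).sobolevDual_lineDeriv_eq hβ β₁ (tsupport_testToSchwartz_single hr k _) (hU _),
    (hc _ _).sobolevDual_eq hγ γ₁ (tsupport_testToSchwartz_single hr k _) (hU _)]
  congr 1
  · congr 1
    · refine Finset.sum_congr rfl fun i _ => Finset.sum_congr rfl fun j _ => ?_
      rw [Finset.sum_eq_single k]
      · simp
      · intro k' _ hk'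
        simp [Pi.single_eq_of_ne hk', testToSchwartz_zero, pair_zero_right]
      · simp
    · refine Finset.sum_congr rfl fun j _ => ?_
      rw [Finset.sum_eq_single k]
      · simp
      · intro k' _ hk'
        simp [Pi.single_eq_of_ne hk', testToSchwartz_zero, pair_zero_right]
      · simp
  · rw [Finset.sum_eq_single k]
    · simp
    · intro k' _ hk'
      simp [Pi.single_eq_of_ne hk', testToSchwartz_zero, pair_zero_right]
    · simp

/-- Here the test function pairs with the second matrix index and is differentiated in direction j,
so the transposition of the adjoint becomes visible as the exchange of i with j and of k with l. -/
lemma Coeffs.adjForm_single {m : ℕ} (A : Coeffs n m) {Ω V : Opens (RR n)} {s α β γ : ℝ}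
    (hα : 0 ≤ α) (hβ : 0 ≤ β) (hγ : 0 ≤ γ) (α₁ : -α ≤ s - 1) (β₁ : -β ≤ s) (γ₁ : -γ ≤ s)
    (ha : ∀ i j k l, MemCbarPlus V α (fun x => star (A.a i j x k l)))
    (hb : ∀ j k l, MemCbarPlus V β (fun x => star (A.b j x k l)))
    (hc : ∀ k l, MemCbarPlus V γ (fun x => star (A.c x k l)))
    {U : Fin m → 𝓢'(RR n, ℂ)} (hU : ∀ l, MemSobolev s 2 (U l)) {r : 𝓓(Ω, ℝ)} (hr : tsupport r ⊆ V)
    (l : Fin m) :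
    A.adjForm s U (Pi.single l r) =
      (∑ j : Fin n, ∑ i : Fin n, ∑ k, pair (fun ξ => dsym i ξ * freq s (U k) ξ)
        (fun x => star (A.a i j x k l) * (∂_{dir j} (testToSchwartz r)) x)) +
      (∑ j : Fin n, ∑ k, pair (freq s (U k))
        (fun x => star (A.b j x k l) * (∂_{dir j} (testToSchwartz r)) x)) +
      ∑ k, pair (freq s (U k)) (fun x => star (A.c x k l) * (testToSchwartz r) x) := by
  have e : ∀ (v : 𝓓(Ω, ℝ)) x, ((v x : ℝ) : ℂ) = testToSchwartz v x := fun _ _ => rfl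
  simp only [Coeffs.adjForm, ← testFunction_lineDeriv_schwartz]
  simp only [e, (ha _ _ _ _).sobolevDual_lineDeriv_eq hα α₁ (tsupport_lineDeriv_single hr l _ _) (hU _),
    (hb _ _ _).sobolevDual_eq hβ β₁ (tsupport_lineDeriv_single hr l _ _) (hU _),
    (hc _ _).sobolevDual_eq hγ γ₁ (tsupport_testToSchwartz_single hr l _) (hU _)]
  congr 1
  · congr 1
    · rw [Finset.sum_comm]
      refine Finset.sum_congr rfl fun i _ => Finset.sum_congr rfl fun j _ =>
        Finset.sum_congr rfl fun k _ => ?_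
      rw [Finset.sum_eq_single l]
      · simp
      · intro k' _ hk'
        simp [Pi.single_eq_of_ne hk', testToSchwartz_zero, pair_zero_right]
      · simp
    · refine Finset.sum_congr rfl fun j _ => Finset.sum_congr rfl fun k _ => ?_
      rw [Finset.sum_eq_single l]
      · simp
      · intro k' _ hk'
        simp [Pi.single_eq_of_ne hk', testToSchwartz_zero, pair_zero_right]
      · simp
  · refine Finset.sum_congr rfl fun k _ => ?_
    rw [Finset.sum_eq_single l]
    · simp
    · intro k' _ hk'
      simp [Pi.single_eq_of_ne hk', testToSchwartz_zero, pair_zero_right]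
    · simp

lemma MemCbarPlus.star {V : Opens (RR n)} {μ : ℝ} {g : RR n → ℂ} (h : MemCbarPlus V μ g) :
    MemCbarPlus V μ (fun x => Star.star (g x)) := by
  have key : ∀ ν, MemCbar V ν g → MemCbar V ν (fun x => Star.star (g x)) := fun ν ⟨G, hG, e⟩ =>
    ⟨fun x => Star.star (G x), MemWkInfty.star hG, e.mono fun x hx => by simp only [hx]⟩
  exact h.imp (fun h => ⟨h.1, key _ h.2⟩) fun ⟨h1, ν, h2, h3⟩ => ⟨h1, ν, h2, key ν h3⟩

lemma memCbarPlus_zero (V : Opens (RR n)) (k : ℕ) : MemCbarPlus V k (fun _ => 0) :=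
  Or.inl ⟨⟨k, rfl⟩, fun _ => 0, memWkInfty_const 0, Eventually.of_forall fun _ => rfl⟩

/-! ### Coefficient exponents and the two local systems -/

/-- The exponent of the coefficients `b` for the class of order `σ`. -/
abbrev expB (σ : ℝ) : ℝ := max 0 (|σ - 1 / 2| - 1 / 2)

/-- The exponent of the coefficients `c` for the class of order `σ`. -/
abbrev expC (σ : ℝ) : ℝ := max 0 (|σ| - 1)

/-- Since |σ - 1/2| - 1/2 = max(σ - 1, -σ), the exponent dominates both: -σ₁ is needed to multiply
∂u of order σ₁, and σ₂ - 1 to reach the order of the right-hand side. -/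
lemma le_expB (σ : ℝ) : σ - 1 ≤ expB σ := by
  have := le_abs_self (σ - 1 / 2)
  exact le_max_of_le_right (by linarith)

lemma neg_le_expB (σ : ℝ) : -σ ≤ expB σ := by
  have := neg_le_abs (σ - 1 / 2)
  exact le_max_of_le_right (by linarith)

lemma le_expC (σ : ℝ) : σ - 1 ≤ expC σ := by
  have := le_abs_self σ
  exact le_max_of_le_right (by linarith)

lemma neg_le_expC (σ : ℝ) : -σ - 1 ≤ expC σ := by
  have := neg_le_abs σ
  exact le_max_of_le_right (by linarith)

section Local

variable {m : ℕ} {Ω V : Opens (RR n)} {s₁ s₂ : ℝ} {A : Coeffs n m} {u f : Fin m → 𝓓'(Ω, ℂ)}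
  {U G : Fin m → 𝓢'(RR n, ℂ)}

lemma isExtensionNear_single (hU : ∀ l, MemSobolev s₁ 2 (U l))
    (eU : ∀ l, ∀ ψ : 𝓓(Ω, ℝ), tsupport ψ ⊆ V → U l (testToSchwartz ψ) = u l ψ) {r : 𝓓(Ω, ℝ)}
    (hr : tsupport r ⊆ V) (k : Fin m) : IsExtensionNear s₁ u (Pi.single k r) U :=
  ⟨hU, V, V.isOpen, fun k' => tsupport_single hr k k', eU⟩

lemma sum_apply_single (r : 𝓓(Ω, ℝ)) (k : Fin m) :
    ∑ k', f k' ((Pi.single k r : Fin m → 𝓓(Ω, ℝ)) k') = f k r := by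
  rw [Finset.sum_eq_single k]
  · simp
  · intro k' _ hk'
    rw [Pi.single_eq_of_ne hk', map_zero]
  · simp

theorem Coeffs.Satisfies.locReg (hs : s₁ - 2 < s₂) (hV : V ≤ Ω) (hell : StronglyElliptic Ω A.a)
    (hL : A.Satisfies Ω s₁ u f) (h1 : A.MemClass V (s₁ - 1)) (h2 : A.MemClass V (s₂ + 1))
    (hU : ∀ l, MemSobolev s₁ 2 (U l)) (hG : ∀ l, MemSobolev s₂ 2 (G l))
    (eU : ∀ l, ∀ ψ : 𝓓(Ω, ℝ), tsupport ψ ⊆ V → U l (testToSchwartz ψ) = u l ψ)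
    (eG : ∀ l, ∀ ψ : 𝓓(Ω, ℝ), tsupport ψ ⊆ V → G l (testToSchwartz ψ) = f l ψ) :
    LocReg (fun l => freq s₁ (U l)) V (s₂ + 2) := by
  set β := max (expB (s₁ - 1)) (expB (s₂ + 1))
  set γ := max (expC (s₁ - 1)) (expC (s₂ + 1))
  -- The d-term is absent in this case; zero belongs to every class, so any natural number large
  -- enough for the order constraints will do.
  set δ := ⌈max (-s₁) (s₂ + 1)⌉₊
  have hδ : max (-s₁) (s₂ + 1) ≤ δ := Nat.le_ceil _
  have ha := fun i j k l => (h1.1 i j k l).max (h2.1 i j k l)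
  have hb := fun j k l => (h1.2.1 j k l).max (h2.2.1 j k l)
  have hc := fun k l => (h1.2.2 k l).max (h2.2.2 k l)
  have hβ : 0 ≤ β := le_max_of_le_left (le_max_left _ _)
  have hγ : 0 ≤ γ := le_max_of_le_left (le_max_left _ _)
  have β₁ : -β ≤ s₁ - 1 := by
    have := (neg_le_expB (s₁ - 1)).trans (le_max_left _ (expB (s₂ + 1)))
    linarith
  have β₂ : s₂ + 1 - 1 ≤ β := (le_expB (s₂ + 1)).trans (le_max_right (expB (s₁ - 1)) _)
  have γ₁ : -γ ≤ s₁ := by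
    have := (neg_le_expC (s₁ - 1)).trans (le_max_left _ (expC (s₂ + 1)))
    linarith
  have γ₂ : s₂ + 1 - 1 ≤ γ := (le_expC (s₂ + 1)).trans (le_max_right (expC (s₁ - 1)) _)
  have δ₁ := (le_max_left _ _).trans hδ
  have δ₂ := (le_max_right _ _).trans hδ
  have α₁ : -max |s₁ - 1| |s₂ + 1| ≤ s₁ - 1 := by
    have := (neg_le_abs (s₁ - 1)).trans (le_max_left _ |s₂ + 1|)
    linarith
  let X : Sys n m :=
    { a := fun i j k l x => A.a i j x k l
      b := fun j k l x => A.b j x k l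
      d := fun _ _ _ _ => 0
      c := fun k l x => A.c x k l
      F := fun l => freq s₁ (U l)
      Φ := fun l => freq s₂ (G l)
      α := max |s₁ - 1| |s₂ + 1|
      β := β
      δ := δ
      γ := γ }
  have hX : LocReg X.F V (s₂ + 1 + 1) := by
    refine X.exists_regOn (σ₁ := s₁ - 1) (by linarith) rfl hβ (Nat.cast_nonneg _) hγ hV ha hb
      (fun _ _ _ => memCbarPlus_zero V _) hc β₁ β₂ ?_ δ₂ ?_ γ₂ (fun l => ?_) (fun l => ?_)
      (hell.congr hV fun i j k l => Eventually.of_forall fun x => rfl) fun r hr k => ?_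
    · change -(δ : ℝ) ≤ _
      linarith
    · change -γ ≤ _
      linarith
    · simpa using memW_freq s₁ (U l)
    · simpa using memW_freq s₂ (G l)
    · have := hL _ U (isExtensionNear_single hU eU hr k)
      rw [A.form_single (V := V) ((abs_nonneg _).trans (le_max_left |s₁ - 1| |s₂ + 1|)) hβ hγ α₁ β₁ γ₁
        ha hb hc hU hr k, sum_apply_single, ← eG k r hr, apply_eq_act_freq (hG k)] at this
      simpa [Sys.Eqn, X, pair_zero_right] using this
  rwa [add_assoc, one_add_one_eq_two] at hX

theorem Coeffs.AdjSatisfies.locReg (hs : s₁ - 2 < s₂) (hV : V ≤ Ω)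
    (hell : StronglyElliptic Ω A.adjLeading)
    (hL : A.AdjSatisfies Ω s₁ u f) (h1 : A.MemClass V (1 - s₁)) (h2 : A.MemClass V (-s₂ - 1))
    (hU : ∀ l, MemSobolev s₁ 2 (U l)) (hG : ∀ l, MemSobolev s₂ 2 (G l))
    (eU : ∀ l, ∀ ψ : 𝓓(Ω, ℝ), tsupport ψ ⊆ V → U l (testToSchwartz ψ) = u l ψ)
    (eG : ∀ l, ∀ ψ : 𝓓(Ω, ℝ), tsupport ψ ⊆ V → G l (testToSchwartz ψ) = f l ψ) :
    LocReg (fun l => freq s₁ (U l)) V (s₂ + 2) := by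
  set δ := max (expB (1 - s₁)) (expB (-s₂ - 1))
  set γ := max (expC (1 - s₁)) (expC (-s₂ - 1))
  set β := ⌈max (1 - s₁) s₂⌉₊
  have hβ : max (1 - s₁) s₂ ≤ β := Nat.le_ceil _
  have ha := fun i j k l => ((h1.1 i j k l).max (h2.1 i j k l)).star
  have hb := fun j k l => ((h1.2.1 j k l).max (h2.2.1 j k l)).star
  have hc := fun k l => ((h1.2.2 k l).max (h2.2.2 k l)).star
  have hδ : 0 ≤ δ := le_max_of_le_left (le_max_left _ _)
  have hγ : 0 ≤ γ := le_max_of_le_left (le_max_left _ _)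
  have δ₁ : -δ ≤ s₁ := by
    have := (le_expB (1 - s₁)).trans (le_max_left _ (expB (-s₂ - 1)))
    linarith
  have δ₂ : s₂ + 1 ≤ δ := by
    have := (neg_le_expB (-s₂ - 1)).trans (le_max_right (expB (1 - s₁)) _)
    linarith
  have γ₁ : -γ ≤ s₁ := by
    have := (le_expC (1 - s₁)).trans (le_max_left _ (expC (-s₂ - 1)))
    linarith
  have γ₂ : s₂ + 1 - 1 ≤ γ := by
    have := (neg_le_expC (-s₂ - 1)).trans (le_max_right (expC (1 - s₁)) _)
    linarith
  have β₁ := (le_max_left _ _).trans hβ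
  have β₂ := (le_max_right _ _).trans hβ
  have α₁ : -max |1 - s₁| |-s₂ - 1| ≤ s₁ - 1 := by
    have := (le_abs_self (1 - s₁)).trans (le_max_left _ |-s₂ - 1|)
    linarith
  -- In the adjoint the first-order term is in divergence form, so b̄ᵀ fills the place of `d` and
  -- `b` vanishes. Because the classes have the orders 1 - s₁ = -σ₁ and -s₂ - 1 = -σ₂, the two
  -- bounds on each exponent change roles compared with the direct case.
  let X : Sys n m :=
    { a := fun i j k l x => star (A.a j i x l k)
      b := fun _ _ _ _ => 0
      d := fun j k l x => star (A.b j x l k)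
      c := fun k l x => star (A.c x l k)
      F := fun l => freq s₁ (U l)
      Φ := fun l => freq s₂ (G l)
      α := max |1 - s₁| |-s₂ - 1|
      β := β
      δ := δ
      γ := γ }
  have hα : X.α = max |s₁ - 1| |s₂ + 1| := by
    change max |1 - s₁| |-s₂ - 1| = _
    rw [abs_sub_comm, ← abs_neg (s₂ + 1)]
    congr 2
    ring
  have hX : LocReg X.F V (s₂ + 1 + 1) := by
    refine X.exists_regOn (σ₁ := s₁ - 1) (by linarith) hα (Nat.cast_nonneg _) hδ hγ hV
      (fun i j k l => ha j i l k) (fun _ _ _ => memCbarPlus_zero V _) (fun j k l => hb j l k)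
      (fun k l => hc l k) ?_ ?_ ?_ δ₂ ?_ γ₂ (fun l => ?_) (fun l => ?_)
      (hell.congr hV fun i j k l => Eventually.of_forall fun x => rfl) fun r hr k => ?_
    · change -(β : ℝ) ≤ _
      linarith
    · change _ ≤ (β : ℝ)
      linarith
    · change -δ ≤ _
      linarith
    · change -γ ≤ _
      linarith
    · simpa using memW_freq s₁ (U l)
    · simpa using memW_freq s₂ (G l)
    · have := hL _ U (isExtensionNear_single hU eU hr k)
      rw [A.adjForm_single (V := V) ((abs_nonneg _).trans (le_max_left |1 - s₁| |-s₂ - 1|)) hδ hγ α₁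
        δ₁ γ₁ ha hb hc hU hr k, sum_apply_single, ← eG k r hr, apply_eq_act_freq (hG k)] at this
      simpa [Sys.Eqn, X, pair_zero_right] using this
  rwa [add_assoc, one_add_one_eq_two] at hX

end Local

end EllipticReg

end

/-! ### From the local systems to the theorem -/

theorem mainTheorem1 {n m : ℕ} (hm : 1 ≤ m)
    (Ω : TopologicalSpace.Opens (EllipticReg.RR n)) (s₁ s₂ : ℝ) (hs : s₁ - 2 < s₂)
    (A : EllipticReg.Coeffs n m) (u f : Fin m → 𝓓'(Ω, ℂ))
    (hu : ∀ k, EllipticReg.MemHsLoc Ω s₁ (u k))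
    (hf : ∀ k, EllipticReg.MemHsLoc Ω s₂ (f k))
    (hL : (EllipticReg.StronglyElliptic Ω A.a ∧ A.Satisfies Ω s₁ u f ∧
            A.MemClassLoc Ω (s₁ - 1) ∧ A.MemClassLoc Ω (s₂ + 1)) ∨
          (EllipticReg.StronglyElliptic Ω A.adjLeading ∧ A.AdjSatisfies Ω s₁ u f ∧
            A.MemClassLoc Ω (1 - s₁) ∧ A.MemClassLoc Ω (-s₂ - 1))) :
    ∀ k, EllipticReg.MemHsLoc Ω (s₂ + 2) (u k) := by
  intro k
  refine EllipticReg.memHsLoc_of_local fun x₀ hx₀ => ?_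
  obtain ⟨V, hxV, hVc, hVΩ, U, G, hU, hG, eU, eG⟩ := EllipticReg.exists_local_data hu hf hx₀
  have hV : V ≤ Ω := subset_closure.trans hVΩ
  have hR : EllipticReg.LocReg (fun l => EllipticReg.freq s₁ (U l)) V (s₂ + 2) := by
    rcases hL with ⟨hell, hL, h1, h2⟩ | ⟨hell, hL, h1, h2⟩
    · exact hL.locReg hs hV hell (h1 V hVc hVΩ) (h2 V hVc hVΩ) hU hG eU eG
    · exact hL.locReg hs hV hell (h1 V hVc hVΩ) (h2 V hVc hVΩ) hU hG eU eG
  obtain ⟨r, hr, hreg⟩ := hR x₀ hxV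
  obtain ⟨ρ, hρ, hρV⟩ := Metric.isOpen_iff.1 V.isOpen x₀ hxV
  -- Inside radius ρ the extension U represents u; inside radius r its products with cutoffs have
  -- the improved order.
  refine ⟨min r ρ, lt_min hr hρ, EllipticReg.freq s₁ (U k), fun ψ hψ => ?_, fun φ hc hφ => ?_⟩
  · rw [← EllipticReg.apply_eq_act_freq (hU k)]
    exact eU k ψ ((hψ.trans (Metric.ball_subset_ball (min_le_right _ _))).trans hρV)
  · exact hreg φ hc (hφ.trans (Metric.ball_subset_ball (min_le_left _ _))) k
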